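/- **Setting.** Write $\langle y\rangle=(1+|y|^2)^{1/2}$, $\langle y,z\rangle=(1+|y|^2+|z|^2)^{1/2}$, $|y,z|=(|y|^2+|z|^2)^{1/2}$. Let $n,L,M,L',M'\in\mathbb N_0$ and $d\in\mathbb R$. *Function spaces.* $H^s(\mathbb R)$ is the $L^2$-Sobolev space of order $s\in\mathbb R$; $H^{s}_0(\overline{\mathbb R}_+)$ is the subspace of distributions supported in $[0,\infty)$; $H^s(\mathbb R_+)$ is the space of restrictions to $\mathbb R_+=(0,\infty)$ of elements of $H^s(\mathbb R)$, with the quotient norm. With the isomorphism $\theta:\mathscr D'(\mathbb R_+)\to\mathscr D'(\mathbb R)$, $\langle\theta u,\varphi\rangle=\langle u,\varphi(-\ln t)/t\rangle$, and a cut-off function $\omega$ (smooth on $[0,\infty)$ with bounded support, $\omega=1$ near $0$), $\mathcal K^{s,\gamma}(\mathbb R_+)$ consists of all $u\in\mathscr D'(\mathbb R_+)$ with $\theta(t^{1/2-\gamma}\omega u)\in H^s(\mathbb R)$ and $(1-\omega)u\in H^s(\mathbb R_+)$, normed by the sum of the two norms. Put $H^{s,\delta}_0(\overline{\mathbb R}_+)=\langle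 t\rangle^{-\delta}H^s_0(\overline{\mathbb R}_+)$, $H^{s,\delta}(\mathbb R_+)=\langle t\rangle^{-\delta}H^s(\mathbb R_+)$, $\mathcal K^{s,\gamma}(\mathbb R_+)^\delta=\langle t\rangle^{-\delta}\mathcal K^{s,\gamma}(\mathbb R_+)$. On spaces $\mathcal E(\mathbb C^N)\oplus\mathbb C^{K}$, with $\mathcal E$ one of these spaces, let $\kappa_\lambda(u\oplus z)=(\kappa_\lambda u)\oplus z$, where $(\kappa_\lambda u)(t)=\lambda^{1/2}u(\lambda t)$, $\lambda>0$. *Strongly parameter-dependent symbols.* Let $E_0,E_1$ be two such spaces. $S^d_{1,0}(E_0,E_1)$ is the space of smooth $a:\mathbb R^n_x\times\mathbb R^n_\xi\times[0,\infty)_\mu\to\mathscr L(E_0,E_1)$ such that, for all $\alpha,\beta,j$, uniformly in $(x,\xi,\mu)$, $$\|\kappa^{-1}_{\langle\xi,\mu\rangle}\{D^\alpha_\xi D^\beta_xD^j_\mu a\}\kappa_{\langle\xi,\mu\rangle}\|\le C_{\alpha\beta j}\langle\xi,\mu\rangle^{d-|\alpha|-j}.$$ $S^{(d)}(E_0,E_1)$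 is the space of smooth $a$ defined for $\mu\ge0$, $(\xi,\mu)\ne0$, that are $\kappa$-homogeneous, $a(x,\lambda\xi;\lambda\mu)=\lambda^d\kappa_\lambda a(x,\xi;\mu)\kappa_\lambda^{-1}$ for $\lambda>0$, and satisfy the same estimates with $|\xi,\mu|$ in place of $\langle\xi,\mu\rangle$. $S^d(E_0,E_1)$ (classical symbols) is the space of $a\in S^d_{1,0}(E_0,E_1)$ for which there are $a_j\in S^{(d-j)}(E_0,E_1)$, $j\in\mathbb N_0$, with $a-\sum_{j<N}\chi(\xi,\mu)a_j\in S^{d-N}_{1,0}(E_0,E_1)$ for all $N$; here $\chi$ is a $0$-excision function (smooth, $0$ near the origin and $1$ near infinity), whose choice is irrelevant. *Weakly parameter-dependent symbols.* For $\nu\in\mathbb R$, $\widetilde S^{d,\nu}_{1,0}(E_0,E_1)_{\boldsymbol\kappa,\boldsymbol\kappa}$ is defined as $S^d_{1,0}(E_0,E_1)$, but with the right-hand side $C_{\alpha\beta j}\langle\xi\rangle^{\nu-|\alpha|}\langle\xi,\mu\rangle^{d-\nu-j}$. Replacing the first subscript $\boldsymbol\kappa$ by $\kappa$ means replacing the factor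 $\kappa_{\langle\xi,\mu\rangle}$ on the right of $\{\cdot\}$ by $\kappa_{\langle\xi\rangle}$; replacing the second one means replacing the factor $\kappa^{-1}_{\langle\xi,\mu\rangle}$ on the left by $\kappa^{-1}_{\langle\xi\rangle}$. The spaces $\widetilde S^{(d,\nu)}(E_0,E_1)$ consist of the smooth functions defined for $\mu\ge0$, $\xi\neq0$ that are $\kappa$-homogeneous of degree $d$ and satisfy the same estimates with $|\xi|$, $|\xi,\mu|$ in place of $\langle\xi\rangle$, $\langle\xi,\mu\rangle$; the classical spaces $\widetilde S^{d,\nu}(E_0,E_1)$ are defined by expansions $a-\sum_{j<N}\chi(\xi)a_j\in\widetilde S^{d-N,\nu-N}_{1,0}$ with $a_j\in\widetilde S^{(d-j,\nu-j)}$ (same subscripts). *Green symbols.* Operators on different spaces are identified if they agree on $C_c^\infty(\mathbb R_+,\mathbb C^L)\oplus\mathbb C^M$, which is dense in all source spaces. Let $$\mathcal B^{d;0}_G=\bigcap_{s,s',\delta,\delta'\in\mathbb R}S^d\big(H^{s,\delta}_0(\overline{\mathbb R}_+,\mathbb C^L)\oplus\mathbb C^M,\;H^{s',\delta'}(\mathbb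 R_+,\mathbb C^{L'})\oplus\mathbb C^{M'}\big),$$ and let $\widetilde{\mathcal B}^{d,\nu;0}_G$ be the space of symbols that for all $s,s',\delta,\delta'\in\mathbb R$ belong to each of $$\begin{aligned}&\widetilde S^{d,\nu}\big(H^{s}_0(\overline{\mathbb R}_+,\mathbb C^L)\oplus\mathbb C^M,\,H^{s'}(\mathbb R_+,\mathbb C^{L'})\oplus\mathbb C^{M'}\big)_{\boldsymbol\kappa,\boldsymbol\kappa},\\ &\widetilde S^{d,\nu}\big(H^{s}_0(\overline{\mathbb R}_+,\mathbb C^L)\oplus\mathbb C^M,\,\mathcal K^{s',0}(\mathbb R_+,\mathbb C^{L'})^{\delta'}\oplus\mathbb C^{M'}\big)_{\boldsymbol\kappa,\kappa},\\ &\widetilde S^{d,\nu}\big(\mathcal K^{s,0}(\mathbb R_+,\mathbb C^L)^\delta\oplus\mathbb C^M,\,H^{s'}(\mathbb R_+,\mathbb C^{L'})\oplus\mathbb C^{M'}\big)_{\kappa,\boldsymbol\kappa},\\ &\widetilde S^{d,\nu}\big(\mathcal K^{s,0}(\mathbb R_+,\mathbb C^L)^\delta\oplus\mathbb C^M,\,\mathcal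 K^{s',0}(\mathbb R_+,\mathbb C^{L'})^{\delta'}\oplus\mathbb C^{M'}\big)_{\kappa,\kappa}.\end{aligned}$$ The spaces $\mathcal B^{(d);0}_G$ and $\widetilde{\mathcal B}^{(d,\nu);0}_G$ of $\kappa$-homogeneous symbols are defined in the same way with $S^{(d)}$ and $\widetilde S^{(d,\nu)}$. Finally, $\mathcal B^{d,\nu;0}_G=\mathcal B^{d;0}_G+\widetilde{\mathcal B}^{d,\nu;0}_G$ (non-direct sum). **Proposition.** 1. $\mathcal B^{d;0}_G\subset\widetilde{\mathcal B}^{d,0;0}_G$. 2. $\mathcal B^{(d);0}_G\subset\widetilde{\mathcal B}^{(d,0);0}_G$, in the sense that the restriction to $\{\xi\ne0\}$ of every element of $\mathcal B^{(d);0}_G$ belongs to $\widetilde{\mathcal B}^{(d,0);0}_G$. 3. $\mathcal B^{d,\nu;0}_G=\widetilde{\mathcal B}^{d,\nu;0}_G$ for every $\nu\le0$. -/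

import Mathlib

open scoped SchwartzMap Distributions ContDiff
open MeasureTheory

noncomputable section

namespace GreenSymbols

/-! ### Test functions and distributions on the half-line -/

/-- The open half-line `ℝ₊ = (0, ∞)`. -/
def halfLine : TopologicalSpace.Opens ℝ := ⟨Set.Ioi 0, isOpen_Ioi⟩

/-- `C_c^∞(ℝ₊)`. -/
abbrev Test : Type := 𝓓(halfLine, ℂ)

/-- `C_c^∞(ℝ)`. -/
abbrev TestR : Type := 𝓓((⊤ : TopologicalSpace.Opens ℝ), ℂ)

/-- Linear functionals on `C_c^∞(ℝ₊)`: the vector space in which all spaces of distributions on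
`ℝ₊` live. Continuity is not imposed here, because the members of each of the function spaces below
are automatically distributions. -/
abbrev Dist : Type := Test →ₗ[ℂ] ℂ

/-- A test function on an open subset of the line, as a Schwartz function. -/
def toSchwartz {Ω : TopologicalSpace.Opens ℝ} : 𝓓(Ω, ℂ) →ₗ[ℂ] 𝓢(ℝ, ℂ) where
  toFun φ := φ.hasCompactSupport.toSchwartzMap φ.contDiff
  map_add' φ ψ := by ext t; simp
  map_smul' c φ := by ext t; simp

/-- A function that is smooth on `Ω` and vanishes off a compact subset of `Ω` is a test function. -/
def mkTest {Ω : TopologicalSpace.Opens ℝ} (f : ℝ → ℂ) (hf : ContDiffOn ℝ ∞ f Ω)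
    (hK : ∃ K : Set ℝ, IsCompact K ∧ K ⊆ Ω ∧ ∀ t, t ∉ K → f t = 0) : 𝓓(Ω, ℂ) where
  toFun := f
  contDiff' := by
    obtain ⟨K, hKc, hKΩ, hK0⟩ := hK
    rw [contDiff_iff_contDiffAt]
    intro t
    by_cases ht : t ∈ K
    · exact hf.contDiffAt (Ω.isOpen.mem_nhds (hKΩ ht))
    · have : f =ᶠ[nhds t] fun _ => (0 : ℂ) := by
        filter_upwards [hKc.isClosed.isOpen_compl.mem_nhds ht] with r hr using hK0 r hr
      exact contDiffAt_const.congr_of_eventuallyEq this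
  hasCompactSupport' := by
    obtain ⟨K, hKc, -, hK0⟩ := hK
    exact HasCompactSupport.intro hKc hK0
  tsupport_subset' := by
    obtain ⟨K, hKc, hKΩ, hK0⟩ := hK
    refine (closure_minimal (fun t ht => ?_) hKc.isClosed).trans hKΩ
    by_contra h
    exact ht (hK0 t h)

theorem test_zero {Ω : TopologicalSpace.Opens ℝ} (φ : 𝓓(Ω, ℂ)) {t : ℝ} (ht : t ∉ tsupport φ) :
    φ t = 0 := image_eq_zero_of_notMem_tsupport ht

/-- Multiplication `φ ↦ m φ` of test functions on `ℝ₊` by a function that is smooth on `ℝ₊`. -/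
def mulTest (m : ℝ → ℝ) (hm : ContDiffOn ℝ ∞ m (Set.Ioi 0)) : Test →ₗ[ℂ] Test where
  toFun φ := mkTest (fun t => (m t : ℂ) * φ t)
    ((Complex.ofRealCLM.contDiff.comp_contDiffOn hm).mul φ.contDiff.contDiffOn)
    ⟨tsupport φ, φ.hasCompactSupport, φ.tsupport_subset, fun t ht => by simp [test_zero φ ht]⟩
  map_add' φ ψ := by ext t; simp [mkTest, mul_add]
  map_smul' c φ := by ext t; simp [mkTest]; ring

/-- The standard group action `(κ_r φ)(t) = r^{1/2} φ(r t)` on `C_c^∞(ℝ₊)`. -/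
def dilTest (r : ℝ) (hr : 0 < r) : Test →ₗ[ℂ] Test where
  toFun φ := mkTest (fun t => ((r ^ (1 / 2 : ℝ) : ℝ) : ℂ) * φ (r * t))
    (contDiff_const.mul (φ.contDiff.comp (contDiff_const.mul contDiff_id))).contDiffOn
    ⟨(fun t => r⁻¹ * t) '' tsupport φ, φ.hasCompactSupport.isCompact.image (by fun_prop), by
      rintro _ ⟨t, ht, rfl⟩
      exact mul_pos (inv_pos.2 hr) (φ.tsupport_subset ht), fun t ht => by
      rw [test_zero φ (t := r * t), mul_zero]
      exact fun h => ht ⟨r * t, h, by field_simp⟩⟩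
  map_add' φ ψ := by ext t; simp [mkTest, mul_add]
  map_smul' c φ := by ext t; simp [mkTest]; ring

/-- The standard group action `(κ_r φ)(t) = r^{1/2} φ(r t)` on `𝓢(ℝ)`. -/
def dilSchwartz (r : ℝ) (hr : 0 < r) : 𝓢(ℝ, ℂ) →L[ℂ] 𝓢(ℝ, ℂ) :=
  ((r ^ (1 / 2 : ℝ) : ℝ) : ℂ) • SchwartzMap.compCLMOfContinuousLinearEquiv ℂ
    (ContinuousLinearEquiv.smulLeft (M₁ := ℝ) (R₁ := ℝ) (Units.mk0 r hr.ne'))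

/-- The substitution `φ ↦ (t ↦ φ(-ln t)/t)`, mapping `C_c^∞(ℝ)` to `C_c^∞(ℝ₊)`. Its transpose is
the isomorphism `θ` of distributions on `ℝ₊` with distributions on `ℝ`. -/
def thetaTest : TestR →ₗ[ℂ] Test where
  toFun φ := mkTest (fun t => if 0 < t then ((t⁻¹ : ℝ) : ℂ) * φ (-Real.log t) else 0)
    (by
      have h : ContDiffOn ℝ ∞ (fun t : ℝ => ((t⁻¹ : ℝ) : ℂ) * φ (-Real.log t)) (Set.Ioi 0) := by
        refine ContDiffOn.mul ?_ (φ.contDiff.comp_contDiffOn (ContDiffOn.neg ?_))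
        · exact Complex.ofRealCLM.contDiff.comp_contDiffOn
            (contDiffOn_id.inv fun t ht => (ne_of_gt ht))
        · exact contDiffOn_id.log fun t ht => (ne_of_gt ht)
      exact h.congr fun t ht => if_pos ht)
    ⟨(fun r => Real.exp (-r)) '' tsupport φ,
      φ.hasCompactSupport.isCompact.image (by fun_prop), by
      rintro _ ⟨r, -, rfl⟩
      exact Real.exp_pos _, fun t ht => by
      split_ifs with h
      · rw [test_zero φ, mul_zero]
        exact fun h' => ht ⟨_, h', by simp [Real.exp_log h]⟩
      · rfl⟩
  map_add' φ ψ := by ext t; simp only [mkTest]; simp; split_ifs <;> simp [mul_add]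
  map_smul' c φ := by ext t; simp only [mkTest]; simp; split_ifs <;> ring

/-- The inverse substitution `ψ ↦ (r ↦ e^{-r} ψ(e^{-r}))`. -/
def thetaInvTest : Test →ₗ[ℂ] TestR where
  toFun ψ := mkTest (fun r => ((Real.exp (-r) : ℝ) : ℂ) * ψ (Real.exp (-r)))
    (by
      have h : ContDiff ℝ ∞ (fun r : ℝ => Real.exp (-r)) := contDiff_neg.exp
      exact ((Complex.ofRealCLM.contDiff.comp h).mul (ψ.contDiff.comp h)).contDiffOn)
    ⟨(fun t => -Real.log t) '' tsupport ψ, by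
      refine ψ.hasCompactSupport.isCompact.image_of_continuousOn (ContinuousOn.neg ?_)
      exact Real.continuousOn_log.mono fun t ht => ne_of_gt (ψ.tsupport_subset ht),
      fun _ _ => trivial, fun r hr => by
      rw [test_zero ψ, mul_zero]
      exact fun h => hr ⟨_, h, by simp⟩⟩
  map_add' φ ψ := by ext t; simp [mkTest, mul_add]
  map_smul' c φ := by ext t; simp [mkTest]; ring

theorem thetaTest_thetaInvTest (ψ : Test) : thetaTest (thetaInvTest ψ) = ψ := by
  ext t
  by_cases ht : 0 < t
  · have : (t : ℂ) ≠ 0 := Complex.ofReal_ne_zero.2 ht.ne'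
    change (if 0 < t then ((t⁻¹ : ℝ) : ℂ) * (((Real.exp (-(-Real.log t)) : ℝ) : ℂ) *
      ψ (Real.exp (-(-Real.log t)))) else 0) = ψ t
    rw [if_pos ht, neg_neg, Real.exp_log ht]
    push_cast
    field_simp
  · change (if 0 < t then ((t⁻¹ : ℝ) : ℂ) * (thetaInvTest ψ) (-Real.log t) else 0) = ψ t
    rw [if_neg ht, test_zero ψ fun h => ht (ψ.tsupport_subset h)]

/-- `⟨t⟩^δ = (1 + t²)^{δ/2}`. -/
def japanese (δ : ℝ) (t : ℝ) : ℝ := (1 + ‖t‖ ^ 2) ^ (δ / 2)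

theorem contDiff_japanese (δ : ℝ) : ContDiff ℝ ∞ (japanese δ) := by
  unfold japanese
  refine (contDiff_const.add (contDiff_norm_sq ℝ)).rpow_const_of_ne fun t => ?_
  positivity

theorem japanese_neg_mul (δ t : ℝ) : japanese δ t * japanese (-δ) t = 1 := by
  unfold japanese
  rw [← Real.rpow_add (by positivity)]
  ring_nf
  simp

/-- The cut-off function `ω`, equal to `1` for `t ≤ 1` and to `0` for `t ≥ 2`. -/
def cutoff (t : ℝ) : ℝ := Real.smoothTransition (2 - t)

theorem contDiff_cutoff : ContDiff ℝ ∞ cutoff :=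
  Real.smoothTransition.contDiff.comp (contDiff_const.sub contDiff_id)

/-! ### The function spaces on the half-line -/

/-- `L²(ℝ)`. -/
abbrev L2 : Type := Lp ℂ 2 (volume : Measure ℝ)

/-- The isometric parametrization `f ↦ ⟨t⟩^{-δ} ⟨D⟩^{-s} f` of the weighted Sobolev space
`H^{s,δ}(ℝ) = ⟨t⟩^{-δ} H^s(ℝ)` by `L²(ℝ)`. The elements of all Sobolev spaces on the line are
represented below through this parametrization. -/
def sobolev (s δ : ℝ) : L2 →L[ℂ] 𝓢'(ℝ, ℂ) :=
  (TemperedDistribution.smulLeftCLM ℂ (fun t : ℝ => ((japanese (-δ) t : ℝ) : ℂ))).comp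
    ((TemperedDistribution.besselPotential ℝ ℂ (-s)).comp
      (Lp.toTemperedDistributionCLM ℂ (volume : Measure ℝ) 2))

/-- Restriction of tempered distributions to `ℝ₊`. -/
def restrict : 𝓢'(ℝ, ℂ) →ₗ[ℂ] Dist where
  toFun u := { toFun φ := u (toSchwartz φ), map_add' := by simp, map_smul' := by simp }
  map_add' u v := by ext φ; simp
  map_smul' c u := by ext φ; simp

/-- `H^{s,δ}_0([0,∞))`: the elements of `H^{s,δ}(ℝ)` with support in `[0,∞)`. -/
def hZero (s δ : ℝ) : Submodule ℂ L2 where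
  carrier := {f | Distribution.IsVanishingOn (sobolev s δ f) (Set.Iio 0)}
  add_mem' hf hg φ hφ := by simp [hf φ hφ, hg φ hφ]
  zero_mem' φ _ := by simp
  smul_mem' c f hf φ hφ := by simp [hf φ hφ]

def HZero (s δ : ℝ) : Type := hZero s δ

instance (s δ : ℝ) : NormedAddCommGroup (HZero s δ) := inferInstanceAs (NormedAddCommGroup (hZero s δ))

instance (s δ : ℝ) : NormedSpace ℂ (HZero s δ) := inferInstanceAs (NormedSpace ℂ (hZero s δ))

/-- The tempered distribution given by an element of `H^{s,δ}_0([0,∞))`. -/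
def hZeroDist (s δ : ℝ) : HZero s δ →ₗ[ℂ] 𝓢'(ℝ, ℂ) :=
  (sobolev s δ : L2 →ₗ[ℂ] 𝓢'(ℝ, ℂ)) ∘ₗ (hZero s δ).subtype

/-- The elements of `H^{s,δ}(ℝ)` whose restriction to `ℝ₊` vanishes. -/
def hNull (s δ : ℝ) : Submodule ℂ L2 :=
  LinearMap.ker (restrict ∘ₗ (sobolev s δ : L2 →ₗ[ℂ] 𝓢'(ℝ, ℂ)))

instance isClosed_hNull (s δ : ℝ) : IsClosed (hNull s δ : Set L2) := by
  have : (hNull s δ : Set L2) = ⋂ φ : Test, {f | sobolev s δ f (toSchwartz φ) = 0} := by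
    ext f
    simp only [hNull, SetLike.mem_coe, LinearMap.mem_ker, Set.mem_iInter]
    exact LinearMap.ext_iff
  rw [this]
  refine isClosed_iInter fun φ => isClosed_eq ?_ continuous_const
  exact (PointwiseConvergenceCLM.evalCLM (RingHom.id ℂ) ℂ (toSchwartz φ)).continuous.comp
    (sobolev s δ).continuous

/-- `H^{s,δ}(ℝ₊)`, the space of restrictions to `ℝ₊` of the elements of `H^{s,δ}(ℝ)`, with the
quotient norm `‖v‖ = inf {‖u‖ | u|_{ℝ₊} = v}`. -/
def HPlus (s δ : ℝ) : Type := L2 ⧸ hNull s δ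

instance (s δ : ℝ) : NormedAddCommGroup (HPlus s δ) :=
  inferInstanceAs (NormedAddCommGroup (L2 ⧸ hNull s δ))

instance (s δ : ℝ) : NormedSpace ℂ (HPlus s δ) := inferInstanceAs (NormedSpace ℂ (L2 ⧸ hNull s δ))

/-- The distribution on `ℝ₊` given by an element of `H^{s,δ}(ℝ₊)`. -/
def hPlusDist (s δ : ℝ) : HPlus s δ →ₗ[ℂ] Dist :=
  (hNull s δ).liftQ (restrict ∘ₗ (sobolev s δ : L2 →ₗ[ℂ] 𝓢'(ℝ, ℂ))) le_rfl

theorem contDiffOn_near (γ δ : ℝ) :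
    ContDiffOn ℝ ∞ (fun t : ℝ => cutoff t * t ^ (1 / 2 - γ) * japanese δ t) (Set.Ioi 0) :=
  (contDiff_cutoff.contDiffOn.mul (contDiffOn_id.rpow_const_of_ne fun _ ht => ne_of_gt ht)).mul
    (contDiff_japanese δ).contDiffOn

theorem contDiffOn_far (δ : ℝ) :
    ContDiffOn ℝ ∞ (fun t : ℝ => (1 - cutoff t) * japanese δ t) (Set.Ioi 0) :=
  ((contDiff_const.sub contDiff_cutoff).mul (contDiff_japanese δ)).contDiffOn

/-- The weighted cone Sobolev space `𝒦^{s,γ}(ℝ₊)^δ = ⟨t⟩^{-δ} 𝒦^{s,γ}(ℝ₊)`. Its elements are the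
distributions `w` on `ℝ₊` such that `U = θ(t^{1/2-γ} ω ⟨t⟩^δ w)` belongs to `H^s(ℝ)` and
`V = (1-ω) ⟨t⟩^δ w` belongs to `H^s(ℝ₊)`; they are recorded together with `(U, V)`. -/
def coneSpace (s γ δ : ℝ) : Submodule ℂ (Dist × WithLp 1 (L2 × HPlus s 0)) where
  carrier := {q |
    (∀ φ : TestR, sobolev s 0 q.2.fst (toSchwartz φ) =
      q.1 (mulTest _ (contDiffOn_near γ δ) (thetaTest φ))) ∧
    (∀ φ : Test, hPlusDist s 0 q.2.snd φ = q.1 (mulTest _ (contDiffOn_far δ) φ))}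
  add_mem' {p q} hp hq := ⟨fun φ => by simp [hp.1 φ, hq.1 φ], fun φ => by simp [hp.2 φ, hq.2 φ]⟩
  zero_mem' := ⟨fun φ => by simp, fun φ => by simp⟩
  smul_mem' c q hq := ⟨fun φ => by simp [hq.1 φ], fun φ => by simp [hq.2 φ]⟩

/-- The pair `(U, V)` of an element of `𝒦^{s,γ}(ℝ₊)^δ`. -/
def conePair (s γ δ : ℝ) : coneSpace s γ δ →ₗ[ℂ] WithLp 1 (L2 × HPlus s 0) :=
  LinearMap.snd ℂ Dist (WithLp 1 (L2 × HPlus s 0)) ∘ₗ (coneSpace s γ δ).subtype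

theorem conePair_injective (s γ δ : ℝ) : Function.Injective (conePair s γ δ) := by
  rw [← LinearMap.ker_eq_bot, LinearMap.ker_eq_bot']
  rintro ⟨⟨w, p⟩, h1, h2⟩ hp
  replace hp : p = 0 := hp
  subst hp
  have hw : w = 0 := by
    ext ψ
    have hA : ContDiffOn ℝ ∞ (fun t : ℝ => t ^ (-(1 / 2 - γ)) * japanese (-δ) t) (Set.Ioi 0) :=
      (contDiffOn_id.rpow_const_of_ne fun _ ht => ne_of_gt ht).mul
        (contDiff_japanese (-δ)).contDiffOn
    have hB : ContDiffOn ℝ ∞ (japanese (-δ)) (Set.Ioi 0) := (contDiff_japanese (-δ)).contDiffOn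
    have e1 := h1 (thetaInvTest (mulTest _ hA ψ))
    have e2 := h2 (mulTest _ hB ψ)
    simp only [thetaTest_thetaInvTest] at e1
    have e3 : ψ = mulTest _ (contDiffOn_near γ δ) (mulTest _ hA ψ)
        + mulTest _ (contDiffOn_far δ) (mulTest _ hB ψ) := by
      ext t
      change ψ t = ((cutoff t * t ^ (1 / 2 - γ) * japanese δ t : ℝ) : ℂ) *
          (((t ^ (-(1 / 2 - γ)) * japanese (-δ) t : ℝ) : ℂ) * ψ t) +
        (((1 - cutoff t) * japanese δ t : ℝ) : ℂ) * ((japanese (-δ) t : ℝ) * ψ t)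
      by_cases ht : 0 < t
      · have a1 := japanese_neg_mul δ t
        have a2 : t ^ (1 / 2 - γ) * t ^ (-(1 / 2 - γ)) = 1 := by
          rw [← Real.rpow_add ht]; simp
        have a3 : cutoff t * t ^ (1 / 2 - γ) * japanese δ t *
            (t ^ (-(1 / 2 - γ)) * japanese (-δ) t) +
            (1 - cutoff t) * japanese δ t * japanese (-δ) t = 1 := by
          linear_combination (1 - cutoff t + cutoff t * (t ^ (1 / 2 - γ) * t ^ (-(1 / 2 - γ)))) * a1
            + cutoff t * a2
        have a4 := congrArg (fun r : ℝ => (r : ℂ) * ψ t) a3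
        simp only [Complex.ofReal_add, Complex.ofReal_one, one_mul] at a4
        refine a4.symm.trans ?_
        push_cast
        ring
      · rw [test_zero ψ fun h => ht (ψ.tsupport_subset h)]
        simp
    rw [e3, map_add, ← e1, ← e2]
    simp
  subst hw
  rfl

/-- `𝒦^{s,γ}(ℝ₊)^δ` with the norm
`‖w‖ = ‖θ(t^{1/2-γ} ω ⟨t⟩^δ w)‖_{H^s(ℝ)} + ‖(1-ω) ⟨t⟩^δ w‖_{H^s(ℝ₊)}`. -/
def Cone (s γ δ : ℝ) : Type := coneSpace s γ δ

instance (s γ δ : ℝ) : NormedAddCommGroup (Cone s γ δ) :=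
  NormedAddCommGroup.induced (coneSpace s γ δ) _ (conePair s γ δ) (conePair_injective s γ δ)

instance (s γ δ : ℝ) : NormedSpace ℂ (Cone s γ δ) :=
  NormedSpace.induced ℂ (coneSpace s γ δ) _ (conePair s γ δ)

/-- The distribution on `ℝ₊` given by an element of `𝒦^{s,γ}(ℝ₊)^δ`. -/
def coneDist (s γ δ : ℝ) : Cone s γ δ →ₗ[ℂ] Dist :=
  LinearMap.fst ℂ Dist (WithLp 1 (L2 × HPlus s 0)) ∘ₗ (coneSpace s γ δ).subtype

/-- The elements of `H^{s,δ}(ℝ)` parametrized by `sobolev s δ` are the tempered distributions `u`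
with `⟨t⟩^δ u ∈ H^s(ℝ)`. -/
theorem mem_range_sobolev (s δ : ℝ) (u : 𝓢'(ℝ, ℂ)) :
    u ∈ Set.range (sobolev s δ) ↔ TemperedDistribution.MemSobolev s 2
      (TemperedDistribution.smulLeftCLM ℂ (fun t : ℝ => ((japanese δ t : ℝ) : ℂ)) u) := by
  have hT (ε : ℝ) : (fun t : ℝ => ((japanese ε t : ℝ) : ℂ)).HasTemperateGrowth := by
    have := Function.hasTemperateGrowth_one_add_norm_sq_rpow ℝ (ε / 2)
    unfold japanese
    fun_prop
  have h1 (ε : ℝ) (v : 𝓢'(ℝ, ℂ)) :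
      TemperedDistribution.smulLeftCLM ℂ (fun t : ℝ => ((japanese ε t : ℝ) : ℂ))
        (TemperedDistribution.smulLeftCLM ℂ (fun t : ℝ => ((japanese (-ε) t : ℝ) : ℂ)) v) = v := by
    rw [TemperedDistribution.smulLeftCLM_smulLeftCLM_apply (hT _) (hT _)]
    have : (fun t : ℝ => ((japanese (-ε) t : ℝ) : ℂ)) * (fun t : ℝ => ((japanese ε t : ℝ) : ℂ))
        = fun _ => 1 := by
      ext t
      simp only [Pi.mul_apply]
      rw [mul_comm]
      exact_mod_cast japanese_neg_mul ε t
    rw [this]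
    simp
  constructor
  · rintro ⟨f, rfl⟩
    refine ⟨f, ?_⟩
    simp [sobolev, h1]
  · rintro ⟨f, hf⟩
    refine ⟨f, ?_⟩
    have h2 := h1 (-δ) u
    rw [neg_neg] at h2
    simp only [sobolev, ContinuousLinearMap.comp_apply, Lp.toTemperedDistributionCLM_apply]
    rw [← hf]
    simp [h2]

/-! ### Spaces with group action -/

/-- The dilations `κ_r` on a space of distributions: `dil r u v` means that `r > 0` and
`v = κ_r u`, where `⟨κ_r u, φ⟩ = ⟨u, κ_r⁻¹ φ⟩`. -/
class KappaSpace (E : Type*) where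
  dil : ℝ → E → E → Prop

/-- `isTest φ u` means that `u` is the regular distribution with density `φ`. -/
class SourceSpace (E : Type*) where
  isTest : Test → E → Prop

/-- The embedding into the distributions on `ℝ₊`. -/
class TargetSpace (E : Type*) where
  toDist : E → Dist

instance (s δ : ℝ) : KappaSpace (HZero s δ) where
  dil r u v := ∃ hr : 0 < r, ∀ φ : 𝓢(ℝ, ℂ),
    hZeroDist s δ v φ = hZeroDist s δ u (dilSchwartz r⁻¹ (inv_pos.2 hr) φ)

instance (s δ : ℝ) : SourceSpace (HZero s δ) where
  isTest φ u := ∀ ψ : 𝓢(ℝ, ℂ), hZeroDist s δ u ψ = ∫ t : ℝ, φ t * ψ t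

instance (s δ : ℝ) : TargetSpace (HPlus s δ) where
  toDist u := hPlusDist s δ u

instance (s δ : ℝ) : KappaSpace (HPlus s δ) where
  dil r u v := ∃ hr : 0 < r, ∀ φ : Test,
    hPlusDist s δ v φ = hPlusDist s δ u (dilTest r⁻¹ (inv_pos.2 hr) φ)

instance (s γ δ : ℝ) : TargetSpace (Cone s γ δ) where
  toDist u := coneDist s γ δ u

instance (s γ δ : ℝ) : SourceSpace (Cone s γ δ) where
  isTest φ u := ∀ ψ : Test, coneDist s γ δ u ψ = ∫ t : ℝ, φ t * ψ t

instance (s γ δ : ℝ) : KappaSpace (Cone s γ δ) where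
  dil r u v := ∃ hr : 0 < r, ∀ φ : Test,
    coneDist s γ δ v φ = coneDist s γ δ u (dilTest r⁻¹ (inv_pos.2 hr) φ)

/-- `E(ℝ₊, ℂ^L) ⊕ ℂ^M`; the maximum norm used here is equivalent to the Hilbert sum norm. -/
abbrev Block (E : Type*) (L M : ℕ) : Type _ := (Fin L → E) × (Fin M → ℂ)

/-- The group action `κ_r (u ⊕ z) = κ_r u ⊕ z`. -/
instance (E : Type*) [KappaSpace E] (L M : ℕ) : KappaSpace (Block E L M) where
  dil r u v := 0 < r ∧ (∀ i, KappaSpace.dil r (u.1 i) (v.1 i)) ∧ v.2 = u.2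

/-! ### Operator-valued symbols

Points `(x, (ξ, μ))`, where `x, ξ ∈ ℝ^n` and `μ ∈ ℝ`. -/

abbrev Phase (n : ℕ) : Type := EuclideanSpace ℝ (Fin n) × (EuclideanSpace ℝ (Fin n) × ℝ)

/-- `ℝ^n × ℝ^n × [0,∞)`. -/
def fullDomain (n : ℕ) : Set (Phase n) := {p | 0 ≤ p.2.2}

/-- `ℝ^n × ((ℝ^n × [0,∞)) \ {0})`. -/
def strongDomain (n : ℕ) : Set (Phase n) := {p | 0 ≤ p.2.2 ∧ p.2 ≠ 0}

/-- `ℝ^n × (ℝ^n \ {0}) × [0,∞)`. -/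
def weakDomain (n : ℕ) : Set (Phase n) := {p | 0 ≤ p.2.2 ∧ p.2.1 ≠ 0}

/-- `⟨ξ⟩`. -/
def brXi {n : ℕ} (p : Phase n) : ℝ := √(1 + ‖p.2.1‖ ^ 2)

/-- `⟨ξ, μ⟩`. -/
def brXiMu {n : ℕ} (p : Phase n) : ℝ := √(1 + ‖p.2.1‖ ^ 2 + p.2.2 ^ 2)

/-- `|ξ|`. -/
def absXi {n : ℕ} (p : Phase n) : ℝ := ‖p.2.1‖

/-- `|ξ, μ|`. -/
def absXiMu {n : ℕ} (p : Phase n) : ℝ := √(‖p.2.1‖ ^ 2 + p.2.2 ^ 2)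

/-- The coordinate directions `x_i`, `ξ_i`, `μ`. -/
inductive Direction (n : ℕ) : Type
  | x (i : Fin n) : Direction n
  | xi (i : Fin n) : Direction n
  | mu : Direction n

def Direction.vec {n : ℕ} : Direction n → Phase n
  | .x i => (EuclideanSpace.single i 1, (0, 0))
  | .xi i => (0, (EuclideanSpace.single i 1, 0))
  | .mu => (0, (0, 1))

def Direction.isXi {n : ℕ} : Direction n → Bool
  | .xi _ => true
  | _ => false

def Direction.isMu {n : ℕ} : Direction n → Bool
  | .mu => true
  | _ => false

/-- Iterated partial derivatives within `D`, along a list of coordinate directions. -/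
def partials {n : ℕ} {F : Type*} [NormedAddCommGroup F] [NormedSpace ℝ F] (D : Set (Phase n)) :
    List (Direction n) → (Phase n → F) → Phase n → F
  | [], a => a
  | e :: l, a => fun p => fderivWithin ℝ (partials D l a) D p e.vec

section Symbols

variable {n : ℕ} {E₀ E₁ : Type*} [NormedAddCommGroup E₀] [NormedSpace ℂ E₀] [KappaSpace E₀]
  [NormedAddCommGroup E₁] [NormedSpace ℂ E₁] [KappaSpace E₁]

/-- `‖κ_{1,r₁}⁻¹ T κ_{0,r₀}‖ ≤ C`. -/
def TwistedNormLE (r₀ r₁ : ℝ) (T : E₀ →L[ℂ] E₁) (C : ℝ) : Prop :=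
  ∀ u v : E₀, KappaSpace.dil r₀ u v → ∃ w : E₁, KappaSpace.dil r₁ w (T v) ∧ ‖w‖ ≤ C * ‖u‖

/-- Smooth functions on `D` satisfying
`‖κ₁⁻¹_{r₁} {D_ξ^α D_x^β D_μ^j a} κ_{0,r₀}‖ ≤ C_{αβj} weight(|α|, j)`. -/
def SymbolEstimates (D : Set (Phase n)) (r₀ r₁ : Phase n → ℝ) (weight : ℕ → ℕ → Phase n → ℝ)
    (a : Phase n → E₀ →L[ℂ] E₁) : Prop :=
  ContDiffOn ℝ ∞ a D ∧ ∀ l : List (Direction n), ∃ C : ℝ, ∀ p ∈ D,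
    TwistedNormLE (r₀ p) (r₁ p) (partials D l a p)
      (C * weight (l.countP Direction.isXi) (l.countP Direction.isMu) p)

/-- `κ`-homogeneity of degree `d` on `D`:
`a(x, rξ; rμ) κ_{0,r} u = r^d κ_{1,r} a(x, ξ; μ) u` for all `r > 0`. -/
def KappaHomogeneous (D : Set (Phase n)) (d : ℝ) (a : Phase n → E₀ →L[ℂ] E₁) : Prop :=
  ∀ p ∈ D, ∀ r : ℝ, 0 < r → ∀ u v : E₀, KappaSpace.dil r u v →
    KappaSpace.dil r (((r ^ d : ℝ) : ℂ) • a p u) (a (p.1, r • p.2) v)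

/-- `0`-excision functions: smooth, vanishing near `0`, equal to `1` near infinity. -/
def IsExcision {F : Type*} [NormedAddCommGroup F] [NormedSpace ℝ F] (χ : F → ℝ) : Prop :=
  ContDiff ℝ ∞ χ ∧ (∀ᶠ y in nhds 0, χ y = 0) ∧ ∃ R : ℝ, ∀ y, R ≤ ‖y‖ → χ y = 1

/-- `S^d_{1,0}(ℝ^n × [0,∞); E₀, E₁)`. -/
def StrongSymbol (d : ℝ) (a : Phase n → E₀ →L[ℂ] E₁) : Prop :=
  SymbolEstimates (fullDomain n) brXiMu brXiMu (fun k j p => brXiMu p ^ (d - k - j)) a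

/-- `S^{(d)}(ℝ^n × [0,∞); E₀, E₁)`. -/
def StrongHomogeneous (d : ℝ) (a : Phase n → E₀ →L[ℂ] E₁) : Prop :=
  KappaHomogeneous (strongDomain n) d a ∧
    SymbolEstimates (strongDomain n) absXiMu absXiMu (fun k j p => absXiMu p ^ (d - k - j)) a

/-- `S^d(ℝ^n × [0,∞); E₀, E₁)`, the classical strongly parameter-dependent symbols. -/
def StrongClassical (d : ℝ) (a : Phase n → E₀ →L[ℂ] E₁) : Prop :=
  StrongSymbol d a ∧ ∃ h : ℕ → Phase n → E₀ →L[ℂ] E₁, (∀ j : ℕ, StrongHomogeneous (d - j) (h j)) ∧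
    ∀ χ : EuclideanSpace ℝ (Fin n) × ℝ → ℝ, IsExcision χ → ∀ N : ℕ,
      StrongSymbol (d - N) (fun p => a p - ∑ j ∈ Finset.range N, ((χ p.2 : ℝ) : ℂ) • h j p)

/-- The kind of twisting: boldface `κ(ξ, μ)` or ordinary `κ(ξ)`. -/
inductive Twist : Type
  | bold : Twist
  | plain : Twist

def Twist.bracket : Twist → Phase n → ℝ
  | .bold => brXiMu
  | .plain => brXi

def Twist.modulus : Twist → Phase n → ℝ
  | .bold => absXiMu
  | .plain => absXi

/-- `S̃^{d,ν}_{1,0}(ℝ^n × [0,∞); E₀, E₁)_{k₀,k₁}`. -/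
def WeakSymbol (k₀ k₁ : Twist) (d ν : ℝ) (a : Phase n → E₀ →L[ℂ] E₁) : Prop :=
  SymbolEstimates (fullDomain n) k₀.bracket k₁.bracket
    (fun k j p => brXi p ^ (ν - k) * brXiMu p ^ (d - ν - j)) a

/-- `S̃^{(d,ν)}(ℝ^n × [0,∞); E₀, E₁)_{k₀,k₁}`. -/
def WeakHomogeneous (k₀ k₁ : Twist) (d ν : ℝ) (a : Phase n → E₀ →L[ℂ] E₁) : Prop :=
  KappaHomogeneous (weakDomain n) d a ∧
    SymbolEstimates (weakDomain n) k₀.modulus k₁.modulus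
      (fun k j p => absXi p ^ (ν - k) * absXiMu p ^ (d - ν - j)) a

/-- `S̃^{d,ν}(ℝ^n × [0,∞); E₀, E₁)_{k₀,k₁}`, the classical weakly parameter-dependent symbols. -/
def WeakClassical (k₀ k₁ : Twist) (d ν : ℝ) (a : Phase n → E₀ →L[ℂ] E₁) : Prop :=
  WeakSymbol k₀ k₁ d ν a ∧ ∃ h : ℕ → Phase n → E₀ →L[ℂ] E₁,
    (∀ j : ℕ, WeakHomogeneous k₀ k₁ (d - j) (ν - j) (h j)) ∧
    ∀ χ : EuclideanSpace ℝ (Fin n) → ℝ, IsExcision χ → ∀ N : ℕ,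
      WeakSymbol k₀ k₁ (d - N) (ν - N)
        (fun p => a p - ∑ j ∈ Finset.range N, ((χ p.2.1 : ℝ) : ℂ) • h j p)

end Symbols

/-! ### Singular Green symbols of type `0` -/

/-- Linear operators from `C_c^∞(ℝ₊, ℂ^L) ⊕ ℂ^M` to distributions on `ℝ₊` with values in `ℂ^{L'}`,
plus `ℂ^{M'}`. Since `C_c^∞(ℝ₊)` is dense in all the spaces `H^{s,δ}_0([0,∞))` and
`𝒦^{s,γ}(ℝ₊)^δ`, bounded operators on these spaces are identified with their restrictions to test
functions. -/
abbrev GreenOp (L M L' M' : ℕ) : Type := Block Test L M →ₗ[ℂ] Block Dist L' M'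

/-- The operator function `g`, given on test functions, is on `D` the restriction of `a`. -/
def Realizes {n L M L' M' : ℕ} {E₀ E₁ : Type*} [NormedAddCommGroup E₀] [NormedSpace ℂ E₀]
    [SourceSpace E₀] [NormedAddCommGroup E₁] [NormedSpace ℂ E₁] [TargetSpace E₁]
    {D : Set (Phase n)} (a : Phase n → Block E₀ L M →L[ℂ] Block E₁ L' M')
    (g : D → GreenOp L M L' M') : Prop :=
  ∀ (p : D) (φ : Block Test L M) (u : Fin L → E₀), (∀ i, SourceSpace.isTest (φ.1 i) (u i)) →
    (∀ i, TargetSpace.toDist ((a p (u, φ.2)).1 i) = (g p φ).1 i) ∧ (a p (u, φ.2)).2 = (g p φ).2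

section Membership

variable {n L M L' M' : ℕ} (E₀ E₁ : Type*)
  [NormedAddCommGroup E₀] [NormedSpace ℂ E₀] [KappaSpace E₀] [SourceSpace E₀]
  [NormedAddCommGroup E₁] [NormedSpace ℂ E₁] [KappaSpace E₁] [TargetSpace E₁]

/-- `g` belongs to `S^d(E₀(ℂ^L) ⊕ ℂ^M, E₁(ℂ^{L'}) ⊕ ℂ^{M'})`. -/
def MemStrong (d : ℝ) (g : fullDomain n → GreenOp L M L' M') : Prop :=
  ∃ a : Phase n → Block E₀ L M →L[ℂ] Block E₁ L' M', StrongClassical d a ∧ Realizes a g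

/-- `g` belongs to `S^{(d)}(E₀(ℂ^L) ⊕ ℂ^M, E₁(ℂ^{L'}) ⊕ ℂ^{M'})`. -/
def MemStrongHom (d : ℝ) (g : strongDomain n → GreenOp L M L' M') : Prop :=
  ∃ a : Phase n → Block E₀ L M →L[ℂ] Block E₁ L' M', StrongHomogeneous d a ∧ Realizes a g

/-- `g` belongs to `S̃^{d,ν}(E₀(ℂ^L) ⊕ ℂ^M, E₁(ℂ^{L'}) ⊕ ℂ^{M'})_{k₀,k₁}`. -/
def MemWeak (k₀ k₁ : Twist) (d ν : ℝ)
    (g : fullDomain n → GreenOp L M L' M') : Prop :=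
  ∃ a : Phase n → Block E₀ L M →L[ℂ] Block E₁ L' M',
    WeakClassical k₀ k₁ d ν a ∧ Realizes a g

/-- `g` belongs to `S̃^{(d,ν)}(E₀(ℂ^L) ⊕ ℂ^M, E₁(ℂ^{L'}) ⊕ ℂ^{M'})_{k₀,k₁}`. -/
def MemWeakHom (k₀ k₁ : Twist) (d ν : ℝ)
    (g : weakDomain n → GreenOp L M L' M') : Prop :=
  ∃ a : Phase n → Block E₀ L M →L[ℂ] Block E₁ L' M',
    WeakHomogeneous k₀ k₁ d ν a ∧ Realizes a g

end Membership

section Green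

variable (n L M L' M' : ℕ)

/-- `𝓑^{d;0}_G(ℝ^n × [0,∞); (L,M), (L',M'))`. -/
def StrongGreen (d : ℝ) : Set (fullDomain n → GreenOp L M L' M') :=
  {g | ∀ s s' δ δ' : ℝ, MemStrong (HZero s δ) (HPlus s' δ') d g}

/-- `𝓑^{(d);0}_G(ℝ^n × [0,∞); (L,M), (L',M'))`. -/
def StrongGreenHom (d : ℝ) : Set (strongDomain n → GreenOp L M L' M') :=
  {g | ∀ s s' δ δ' : ℝ, MemStrongHom (HZero s δ) (HPlus s' δ') d g}

/-- `𝓑̃^{d,ν;0}_G(ℝ^n × [0,∞); (L,M), (L',M'))`. -/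
def WeakGreen (d ν : ℝ) : Set (fullDomain n → GreenOp L M L' M') :=
  {g | ∀ s s' δ δ' : ℝ,
    MemWeak (HZero s 0) (HPlus s' 0) .bold .bold d ν g ∧
    MemWeak (HZero s 0) (Cone s' 0 δ') .bold .plain d ν g ∧
    MemWeak (Cone s 0 δ) (HPlus s' 0) .plain .bold d ν g ∧
    MemWeak (Cone s 0 δ) (Cone s' 0 δ') .plain .plain d ν g}

/-- `𝓑̃^{(d,ν);0}_G(ℝ^n × [0,∞); (L,M), (L',M'))`. -/
def WeakGreenHom (d ν : ℝ) : Set (weakDomain n → GreenOp L M L' M') :=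
  {g | ∀ s s' δ δ' : ℝ,
    MemWeakHom (HZero s 0) (HPlus s' 0) .bold .bold d ν g ∧
    MemWeakHom (HZero s 0) (Cone s' 0 δ') .bold .plain d ν g ∧
    MemWeakHom (Cone s 0 δ) (HPlus s' 0) .plain .bold d ν g ∧
    MemWeakHom (Cone s 0 δ) (Cone s' 0 δ') .plain .plain d ν g}

/-- `𝓑^{d,ν;0}_G = 𝓑^{d;0}_G + 𝓑̃^{d,ν;0}_G`, the singular Green symbols of order `d`, regularity
`ν` and type `0`. -/
def Green (d ν : ℝ) : Set (fullDomain n → GreenOp L M L' M') :=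
  {g | ∃ g₀ ∈ StrongGreen n L M L' M' d, ∃ g₁ ∈ WeakGreen n L M L' M' d ν, g = g₀ + g₁}

end Green

/-- Strongly homogeneous symbols, defined for `(ξ, μ) ≠ 0`, are restricted to `ξ ≠ 0`. -/
theorem weakDomain_subset (n : ℕ) : weakDomain n ⊆ strongDomain n :=
  fun _ hp => ⟨hp.1, fun h => hp.2 (by rw [h]; rfl)⟩

end GreenSymbols

end

/-!
The point is that `κ_{⟨ξ,μ⟩}` may be replaced by `κ_{⟨ξ⟩}` on either side at the cost of regularity
and decay. For `K` large, `H^{K,3K}(ℝ₊)` embeds into `𝓚^{s,0}(ℝ₊)^δ` by a map `J` for which the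
operators `κ_{r'}⁻¹ J κ_r`, `0 < r' ≤ r`, are uniformly bounded: a dilation by `r / r' ≥ 1` shrinks
the moments of a function and leaves its `L²`-norm and the operator `t ∂_t` unchanged, hence does
not increase the norms of `⟨t⟩^{2K} t^j ψ^{(j)}` in `L²(ℝ₊)` by which the norm of `𝓚^{s,0}(ℝ₊)^δ`
is controlled. By duality `𝓚^{s,0}(ℝ₊)^δ` embeds into `H^{-K,-3K}_0` in the same way. With
`r = ⟨ξ,μ⟩` and `r' = ⟨ξ⟩` this yields all four twistings of weak symbols from the boldface one.

The weights are compared by `⟨ξ,μ⟩^{d-k-j} ≤ ⟨ξ⟩^{ν-k} ⟨ξ,μ⟩^{d-ν-j}` for `ν ≤ 0`.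
-/

noncomputable section

namespace GreenSymbols

open scoped FourierTransform LineDeriv Laplacian

/-! ### Bessel potentials on Schwartz functions -/

section Bessel

variable {E F : Type*} [NormedAddCommGroup E]

/-- The symbol `⟨x⟩^s`, as a complex-valued function. -/
def besselSymbol (s : ℝ) (x : E) : ℂ := ((1 + ‖x‖ ^ 2) ^ (s / 2) : ℝ)

@[fun_prop]
theorem hasTemperateGrowth_besselSymbol [InnerProductSpace ℝ E] (s : ℝ) :
    (besselSymbol s : E → ℂ).HasTemperateGrowth := by
  unfold besselSymbol
  fun_prop

theorem norm_besselSymbol (s : ℝ) (x : E) : ‖besselSymbol s x‖ = (1 + ‖x‖ ^ 2) ^ (s / 2) := by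
  rw [besselSymbol, Complex.norm_real, Real.norm_of_nonneg (by positivity)]

theorem norm_besselSymbol_mono {s s' : ℝ} (h : s ≤ s') (x : E) :
    ‖besselSymbol s x‖ ≤ ‖besselSymbol s' x‖ := by
  simp only [norm_besselSymbol]
  exact Real.rpow_le_rpow_of_exponent_le (by nlinarith [sq_nonneg ‖x‖]) (by linarith)

theorem norm_le_norm_besselSymbol_one (x : E) : ‖x‖ ≤ ‖besselSymbol 1 x‖ := by
  rw [norm_besselSymbol, ← Real.sqrt_eq_rpow]
  exact Real.le_sqrt_of_sq_le (by linarith)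

theorem besselSymbol_mul (s s' : ℝ) :
    (besselSymbol s * besselSymbol s' : E → ℂ) = besselSymbol (s + s') := by
  ext x
  simp only [besselSymbol, Pi.mul_apply]
  norm_cast
  rw [← Real.rpow_add (by positivity), add_div]

variable [InnerProductSpace ℝ E] [NormedAddCommGroup F] [NormedSpace ℂ F]
  [FiniteDimensional ℝ E] [MeasurableSpace E] [BorelSpace E]

/-- The Bessel potential `⟨D⟩^s` on Schwartz functions. -/
def bessel (s : ℝ) : 𝓢(E, F) →L[ℂ] 𝓢(E, F) :=
  SchwartzMap.fourierMultiplierCLM F (besselSymbol s)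

theorem fourier_lineDerivOp_apply (m : E) (ψ : 𝓢(E, F)) (x : E) :
    𝓕 (∂_{m} ψ) x = (2 * Real.pi * Complex.I) • inner ℝ x m • 𝓕 ψ x := by
  rw [SchwartzMap.fourier_lineDerivOp_eq, _root_.smul_apply,
    SchwartzMap.smulLeftCLM_apply_apply (by fun_prop)]

theorem schwartz_fourierInv_apply (φ : 𝓢(E, F)) (x : E) : 𝓕⁻ φ x = 𝓕 φ (-x) := by
  rw [SchwartzMap.fourierInv_coe, Real.fourierInv_eq_fourier_neg, SchwartzMap.fourier_coe]

theorem fourier_smulLeftCLM_fourierInv {g : E → ℂ} (hg : g.HasTemperateGrowth)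
    (heven : ∀ x, g (-x) = g x) (ψ : 𝓢(E, F)) :
    𝓕 (SchwartzMap.smulLeftCLM F g (𝓕⁻ ψ)) = SchwartzMap.fourierMultiplierCLM F g ψ := by
  have h : SchwartzMap.smulLeftCLM F g (𝓕⁻ ψ) = SchwartzMap.compCLMOfContinuousLinearEquiv ℂ
      (LinearIsometryEquiv.neg ℝ (E := E)) (SchwartzMap.smulLeftCLM F g (𝓕 ψ)) := by
    ext x
    simp [SchwartzMap.smulLeftCLM_apply_apply hg, schwartz_fourierInv_apply, heven]
  rw [h, SchwartzMap.fourierMultiplierCLM_apply]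
  ext x
  rw [SchwartzMap.fourierInv_coe, Real.fourierInv_eq_fourier_comp_neg, SchwartzMap.fourier_coe]
  rfl

variable [CompleteSpace F]

theorem bessel_bessel (s s' : ℝ) (ψ : 𝓢(E, F)) : bessel s (bessel s' ψ) = bessel (s + s') ψ := by
  rw [bessel, bessel, SchwartzMap.fourierMultiplierCLM_fourierMultiplierCLM_apply
    (by fun_prop) (by fun_prop), besselSymbol_mul, bessel]

theorem bessel_zero (ψ : 𝓢(E, F)) : bessel 0 ψ = ψ := by
  have h : (besselSymbol 0 : E → ℂ) = fun _ => 1 := by ext x; simp [besselSymbol]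
  rw [bessel, h, SchwartzMap.fourierMultiplierCLM_const, one_smul, ContinuousLinearMap.id_apply]

theorem fourier_bessel (s : ℝ) (ψ : 𝓢(E, F)) (x : E) :
    𝓕 (bessel s ψ) x = besselSymbol s x • 𝓕 ψ x := by
  rw [bessel, SchwartzMap.fourierMultiplierCLM_apply, FourierTransform.fourier_fourierInv_eq,
    SchwartzMap.smulLeftCLM_apply_apply (by fun_prop)]

theorem fourier_laplacian_apply (ψ : 𝓢(E, F)) (x : E) :
    𝓕 (Δ ψ) x = (-(2 * Real.pi) ^ 2 : ℝ) • ‖x‖ ^ 2 • 𝓕 ψ x := by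
  rw [SchwartzMap.laplacian_eq_fourierMultiplierCLM, FourierTransform.fourier_smul,
    SchwartzMap.fourierMultiplierCLM_apply, FourierTransform.fourier_fourierInv_eq,
    _root_.smul_apply, SchwartzMap.smulLeftCLM_apply_apply (by fun_prop)]

theorem bessel_lineDerivOp (s : ℝ) (m : E) (ψ : 𝓢(E, F)) :
    bessel s (∂_{m} ψ) = ∂_{m} (bessel s ψ) := by
  apply (FourierTransform.fourierEquiv ℂ 𝓢(E, F)).injective
  ext x
  simp only [FourierTransform.fourierEquiv_apply, fourier_bessel, fourier_lineDerivOp_apply,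
    smul_comm (besselSymbol s x)]

theorem bessel_two (ψ : 𝓢(E, F)) :
    bessel 2 ψ = ψ - ((2 * Real.pi) ^ 2)⁻¹ • Δ ψ := by
  apply (FourierTransform.fourierEquiv ℂ 𝓢(E, F)).injective
  ext x
  have hx : besselSymbol 2 x = ((1 + ‖x‖ ^ 2 : ℝ) : ℂ) := by simp [besselSymbol]
  rw [map_sub]
  simp only [FourierTransform.fourierEquiv_apply, FourierTransform.fourier_smul,
    _root_.sub_apply, _root_.smul_apply, fourier_bessel, fourier_laplacian_apply, hx,
    Complex.coe_smul, smul_smul, add_smul, one_smul]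
  have hπ : (2 * Real.pi) ^ 2 ≠ 0 := by positivity
  rw [neg_mul, mul_neg, inv_mul_cancel_left₀ hπ, neg_smul, sub_neg_eq_add]

theorem integral_bessel_mul_comm (s : ℝ) (f g : 𝓢(E, ℂ)) :
    ∫ x, bessel s f x * g x = ∫ x, f x * bessel s g x := by
  have htranspose : bessel s g = 𝓕 (SchwartzMap.smulLeftCLM ℂ (besselSymbol s) (𝓕⁻ g)) :=
    (fourier_smulLeftCLM_fourierInv (by fun_prop) (fun x => by simp [besselSymbol]) g).symm
  have h := DFunLike.congr_fun
    (TemperedDistribution.fourierMultiplierCLM_toTemperedDistributionCLM_eq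
      (hasTemperateGrowth_besselSymbol s) f) g
  simp only [TemperedDistribution.fourierMultiplierCLM_apply_apply, SchwartzMap.coe_apply,
    smul_eq_mul] at h
  simp only [htranspose, mul_comm (bessel s f _), mul_comm (f _)]
  exact h.symm

end Bessel

/-! ### `L²`-norms of derivatives and Bessel potentials -/

section NormL2

variable {E F : Type*} [NormedAddCommGroup E] [InnerProductSpace ℝ E] [FiniteDimensional ℝ E]
  [MeasurableSpace E] [BorelSpace E] [NormedAddCommGroup F]

/-- The inclusion of the Schwartz functions into `L²`. -/
abbrev toL2 [NormedSpace ℂ F] : 𝓢(E, F) →L[ℂ] Lp F 2 (volume : Measure E) :=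
  SchwartzMap.toLpCLM ℂ F 2 volume

theorem norm_toL2_eq_lpNorm [NormedSpace ℂ F] (ψ : 𝓢(E, F)) : ‖toL2 ψ‖ = lpNorm ψ 2 volume :=
  SchwartzMap.norm_toLp.trans (toReal_eLpNorm ψ.continuous.aestronglyMeasurable)

theorem norm_toL2_mono {G : Type*} [NormedSpace ℂ F] [NormedAddCommGroup G] [NormedSpace ℂ G]
    {φ : 𝓢(E, F)} {ψ : 𝓢(E, G)} (h : ∀ x, ‖φ x‖ ≤ ‖ψ x‖) : ‖toL2 φ‖ ≤ ‖toL2 ψ‖ := by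
  rw [norm_toL2_eq_lpNorm, norm_toL2_eq_lpNorm, ← lpNorm_norm ψ.continuous.aestronglyMeasurable]
  exact lpNorm_mono_real (ψ.memLp 2 volume).norm h

variable [InnerProductSpace ℂ F] [CompleteSpace F]

theorem norm_toL2_fourier (ψ : 𝓢(E, F)) : ‖toL2 (𝓕 ψ)‖ = ‖toL2 ψ‖ :=
  SchwartzMap.norm_fourier_toL2_eq ψ

theorem norm_toL2_bessel_mono {s s' : ℝ} (h : s ≤ s') (ψ : 𝓢(E, F)) :
    ‖toL2 (bessel s ψ)‖ ≤ ‖toL2 (bessel s' ψ)‖ := by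
  rw [← norm_toL2_fourier, ← norm_toL2_fourier (bessel s' ψ)]
  refine norm_toL2_mono fun x => ?_
  rw [fourier_bessel, fourier_bessel, norm_smul, norm_smul]
  exact mul_le_mul_of_nonneg_right (norm_besselSymbol_mono h x) (norm_nonneg _)

theorem norm_toL2_lineDerivOp_le (m : E) (ψ : 𝓢(E, F)) :
    ‖toL2 (∂_{m} ψ)‖ ≤ 2 * Real.pi * ‖m‖ * ‖toL2 (bessel 1 ψ)‖ := by
  have hπ := Real.pi_pos
  have hc : 0 ≤ 2 * Real.pi * ‖m‖ := by positivity
  calc ‖toL2 (∂_{m} ψ)‖ = ‖toL2 (𝓕 (∂_{m} ψ))‖ := (norm_toL2_fourier _).symm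
    _ ≤ ‖toL2 (((2 * Real.pi * ‖m‖ : ℝ) : ℂ) • 𝓕 (bessel 1 ψ))‖ := by
      refine norm_toL2_mono fun x => ?_
      rw [fourier_lineDerivOp_apply, _root_.smul_apply, fourier_bessel, norm_smul, norm_smul,
        norm_smul, norm_smul, Complex.norm_real, Real.norm_of_nonneg hc]
      have hx : ‖inner ℝ x m‖ ≤ ‖m‖ * ‖besselSymbol 1 x‖ :=
        (norm_inner_le_norm x m).trans <| by
          rw [mul_comm]; gcongr; exact norm_le_norm_besselSymbol_one x
      have hI : ‖2 * Real.pi * Complex.I‖ = 2 * Real.pi := by simp [hπ.le]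
      rw [hI, mul_assoc (2 * Real.pi), ← mul_assoc ‖m‖]
      gcongr
    _ = 2 * Real.pi * ‖m‖ * ‖toL2 (bessel 1 ψ)‖ := by
      rw [map_smul, norm_smul, norm_toL2_fourier, Complex.norm_real, Real.norm_of_nonneg hc]

end NormL2

section NormL2Line

variable {F : Type*} [NormedAddCommGroup F] [InnerProductSpace ℂ F]

/-- The derivative on Schwartz functions. -/
abbrev schwartzDeriv : 𝓢(ℝ, F) →L[ℂ] 𝓢(ℝ, F) := SchwartzMap.derivCLM ℂ F

theorem lineDerivOp_one (ψ : 𝓢(ℝ, F)) : ∂_{(1 : ℝ)} ψ = schwartzDeriv ψ := by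
  ext t
  rw [SchwartzMap.lineDerivOp_apply_eq_fderiv, SchwartzMap.derivCLM_apply,
    fderiv_apply_one_eq_deriv]

theorem laplacian_eq_schwartzDeriv (ψ : 𝓢(ℝ, F)) :
    Δ ψ = schwartzDeriv (schwartzDeriv ψ) := by
  simp [SchwartzMap.laplacian_eq_sum (OrthonormalBasis.singleton Unit ℝ), lineDerivOp_one]

variable [CompleteSpace F]

theorem schwartzDeriv_bessel (s : ℝ) (ψ : 𝓢(ℝ, F)) :
    schwartzDeriv (bessel s ψ) = bessel s (schwartzDeriv ψ) := by
  rw [← lineDerivOp_one, ← lineDerivOp_one, bessel_lineDerivOp]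

theorem norm_toL2_schwartzDeriv_le (ψ : 𝓢(ℝ, F)) :
    ‖toL2 (schwartzDeriv ψ)‖ ≤ 2 * Real.pi * ‖toL2 (bessel 1 ψ)‖ := by
  simpa [lineDerivOp_one] using norm_toL2_lineDerivOp_le 1 ψ

theorem norm_toL2_iterate_schwartzDeriv_le (j : ℕ) (ψ : 𝓢(ℝ, F)) :
    ‖toL2 (schwartzDeriv^[j] ψ)‖ ≤ (2 * Real.pi) ^ j * ‖toL2 (bessel j ψ)‖ := by
  induction j generalizing ψ with
  | zero => simp [bessel_zero]
  | succ j ih =>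
    calc ‖toL2 (schwartzDeriv^[j + 1] ψ)‖
      _ ≤ (2 * Real.pi) ^ j * ‖toL2 (schwartzDeriv (bessel j ψ))‖ := by
        rw [Function.iterate_succ_apply, schwartzDeriv_bessel]; exact ih _
      _ ≤ (2 * Real.pi) ^ j * (2 * Real.pi * ‖toL2 (bessel 1 (bessel j ψ))‖) := by
        gcongr; exact norm_toL2_schwartzDeriv_le _
      _ = (2 * Real.pi) ^ (j + 1) * ‖toL2 (bessel (j + 1 : ℕ) ψ)‖ := by
        rw [bessel_bessel, add_comm (1 : ℝ)]; push_cast; ring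

theorem norm_toL2_bessel_two_le (ψ : 𝓢(ℝ, F)) :
    ‖toL2 (bessel 2 ψ)‖ ≤ ‖toL2 ψ‖ + ‖toL2 (schwartzDeriv^[2] ψ)‖ := by
  have hπ : ‖((2 * Real.pi) ^ 2)⁻¹‖ ≤ 1 := by
    rw [Real.norm_of_nonneg (by positivity)]
    exact inv_le_one_of_one_le₀ (by nlinarith [Real.pi_gt_three])
  rw [bessel_two, laplacian_eq_schwartzDeriv, map_sub,
    ContinuousLinearMap.map_smul_of_tower]
  refine (norm_sub_le _ _).trans (add_le_add_right ?_ _)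
  rw [norm_smul]
  exact mul_le_of_le_one_left (norm_nonneg _) hπ

theorem norm_toL2_bessel_nat_le (m : ℕ) (ψ : 𝓢(ℝ, F)) :
    ‖toL2 (bessel (2 * m) ψ)‖ ≤
      2 ^ m * ∑ j ∈ Finset.range (2 * m + 1), ‖toL2 (schwartzDeriv^[j] ψ)‖ := by
  induction m generalizing ψ with
  | zero => simp [bessel_zero]
  | succ m ih =>
    set S := ∑ j ∈ Finset.range (2 * (m + 1) + 1), ‖toL2 (schwartzDeriv^[j] ψ)‖
    have hS (k : ℕ) (hk : k ≤ 2) :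
        ∑ j ∈ Finset.range (2 * m + 1), ‖toL2 (schwartzDeriv^[j] (schwartzDeriv^[k] ψ))‖ ≤ S := by
      simp_rw [← Function.iterate_add_apply]
      rw [Finset.range_eq_Ico,
        Finset.sum_Ico_add' (fun j => ‖toL2 (schwartzDeriv^[j] ψ)‖) 0 (2 * m + 1) k]
      refine Finset.sum_le_sum_of_subset_of_nonneg (fun j hj => ?_) fun _ _ _ => norm_nonneg _
      simp only [Finset.mem_Ico, Finset.mem_range] at hj ⊢
      lia
    have hcomm : bessel (2 * (m + 1 : ℕ)) ψ = bessel 2 (bessel (2 * m) ψ) := by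
      rw [bessel_bessel]; push_cast; ring_nf
    calc ‖toL2 (bessel (2 * (m + 1 : ℕ)) ψ)‖
      _ ≤ ‖toL2 (bessel (2 * m) ψ)‖ + ‖toL2 (bessel (2 * m) (schwartzDeriv^[2] ψ))‖ := by
        rw [hcomm]
        refine (norm_toL2_bessel_two_le _).trans_eq ?_
        simp only [Function.iterate_succ_apply, Function.iterate_zero_apply, schwartzDeriv_bessel]
      _ ≤ 2 ^ m * S + 2 ^ m * S := by
        gcongr
        · exact (ih ψ).trans (by gcongr; exact hS 0 zero_le_two)
        · exact (ih _).trans (by gcongr; exact hS 2 le_rfl)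
      _ = 2 ^ (m + 1) * S := by ring

theorem exists_norm_toL2_bessel_le (s : ℝ) : ∃ (K : ℕ) (C : ℝ), 0 ≤ C ∧ ∀ ψ : 𝓢(ℝ, F),
    ‖toL2 (bessel s ψ)‖ ≤ C * ∑ j ∈ Finset.range K, ‖toL2 (schwartzDeriv^[j] ψ)‖ := by
  obtain ⟨m, hm⟩ := exists_nat_ge s
  have hs : s ≤ 2 * m := hm.trans (by linarith [m.cast_nonneg (α := ℝ)])
  exact ⟨2 * m + 1, 2 ^ m, by positivity, fun ψ =>
    (norm_toL2_bessel_mono hs ψ).trans (norm_toL2_bessel_nat_le m ψ)⟩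

theorem norm_toL2_iterate_schwartzDeriv_bessel_neg_le {j k : ℕ} (h : j ≤ k) (ψ : 𝓢(ℝ, F)) :
    ‖toL2 (schwartzDeriv^[j] (bessel (-k) ψ))‖ ≤ (2 * Real.pi) ^ j * ‖toL2 ψ‖ := by
  have hjk : (j : ℝ) + -k ≤ 0 := by simpa using h
  have hψ := norm_toL2_bessel_mono hjk ψ
  rw [bessel_zero] at hψ
  refine (norm_toL2_iterate_schwartzDeriv_le j _).trans ?_
  rw [bessel_bessel]
  gcongr

end NormL2Line

/-! ### Conormal norms on the half-line -/

section LpNorm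

variable {α E E' : Type*} [MeasurableSpace α] {μ : Measure α} {p : ENNReal}
  [NormedAddCommGroup E] [NormedAddCommGroup E']

theorem lpNorm_mono_ae_real {f : α → E} {g : α → ℝ} (hg : MemLp g p μ)
    (h : ∀ᵐ x ∂μ, ‖f x‖ ≤ g x) : lpNorm f p μ ≤ lpNorm g p μ := by
  by_cases hf : AEStronglyMeasurable f μ
  · rw [← toReal_eLpNorm hf, ← toReal_eLpNorm hg.1]
    exact ENNReal.toReal_mono hg.eLpNorm_ne_top (eLpNorm_mono_ae_real h)
  · rw [lpNorm_of_not_aestronglyMeasurable hf]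
    exact lpNorm_nonneg

theorem lpNorm_le_mul_of_ae_le {f : α → E} {g : α → E'} {C : ℝ} (hC : 0 ≤ C) (hg : MemLp g p μ)
    (h : ∀ᵐ x ∂μ, ‖f x‖ ≤ C * ‖g x‖) : lpNorm f p μ ≤ C * lpNorm g p μ := by
  refine (lpNorm_mono_ae_real (hg.norm.const_smul C) h).trans_eq ?_
  rw [lpNorm_const_smul, lpNorm_norm hg.1, coe_nnnorm, Real.norm_of_nonneg hC]

theorem lpNorm_le_mul_sum_of_ae_le {ι : Type*} (s : Finset ι) {f : α → E} {g : ι → α → E'}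
    {C : ℝ} (hp : 1 ≤ p) (hC : 0 ≤ C) (hg : ∀ i ∈ s, MemLp (g i) p μ)
    (h : ∀ᵐ x ∂μ, ‖f x‖ ≤ C * ∑ i ∈ s, ‖g i x‖) :
    lpNorm f p μ ≤ C * ∑ i ∈ s, lpNorm (g i) p μ := by
  have hsum : MemLp (∑ i ∈ s, fun x => ‖g i x‖) p μ := memLp_finsetSum' s fun i hi => (hg i hi).norm
  calc lpNorm f p μ ≤ C * lpNorm (∑ i ∈ s, fun x => ‖g i x‖) p μ := by
        refine lpNorm_le_mul_of_ae_le hC hsum ?_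
        filter_upwards [h] with x hx
        rw [Finset.sum_apply]
        exact hx.trans (mul_le_mul_of_nonneg_left (Real.le_norm_self _) hC)
    _ ≤ C * ∑ i ∈ s, lpNorm (fun x => ‖g i x‖) p μ := by
        gcongr
        exact lpNorm_sum_le (fun i hi => (hg i hi).norm) hp
    _ = C * ∑ i ∈ s, lpNorm (g i) p μ := by
        rw [Finset.sum_congr rfl fun i hi => lpNorm_norm (hg i hi).1 p]

end LpNorm

/-- Lebesgue measure on `(0, ∞)`. -/
abbrev halfMeasure : Measure ℝ := volume.restrict (Set.Ioi 0)

theorem ae_halfMeasure {p : ℝ → Prop} (h : ∀ t, 0 < t → p t) : ∀ᵐ t ∂halfMeasure, p t :=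
  ae_restrict_of_forall_mem measurableSet_Ioi h

/-- The operator `ψ ↦ (1 + t²)^K t^j ψ^{(j)}`. -/
def moment (K j : ℕ) (ψ : 𝓢(ℝ, ℂ)) : 𝓢(ℝ, ℂ) :=
  SchwartzMap.smulLeftCLM ℂ (fun t : ℝ => (1 + (t : ℂ) ^ 2) ^ K * (t : ℂ) ^ j) (schwartzDeriv^[j] ψ)

theorem moment_apply (K j : ℕ) (ψ : 𝓢(ℝ, ℂ)) (t : ℝ) :
    moment K j ψ t = (1 + (t : ℂ) ^ 2) ^ K * (t : ℂ) ^ j * (schwartzDeriv^[j] ψ) t :=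
  SchwartzMap.smulLeftCLM_apply_apply (by fun_prop) _ _

theorem norm_moment_apply (K j : ℕ) (ψ : 𝓢(ℝ, ℂ)) (t : ℝ) :
    ‖moment K j ψ t‖ = (1 + t ^ 2) ^ K * |t| ^ j * ‖(schwartzDeriv^[j] ψ) t‖ := by
  have h : ‖(1 + (t : ℂ) ^ 2)‖ = 1 + t ^ 2 := by
    exact_mod_cast Complex.norm_of_nonneg (by positivity : 0 ≤ 1 + t ^ 2)
  rw [moment_apply, norm_mul, norm_mul, norm_pow, norm_pow, h, Complex.norm_real, Real.norm_eq_abs]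

theorem memLp_halfMeasure (ψ : 𝓢(ℝ, ℂ)) : MemLp ψ 2 halfMeasure := (ψ.memLp 2 volume).restrict _

/-- The norm `∑_{j ≤ K} ‖(1 + t²)^K t^j ψ^{(j)}‖` in `L²(ℝ₊)`. Its terms are invariant under
`κ_r` except for the weight, which decreases when `r ≥ 1`. -/
def conormal (K : ℕ) (ψ : 𝓢(ℝ, ℂ)) : ℝ :=
  ∑ j ∈ Finset.range (K + 1), lpNorm (moment K j ψ) 2 halfMeasure

theorem conormal_mono {K K' : ℕ} (h : K ≤ K') (ψ : 𝓢(ℝ, ℂ)) : conormal K ψ ≤ conormal K' ψ := by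
  have hterm (j : ℕ) :
      lpNorm (moment K j ψ) 2 halfMeasure ≤ lpNorm (moment K' j ψ) 2 halfMeasure := by
    have := lpNorm_le_mul_of_ae_le zero_le_one (memLp_halfMeasure (moment K' j ψ))
      (f := moment K j ψ) (ae_halfMeasure fun t _ => ?_)
    · simpa only [one_mul] using this
    rw [one_mul, norm_moment_apply, norm_moment_apply]
    gcongr
    nlinarith only [sq_nonneg t]
  exact (Finset.sum_le_sum fun j _ => hterm j).trans <|
    Finset.sum_le_sum_of_subset_of_nonneg (Finset.range_mono (by lia)) fun _ _ _ => lpNorm_nonneg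

/-- Functionals on the Schwartz functions which are bounded by some `conormal` norm. -/
def Controlled (p : 𝓢(ℝ, ℂ) → ℝ) : Prop :=
  ∃ (K : ℕ) (C : ℝ), 0 ≤ C ∧ ∀ ψ, p ψ ≤ C * conormal K ψ

theorem Controlled.mono {p q : 𝓢(ℝ, ℂ) → ℝ} (hq : Controlled q) (h : ∀ ψ, p ψ ≤ q ψ) :
    Controlled p := by
  obtain ⟨K, C, hC, hq⟩ := hq
  exact ⟨K, C, hC, fun ψ => (h ψ).trans (hq ψ)⟩

theorem Controlled.add {p q : 𝓢(ℝ, ℂ) → ℝ} (hp : Controlled p) (hq : Controlled q) :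
    Controlled fun ψ => p ψ + q ψ := by
  obtain ⟨K, C, hC, hp⟩ := hp
  obtain ⟨K', C', hC', hq⟩ := hq
  refine ⟨max K K', C + C', by positivity, fun ψ => ?_⟩
  rw [add_mul]
  exact add_le_add
    ((hp ψ).trans (mul_le_mul_of_nonneg_left (conormal_mono (le_max_left K K') ψ) hC))
    ((hq ψ).trans (mul_le_mul_of_nonneg_left (conormal_mono (le_max_right K K') ψ) hC'))

theorem Controlled.const_mul {p : 𝓢(ℝ, ℂ) → ℝ} (hp : Controlled p) {c : ℝ} (hc : 0 ≤ c) :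
    Controlled fun ψ => c * p ψ := by
  obtain ⟨K, C, hC, hp⟩ := hp
  refine ⟨K, c * C, by positivity, fun ψ => ?_⟩
  rw [mul_assoc]
  exact mul_le_mul_of_nonneg_left (hp ψ) hc

theorem controlled_zero : Controlled fun _ => 0 :=
  ⟨0, 0, le_rfl, fun ψ => by rw [zero_mul]⟩

theorem Controlled.sum {ι : Type*} (s : Finset ι) {p : ι → 𝓢(ℝ, ℂ) → ℝ}
    (hp : ∀ i ∈ s, Controlled (p i)) : Controlled fun ψ => ∑ i ∈ s, p i ψ := by
  classical
  induction s using Finset.induction_on with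
  | empty => simpa only [Finset.sum_empty] using controlled_zero
  | insert a s ha ih =>
    simp only [Finset.sum_insert ha]
    exact (hp a (by simp)).add (ih fun i hi => hp i (by simp [hi]))

theorem controlled_lpNorm_mul_iterate_deriv (j K : ℕ) {b : ℝ → ℝ} {C : ℝ} (hC : 0 ≤ C)
    (hb : ∀ t, 0 < t → |b t| ≤ C * ((1 + t ^ 2) ^ K * t ^ j)) :
    Controlled fun ψ => lpNorm (fun t => (b t : ℂ) * (schwartzDeriv^[j] ψ) t) 2 halfMeasure := by
  refine ⟨K + j, C, hC, fun ψ => ?_⟩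
  calc lpNorm (fun t => (b t : ℂ) * (schwartzDeriv^[j] ψ) t) 2 halfMeasure
    _ ≤ C * lpNorm (moment (K + j) j ψ) 2 halfMeasure := by
      refine lpNorm_le_mul_of_ae_le hC (memLp_halfMeasure _) (ae_halfMeasure fun t ht => ?_)
      rw [norm_moment_apply, norm_mul, Complex.norm_real, Real.norm_eq_abs, abs_of_pos ht,
        ← mul_assoc]
      refine mul_le_mul_of_nonneg_right ((hb t ht).trans ?_) (norm_nonneg _)
      have hpow : (1 + t ^ 2) ^ K ≤ (1 + t ^ 2) ^ (K + j) :=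
        pow_le_pow_right₀ (by nlinarith only [sq_nonneg t]) (by lia)
      gcongr
    _ ≤ C * conormal (K + j) ψ := mul_le_mul_of_nonneg_left
      (Finset.single_le_sum (f := fun i => lpNorm (moment (K + j) i ψ) 2 halfMeasure)
        (fun _ _ => lpNorm_nonneg)
        (Finset.mem_range.2 (Nat.lt_succ_of_le (Nat.le_add_left j K)))) hC

theorem eLpNorm_two_image {E : Type*} [NormedAddCommGroup E] [NormedSpace ℝ E] {s : Set ℝ}
    (hs : MeasurableSet s) {φ φ' : ℝ → ℝ} (hφ : ∀ t ∈ s, HasDerivWithinAt φ (φ' t) s t)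
    (hinj : Set.InjOn φ s) (f : ℝ → E) :
    eLpNorm f 2 (volume.restrict (φ '' s)) =
      eLpNorm (fun t => √|φ' t| • f (φ t)) 2 (volume.restrict s) := by
  have hsqrt (t : ℝ) : ‖√|φ' t|‖ₑ ^ 2 = ENNReal.ofReal |φ' t| := by
    rw [← ofReal_norm, ← ENNReal.ofReal_pow (norm_nonneg _), Real.norm_eq_abs, sq_abs,
      Real.sq_sqrt (abs_nonneg _)]
  simp only [eLpNorm_eq_lintegral_rpow_enorm_toReal two_ne_zero ENNReal.ofNat_ne_top,
    ENNReal.toReal_ofNat, ENNReal.rpow_ofNat, enorm_smul, mul_pow, hsqrt,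
    lintegral_image_eq_lintegral_abs_deriv_mul hs hφ hinj]

/-! ### The substitution `t = e^{-r}` -/

section LogPull

variable {F : Type*} [NormedAddCommGroup F] [NormedSpace ℝ F]

/-- Smooth functions on the line vanishing for large `t`. -/
structure IsNear (φ : ℝ → F) : Prop where
  contDiff : ContDiff ℝ ∞ φ
  eventually_eq_zero : ∀ᶠ t in Filter.atTop, φ t = 0

theorem IsNear.add {φ φ' : ℝ → F} (h : IsNear φ) (h' : IsNear φ') :
    IsNear fun t => φ t + φ' t where
  contDiff := h.contDiff.add h'.contDiff
  eventually_eq_zero := by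
    filter_upwards [h.eventually_eq_zero, h'.eventually_eq_zero] with t ht ht'
    rw [ht, ht', add_zero]

theorem IsNear.smul_left {b : ℝ → ℝ} {φ : ℝ → F} (h : IsNear φ) (hb : ContDiff ℝ ∞ b) :
    IsNear fun t => b t • φ t where
  contDiff := hb.smul h.contDiff
  eventually_eq_zero := by
    filter_upwards [h.eventually_eq_zero] with t ht
    rw [ht, smul_zero]

theorem IsNear.smul_right {b : ℝ → ℝ} {φ : ℝ → F} (h : IsNear b) (hφ : ContDiff ℝ ∞ φ) :
    IsNear fun t => b t • φ t where
  contDiff := h.contDiff.smul hφ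
  eventually_eq_zero := by
    filter_upwards [h.eventually_eq_zero] with t ht
    rw [ht, zero_smul]

theorem IsNear.deriv {φ : ℝ → F} (h : IsNear φ) : IsNear (deriv φ) where
  contDiff := (contDiff_infty_iff_deriv.1 h.contDiff).2
  eventually_eq_zero := by
    obtain ⟨R, hR⟩ := Filter.eventually_atTop.1 h.eventually_eq_zero
    filter_upwards [Filter.eventually_gt_atTop R] with t ht
    have heq : φ =ᶠ[nhds t] fun _ => 0 := by
      filter_upwards [lt_mem_nhds ht] with r hr using hR r hr.le
    rw [heq.deriv_eq, deriv_const]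

theorem IsNear.exists_bound {φ : ℝ → F} (h : IsNear φ) :
    ∃ C : ℝ, 0 ≤ C ∧ ∀ t, 0 < t → ‖φ t‖ ≤ C := by
  obtain ⟨R, hR⟩ := Filter.eventually_atTop.1 h.eventually_eq_zero
  obtain ⟨C, hC⟩ := (isCompact_Icc (a := 0) (b := R)).exists_bound_of_continuousOn
    h.contDiff.continuous.continuousOn
  refine ⟨max C 0, le_max_right _ _, fun t ht => ?_⟩
  rcases le_total t R with htR | htR
  · exact (hC t ⟨ht.le, htR⟩).trans (le_max_left _ _)
  · rw [hR t htR, norm_zero]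
    exact le_max_right _ _

/-- The operator `1/2 + t∂_t`. -/
def eulerShift (φ : ℝ → F) (t : ℝ) : F := (2⁻¹ : ℝ) • φ t + t • deriv φ t

theorem IsNear.eulerShift {φ : ℝ → F} (h : IsNear φ) : IsNear (eulerShift φ) :=
  (h.smul_left contDiff_const).add (h.deriv.smul_left contDiff_id)

/-- The function `e^{-r/2} φ(e^{-r})`; this substitution is isometric from `L²(ℝ₊)` to `L²(ℝ)`. -/
def logPullFun (φ : ℝ → F) (r : ℝ) : F := Real.exp (-r / 2) • φ (Real.exp (-r))

theorem hasDerivAt_exp_neg (r : ℝ) :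
    HasDerivAt (fun r : ℝ => Real.exp (-r)) (-Real.exp (-r)) r := by
  simpa using (hasDerivAt_neg r).exp

theorem hasDerivAt_logPullFun {φ : ℝ → F} {r : ℝ} (hφ : DifferentiableAt ℝ φ (Real.exp (-r))) :
    HasDerivAt (logPullFun φ) (-logPullFun (eulerShift φ) r) r := by
  have hhalf : HasDerivAt (fun r : ℝ => Real.exp (-r / 2)) (Real.exp (-r / 2) * (-1 / 2)) r :=
    ((hasDerivAt_neg r).div_const 2).exp
  refine (hhalf.smul (hφ.hasDerivAt.scomp r (hasDerivAt_exp_neg r))).congr_deriv ?_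
  simp only [logPullFun, eulerShift, Function.comp_apply]
  module

theorem contDiff_logPullFun {φ : ℝ → F} (hφ : ContDiff ℝ ∞ φ) : ContDiff ℝ ∞ (logPullFun φ) :=
  (contDiff_neg.div_const 2).exp.smul (hφ.comp contDiff_neg.exp)

theorem abs_pow_mul_exp_neg_half_le (k : ℕ) {r R : ℝ} (h : Real.exp (-r) ≤ R) :
    |r| ^ k * Real.exp (-r / 2) ≤ 2 ^ k * k.factorial * max 1 R := by
  have hpow : |r| ^ k ≤ 2 ^ k * k.factorial * Real.exp (|r| / 2) := by
    have := Real.pow_div_factorial_le_exp (|r| / 2) (by positivity) k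
    rw [div_le_iff₀ (by positivity), div_pow, div_le_iff₀ (by positivity)] at this
    linarith
  have hexp : Real.exp (|r| / 2) * Real.exp (-r / 2) ≤ max 1 R := by
    rw [← Real.exp_add]
    rcases le_total 0 r with hr | hr
    · rw [abs_of_nonneg hr, ← add_div, add_neg_cancel, zero_div, Real.exp_zero]
      exact le_max_left _ _
    · rw [abs_of_nonpos hr, add_halves]
      exact h.trans (le_max_right _ _)
  calc |r| ^ k * Real.exp (-r / 2)
    _ ≤ 2 ^ k * k.factorial * Real.exp (|r| / 2) * Real.exp (-r / 2) := by gcongr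
    _ ≤ 2 ^ k * k.factorial * max 1 R := by rw [mul_assoc]; gcongr

theorem IsNear.exists_pow_mul_norm_logPullFun_le {φ : ℝ → F} (h : IsNear φ) (k : ℕ) :
    ∃ C : ℝ, ∀ r, ‖r‖ ^ k * ‖logPullFun φ r‖ ≤ C := by
  obtain ⟨B, hB₀, hB⟩ := h.exists_bound
  obtain ⟨R, hR⟩ := Filter.eventually_atTop.1 h.eventually_eq_zero
  refine ⟨2 ^ k * k.factorial * max 1 R * B, fun r => ?_⟩
  rw [logPullFun, norm_smul, Real.norm_of_nonneg (Real.exp_pos _).le, Real.norm_eq_abs, ← mul_assoc]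
  rcases le_total R (Real.exp (-r)) with hr | hr
  · rw [hR _ hr, norm_zero, mul_zero]
    positivity
  · exact mul_le_mul (abs_pow_mul_exp_neg_half_le k hr) (hB _ (Real.exp_pos _)) (norm_nonneg _)
      (by positivity)

theorem IsNear.exists_pow_mul_norm_iteratedDeriv_logPullFun_le (n k : ℕ) {φ : ℝ → F}
    (h : IsNear φ) : ∃ C : ℝ, ∀ r, ‖r‖ ^ k * ‖iteratedDeriv n (logPullFun φ) r‖ ≤ C := by
  induction n generalizing φ with
  | zero => simpa using h.exists_pow_mul_norm_logPullFun_le k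
  | succ n ih =>
    have hderiv : _root_.deriv (logPullFun φ) = -logPullFun (GreenSymbols.eulerShift φ) :=
      funext fun r => (hasDerivAt_logPullFun (h.contDiff.differentiable (by simp) _)).deriv
    simpa only [iteratedDeriv_succ', hderiv, iteratedDeriv_neg, norm_neg] using ih h.eulerShift

/-- The substitution `logPullFun` as a map into the Schwartz functions. -/
def logPull (φ : ℝ → F) (hφ : IsNear φ) : 𝓢(ℝ, F) where
  toFun := logPullFun φ
  smooth' := contDiff_logPullFun hφ.contDiff
  decay' k n := by
    simpa only [norm_iteratedFDeriv_eq_norm_iteratedDeriv] using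
      hφ.exists_pow_mul_norm_iteratedDeriv_logPullFun_le n k

theorem logPull_apply {φ : ℝ → F} (hφ : IsNear φ) (r : ℝ) :
    logPull φ hφ r = Real.exp (-r / 2) • φ (Real.exp (-r)) := rfl

theorem image_exp_neg_univ : (fun r : ℝ => Real.exp (-r)) '' Set.univ = Set.Ioi 0 := by
  rw [Set.image_univ, ← Real.range_exp]
  exact neg_surjective.range_comp Real.exp

theorem eLpNorm_logPullFun (φ : ℝ → F) :
    eLpNorm (logPullFun φ) 2 volume = eLpNorm φ 2 halfMeasure := by
  have hsubst := eLpNorm_two_image MeasurableSet.univ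
    (fun r _ => (hasDerivAt_exp_neg r).hasDerivWithinAt)
    ((Real.exp_injective.comp neg_injective).injOn) φ
  rw [image_exp_neg_univ, Measure.restrict_univ] at hsubst
  rw [hsubst]
  congr 1 with r
  rw [logPullFun, Real.exp_half, abs_neg, abs_of_pos (Real.exp_pos _)]

end LogPull

/-- The map `ψ ↦ e^{-r/2} b(e^{-r}) ψ(e^{-r})` on Schwartz functions. -/
def near (b : ℝ → ℝ) (hb : IsNear b) : 𝓢(ℝ, ℂ) →ₗ[ℂ] 𝓢(ℝ, ℂ) where
  toFun ψ := logPull (fun t => b t • ψ t) (hb.smul_right (ψ.smooth ⊤))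
  map_add' φ ψ := by
    ext r
    simp only [logPull_apply, _root_.add_apply, smul_add]
  map_smul' c ψ := by
    ext r
    simp only [logPull_apply, _root_.smul_apply, RingHom.id_apply, smul_comm c]

theorem near_apply {b : ℝ → ℝ} (hb : IsNear b) (ψ : 𝓢(ℝ, ℂ)) (r : ℝ) :
    near b hb ψ r = ((Real.exp (-r / 2) * b (Real.exp (-r)) : ℝ) : ℂ) * ψ (Real.exp (-r)) := by
  rw [Complex.ofReal_mul, mul_assoc, ← Complex.real_smul, ← Complex.real_smul]
  rfl

theorem IsNear.pow_mul {b : ℝ → ℝ} (hb : IsNear b) (j : ℕ) : IsNear fun t => t ^ j * b t :=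
  hb.smul_left (contDiff_id.pow j)

theorem schwartzDeriv_near_pow_mul {b : ℝ → ℝ} (hb : IsNear b) (j : ℕ) (ψ : 𝓢(ℝ, ℂ)) :
    schwartzDeriv (near _ (hb.pow_mul j) ψ) =
      -(near _ ((hb.eulerShift.add (hb.smul_left (b := fun _ => j) contDiff_const)).pow_mul j) ψ +
        near _ (hb.pow_mul (j + 1)) (schwartzDeriv ψ)) := by
  ext r
  have hφ : HasDerivAt (fun t => (t ^ j * b t) • ψ t) _ (Real.exp (-r)) :=
    ((hasDerivAt_pow j _).mul
      (hb.contDiff.differentiable (by simp) _).hasDerivAt).smul (ψ.hasDerivAt _)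
  rw [SchwartzMap.derivCLM_apply]
  refine (hasDerivAt_logPullFun hφ.differentiableAt).deriv.trans ?_
  simp only [logPullFun, eulerShift, hφ.deriv]
  simp only [_root_.neg_apply, _root_.add_apply, near_apply, SchwartzMap.derivCLM_apply,
    Complex.real_smul, smul_eq_mul, Pi.mul_apply]
  rcases j with _ | j
  · push_cast
    ring
  · rw [Nat.add_sub_cancel]
    push_cast
    ring

theorem norm_toL2_near {b : ℝ → ℝ} (hb : IsNear b) (ψ : 𝓢(ℝ, ℂ)) :
    ‖toL2 (near b hb ψ)‖ = lpNorm (fun t => (b t : ℂ) * ψ t) 2 halfMeasure := by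
  have hmeas : AEStronglyMeasurable (fun t => b t • ψ t) halfMeasure :=
    (hb.contDiff.continuous.smul ψ.continuous).aestronglyMeasurable
  simp_rw [← Complex.real_smul]
  rw [norm_toL2_eq_lpNorm, ← toReal_eLpNorm (near b hb ψ).continuous.aestronglyMeasurable,
    ← toReal_eLpNorm hmeas, ← eLpNorm_logPullFun]
  rfl

theorem controlled_iterate_deriv_near (i j : ℕ) {b : ℝ → ℝ} (hb : IsNear b) :
    Controlled fun ψ =>
      ‖toL2 (schwartzDeriv^[i] (near _ (hb.pow_mul j) (schwartzDeriv^[j] ψ)))‖ := by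
  induction i generalizing b j with
  | zero =>
    obtain ⟨C, hC, hbC⟩ := hb.exists_bound
    refine (controlled_lpNorm_mul_iterate_deriv j 0 (b := fun t => t ^ j * b t) hC
      fun t ht => ?_).mono fun ψ => (norm_toL2_near _ _).le
    rw [abs_mul, abs_of_pos (by positivity : 0 < t ^ j), pow_zero, one_mul, mul_comm]
    exact mul_le_mul_of_nonneg_right (hbC t ht) (by positivity)
  | succ i ih =>
    have hshift : IsNear fun t => eulerShift b t + (j : ℝ) • b t :=
      hb.eulerShift.add (hb.smul_left contDiff_const)
    refine ((ih j hshift).add (ih (j + 1) hb)).mono fun ψ => ?_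
    rw [Function.iterate_succ_apply, schwartzDeriv_near_pow_mul hb, iterate_map_neg,
      iterate_map_add, map_neg, norm_neg, map_add, ← Function.iterate_succ_apply' schwartzDeriv j]
    exact norm_add_le _ _

theorem controlled_bessel_near (s : ℝ) {b : ℝ → ℝ} (hb : IsNear b) :
    Controlled fun ψ => ‖toL2 (bessel s (near b hb ψ))‖ := by
  obtain ⟨K, C, hC, hK⟩ := exists_norm_toL2_bessel_le (F := ℂ) s
  refine ((Controlled.sum (Finset.range K)
    fun i _ => controlled_iterate_deriv_near i 0 hb).const_mul hC).mono fun ψ => ?_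
  simpa only [pow_zero, one_mul, Function.iterate_zero, id_eq] using hK (near b hb ψ)

/-! ### Multiplication by functions supported away from the origin -/

/-- Smooth functions of temperate growth vanishing to the left of some positive number. -/
structure IsFar (b : ℝ → ℝ) : Prop where
  hasTemperateGrowth : b.HasTemperateGrowth
  exists_eq_zero : ∃ ε : ℝ, 0 < ε ∧ ∀ t, t ≤ ε → b t = 0

theorem hasTemperateGrowth_deriv {F : Type*} [NormedAddCommGroup F] [NormedSpace ℝ F] {b : ℝ → F}
    (hb : b.HasTemperateGrowth) : (deriv b).HasTemperateGrowth := by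
  refine ⟨(contDiff_infty_iff_deriv.1 hb.1).2, fun n => ?_⟩
  obtain ⟨k, C, h⟩ := hb.2 (n + 1)
  exact ⟨k, C, by
    simpa only [norm_iteratedFDeriv_eq_norm_iteratedDeriv, iteratedDeriv_succ'] using h⟩

theorem hasTemperateGrowth_ofReal_comp {b : ℝ → ℝ} (hb : b.HasTemperateGrowth) :
    (fun t => (b t : ℂ)).HasTemperateGrowth :=
  Function.Complex.hasTemperateGrowth_ofReal.comp hb

theorem IsFar.deriv {b : ℝ → ℝ} (hb : IsFar b) : IsFar (deriv b) where
  hasTemperateGrowth := hasTemperateGrowth_deriv hb.hasTemperateGrowth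
  exists_eq_zero := by
    obtain ⟨ε, hε, h₀⟩ := hb.exists_eq_zero
    refine ⟨ε / 2, half_pos hε, fun t ht => ?_⟩
    have heq : b =ᶠ[nhds t] fun _ => 0 := by
      filter_upwards [gt_mem_nhds (ht.trans_lt (half_lt_self hε))] with r hr using h₀ r hr.le
    rw [heq.deriv_eq, deriv_const]

/-- Multiplication of Schwartz functions by a real function. -/
def mulReal (b : ℝ → ℝ) : 𝓢(ℝ, ℂ) →L[ℂ] 𝓢(ℝ, ℂ) := SchwartzMap.smulLeftCLM ℂ fun t => (b t : ℂ)

theorem mulReal_apply {b : ℝ → ℝ} (hb : b.HasTemperateGrowth) (ψ : 𝓢(ℝ, ℂ)) (t : ℝ) :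
    mulReal b ψ t = (b t : ℂ) * ψ t :=
  SchwartzMap.smulLeftCLM_apply_apply (hasTemperateGrowth_ofReal_comp hb) ψ t

theorem schwartzDeriv_mulReal {b : ℝ → ℝ} (hb : b.HasTemperateGrowth) (ψ : 𝓢(ℝ, ℂ)) :
    schwartzDeriv (mulReal b ψ) = mulReal (deriv b) ψ + mulReal b (schwartzDeriv ψ) := by
  ext t
  rw [SchwartzMap.derivCLM_apply, _root_.add_apply, mulReal_apply (hasTemperateGrowth_deriv hb),
    mulReal_apply hb, SchwartzMap.derivCLM_apply, funext (mulReal_apply hb ψ)]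
  exact ((hb.1.differentiable (by simp) t).hasDerivAt.ofReal_comp.mul (ψ.hasDerivAt t)).deriv

theorem IsFar.exists_bound {b : ℝ → ℝ} (hb : IsFar b) (j : ℕ) : ∃ (K : ℕ) (C : ℝ), 0 ≤ C ∧
    ∀ t, 0 < t → |b t| ≤ C * ((1 + t ^ 2) ^ K * t ^ j) := by
  obtain ⟨h, ε, hε, h₀⟩ := hb
  obtain ⟨k, C, hC⟩ := h.2 0
  simp only [norm_iteratedFDeriv_zero, Real.norm_eq_abs] at hC
  have hC₀ : 0 ≤ C := by simpa using (abs_nonneg _).trans (hC 0)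
  refine ⟨k, C * 2 ^ k * ε⁻¹ ^ j, by positivity, fun t ht => ?_⟩
  rcases le_total t ε with hle | hle
  · rw [h₀ t hle, abs_zero]
    positivity
  · have hgrowth : (1 + |t|) ^ k ≤ 2 ^ k * (1 + t ^ 2) ^ k := by
      rw [← mul_pow, abs_of_pos ht]
      exact pow_le_pow_left₀ (by positivity) (by nlinarith only [sq_nonneg (t - 1)]) k
    have hone : 1 ≤ ε⁻¹ ^ j * t ^ j := by
      rw [← mul_pow, inv_mul_eq_div]
      exact one_le_pow₀ ((one_le_div hε).2 hle)
    calc |b t| ≤ C * (1 + |t|) ^ k := hC t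
      _ ≤ C * (2 ^ k * (1 + t ^ 2) ^ k) * 1 := by rw [mul_one]; gcongr
      _ ≤ C * (2 ^ k * (1 + t ^ 2) ^ k) * (ε⁻¹ ^ j * t ^ j) := by gcongr
      _ = C * 2 ^ k * ε⁻¹ ^ j * ((1 + t ^ 2) ^ k * t ^ j) := by ring

theorem IsFar.norm_toL2_mulReal {b : ℝ → ℝ} (hb : IsFar b) (ψ : 𝓢(ℝ, ℂ)) :
    ‖toL2 (mulReal b ψ)‖ = lpNorm (fun t => (b t : ℂ) * ψ t) 2 halfMeasure := by
  obtain ⟨hb, ε, hε, h₀⟩ := hb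
  have hindicator : (Set.Ioi (0 : ℝ)).indicator (mulReal b ψ) = mulReal b ψ :=
    Set.indicator_eq_self.2 <| Function.support_subset_iff'.2 fun t ht => by
      rw [mulReal_apply hb, h₀ t ((not_lt.1 ht).trans hε.le), Complex.ofReal_zero, zero_mul]
  have hmeas {μ : Measure ℝ} : AEStronglyMeasurable (mulReal b ψ) μ :=
    (mulReal b ψ).continuous.aestronglyMeasurable
  rw [norm_toL2_eq_lpNorm, ← funext (mulReal_apply hb ψ), ← toReal_eLpNorm hmeas,
    ← toReal_eLpNorm hmeas, ← eLpNorm_indicator_eq_eLpNorm_restrict measurableSet_Ioi, hindicator]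

theorem controlled_iterate_deriv_far (i j : ℕ) {b : ℝ → ℝ} (hb : IsFar b) :
    Controlled fun ψ => ‖toL2 (schwartzDeriv^[i] (mulReal b (schwartzDeriv^[j] ψ)))‖ := by
  induction i generalizing b j with
  | zero =>
    obtain ⟨K, C, hC, hbC⟩ := hb.exists_bound j
    exact (controlled_lpNorm_mul_iterate_deriv j K hC hbC).mono
      fun ψ => (hb.norm_toL2_mulReal _).le
  | succ i ih =>
    refine ((ih j hb.deriv).add (ih (j + 1) hb)).mono fun ψ => ?_
    rw [Function.iterate_succ_apply, schwartzDeriv_mulReal hb.hasTemperateGrowth, iterate_map_add,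
      map_add, ← Function.iterate_succ_apply' schwartzDeriv j]
    exact norm_add_le _ _

theorem controlled_bessel_far (s : ℝ) {b : ℝ → ℝ} (hb : IsFar b) :
    Controlled fun ψ => ‖toL2 (bessel s (mulReal b ψ))‖ := by
  obtain ⟨K, C, hC, hK⟩ := exists_norm_toL2_bessel_le (F := ℂ) s
  exact ((Controlled.sum (Finset.range K)
    fun i _ => controlled_iterate_deriv_far i 0 hb).const_mul hC).mono fun ψ => hK _

/-! ### Dilations -/

theorem dilSchwartz_apply {r : ℝ} (hr : 0 < r) (ψ : 𝓢(ℝ, ℂ)) (t : ℝ) :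
    dilSchwartz r hr ψ t = ((r ^ (1 / 2 : ℝ) : ℝ) : ℂ) * ψ (r * t) := rfl

theorem schwartzDeriv_dilSchwartz {r : ℝ} (hr : 0 < r) (ψ : 𝓢(ℝ, ℂ)) :
    schwartzDeriv (dilSchwartz r hr ψ) = (r : ℂ) • dilSchwartz r hr (schwartzDeriv ψ) := by
  ext t
  have hscale : HasDerivAt (fun t : ℝ => r * t) r t := by simpa using (hasDerivAt_id t).const_mul r
  have hderiv := ((ψ.hasDerivAt (r * t)).scomp t hscale).const_mul (((r ^ (1 / 2 : ℝ) : ℝ) : ℂ))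
  rw [SchwartzMap.derivCLM_apply, _root_.smul_apply, dilSchwartz_apply, SchwartzMap.derivCLM_apply]
  refine hderiv.deriv.trans ?_
  rw [Complex.real_smul, smul_eq_mul, mul_left_comm]

theorem iterate_schwartzDeriv_dilSchwartz {r : ℝ} (hr : 0 < r) (j : ℕ) (ψ : 𝓢(ℝ, ℂ)) :
    schwartzDeriv^[j] (dilSchwartz r hr ψ) =
      (r : ℂ) ^ j • dilSchwartz r hr (schwartzDeriv^[j] ψ) := by
  induction j with
  | zero => simp
  | succ j ih =>
    rw [Function.iterate_succ_apply', ih, map_smul, schwartzDeriv_dilSchwartz, smul_smul, pow_succ,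
      Function.iterate_succ_apply' schwartzDeriv j]

theorem lpNorm_dilSchwartz {r : ℝ} (hr : 0 < r) (ψ : 𝓢(ℝ, ℂ)) :
    lpNorm (dilSchwartz r hr ψ) 2 halfMeasure = lpNorm ψ 2 halfMeasure := by
  have hsubst := eLpNorm_two_image (s := Set.Ioi 0) (φ := (r * ·)) (φ' := fun _ => r)
    measurableSet_Ioi (fun t _ => by simpa using ((hasDerivAt_id t).const_mul r).hasDerivWithinAt)
    (mul_right_injective₀ hr.ne').injOn ψ
  rw [Set.image_const_mul_Ioi_zero hr] at hsubst
  rw [← toReal_eLpNorm (dilSchwartz r hr ψ).continuous.aestronglyMeasurable,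
    ← toReal_eLpNorm ψ.continuous.aestronglyMeasurable, hsubst]
  congr 2 with t
  rw [dilSchwartz_apply, ← Real.sqrt_eq_rpow, abs_of_pos hr, Complex.real_smul]

theorem conormal_dilSchwartz_le_mul {r : ℝ} (hr : 0 < r) (K : ℕ) (ψ : 𝓢(ℝ, ℂ)) :
    conormal K (dilSchwartz r hr ψ) ≤ max 1 (r⁻¹ ^ 2) ^ K * conormal K ψ := by
  unfold conormal
  rw [Finset.mul_sum]
  refine Finset.sum_le_sum fun j _ => ?_
  rw [← lpNorm_dilSchwartz hr (moment K j ψ)]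
  refine lpNorm_le_mul_of_ae_le (by positivity) (memLp_halfMeasure _) (.of_forall fun t => ?_)
  have hweight : 1 + t ^ 2 ≤ max 1 (r⁻¹ ^ 2) * (1 + (r * t) ^ 2) := by
    have ht : t ^ 2 = r⁻¹ ^ 2 * (r * t) ^ 2 := by field_simp
    rw [mul_add, mul_one]
    refine add_le_add (le_max_left _ _) (ht.trans_le ?_)
    gcongr
    exact le_max_right _ _
  rw [norm_moment_apply, iterate_schwartzDeriv_dilSchwartz, _root_.smul_apply, dilSchwartz_apply,
    dilSchwartz_apply, norm_mul, norm_moment_apply, norm_smul, norm_mul, norm_pow,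
    Complex.norm_real, Complex.norm_real, Real.norm_of_nonneg hr.le, abs_mul, abs_of_pos hr,
    mul_pow]
  calc (1 + t ^ 2) ^ K * |t| ^ j *
        (r ^ j * (‖r ^ (1 / 2 : ℝ)‖ * ‖(schwartzDeriv^[j] ψ) (r * t)‖))
    _ ≤ (max 1 (r⁻¹ ^ 2) * (1 + (r * t) ^ 2)) ^ K * |t| ^ j *
        (r ^ j * (‖r ^ (1 / 2 : ℝ)‖ * ‖(schwartzDeriv^[j] ψ) (r * t)‖)) := by gcongr
    _ = _ := by rw [mul_pow]; ring

theorem conormal_dilSchwartz_le {r : ℝ} (hr : 1 ≤ r) (K : ℕ) (ψ : 𝓢(ℝ, ℂ)) :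
    conormal K (dilSchwartz r (zero_lt_one.trans_le hr) ψ) ≤ conormal K ψ := by
  have h := conormal_dilSchwartz_le_mul (zero_lt_one.trans_le hr) K ψ
  rwa [max_eq_left (pow_le_one₀ (by positivity) (inv_le_one_of_one_le₀ hr)), one_pow, one_mul] at h

/-! ### Japanese brackets -/

theorem hasTemperateGrowth_japanese (δ : ℝ) : (japanese δ).HasTemperateGrowth :=
  Function.hasTemperateGrowth_one_add_norm_sq_rpow ℝ (δ / 2)

theorem japanese_pos (δ t : ℝ) : 0 < japanese δ t := by unfold japanese; positivity

theorem japanese_zero (t : ℝ) : japanese 0 t = 1 := by rw [japanese, zero_div, Real.rpow_zero]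

theorem japanese_mono {δ δ' : ℝ} (h : δ ≤ δ') (t : ℝ) : japanese δ t ≤ japanese δ' t :=
  Real.rpow_le_rpow_of_exponent_le (le_add_of_nonneg_right (sq_nonneg _)) (by linarith)

theorem japanese_add (δ δ' t : ℝ) : japanese (δ + δ') t = japanese δ t * japanese δ' t := by
  unfold japanese
  rw [← Real.rpow_add (by positivity), add_div]

theorem japanese_two_mul (K : ℕ) (t : ℝ) : japanese (2 * K) t = (1 + t ^ 2) ^ K := by
  unfold japanese
  rw [mul_div_cancel_left₀ _ two_ne_zero, Real.rpow_natCast, Real.norm_eq_abs, sq_abs]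

theorem abs_pow_le_japanese (a : ℕ) (t : ℝ) : |t| ^ a ≤ japanese a t := by
  have h : |t| ^ a = (|t| ^ 2) ^ ((a : ℝ) / 2) := by
    rw [← Real.rpow_natCast, ← Real.rpow_natCast, ← Real.rpow_mul (abs_nonneg t)]
    congr 1
    push_cast
    ring
  rw [h]
  exact Real.rpow_le_rpow (by positivity) (le_add_of_nonneg_left zero_le_one) (by positivity)

theorem hasDerivAt_japanese (δ t : ℝ) :
    HasDerivAt (japanese δ) (δ * (t * japanese (δ - 2) t)) t := by
  have hbase : HasDerivAt (fun t : ℝ => 1 + ‖t‖ ^ 2) (2 * t) t := by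
    simpa only [Real.norm_eq_abs, sq_abs, Nat.cast_ofNat, Nat.add_one_sub_one, pow_one] using
      (hasDerivAt_pow 2 t).const_add 1
  refine (hbase.rpow_const (p := δ / 2) (Or.inl (by positivity))).congr_deriv ?_
  rw [japanese, sub_div, div_self two_ne_zero]
  ring

theorem exists_abs_iteratedDeriv_pow_mul_japanese_le (i a : ℕ) (δ : ℝ) : ∃ C : ℝ, 0 ≤ C ∧ ∀ t,
    |iteratedDeriv i (fun t => t ^ a * japanese δ t) t| ≤ C * japanese (a + δ) t := by
  induction i generalizing a δ with
  | zero =>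
    refine ⟨1, zero_le_one, fun t => ?_⟩
    rw [iteratedDeriv_zero, abs_mul, abs_pow, abs_of_pos (japanese_pos δ t), japanese_add, one_mul]
    exact mul_le_mul_of_nonneg_right (abs_pow_le_japanese a t) (japanese_pos δ t).le
  | succ i ih =>
    obtain ⟨C₁, hC₁, h₁⟩ := ih (a - 1) δ
    obtain ⟨C₂, hC₂, h₂⟩ := ih (a + 1) (δ - 2)
    refine ⟨a * C₁ + |δ| * C₂, by positivity, fun t => ?_⟩
    have hderiv : deriv (fun t => t ^ a * japanese δ t) =
        (fun t => (a : ℝ) * (t ^ (a - 1) * japanese δ t)) +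
          fun t => δ * (t ^ (a + 1) * japanese (δ - 2) t) := by
      ext t
      refine ((hasDerivAt_pow a t).mul (hasDerivAt_japanese δ t)).deriv.trans ?_
      simp only [Pi.add_apply]
      ring
    have hsmooth (a : ℕ) (δ : ℝ) : ContDiff ℝ i fun t : ℝ => t ^ a * japanese δ t :=
      ((contDiff_id.pow a).mul (contDiff_japanese δ)).of_le (by exact_mod_cast le_top)
    have hle₁ : japanese ((a - 1 : ℕ) + δ) t ≤ japanese (a + δ) t :=
      japanese_mono (by gcongr; exact Nat.sub_le a 1) t
    have hle₂ : japanese ((a + 1 : ℕ) + (δ - 2)) t ≤ japanese (a + δ) t :=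
      japanese_mono (by push_cast; linarith) t
    rw [iteratedDeriv_succ', hderiv, iteratedDeriv_add
      (contDiff_const.mul (hsmooth _ _)).contDiffAt (contDiff_const.mul (hsmooth _ _)).contDiffAt,
      iteratedDeriv_const_mul_field, iteratedDeriv_const_mul_field]
    refine (abs_add_le _ _).trans ?_
    rw [abs_mul, abs_mul, Nat.abs_cast, add_mul, mul_assoc, mul_assoc]
    gcongr
    · exact (h₁ t).trans (mul_le_mul_of_nonneg_left hle₁ hC₁)
    · exact (h₂ t).trans (mul_le_mul_of_nonneg_left hle₂ hC₂)

theorem exists_abs_iteratedDeriv_japanese_le (i : ℕ) (δ : ℝ) : ∃ C : ℝ, 0 ≤ C ∧ ∀ t,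
    |iteratedDeriv i (japanese δ) t| ≤ C * japanese δ t := by
  simpa using exists_abs_iteratedDeriv_pow_mul_japanese_le i 0 δ

/-! ### Conormal norms of products -/

theorem iterate_schwartzDeriv_apply (j : ℕ) (ψ : 𝓢(ℝ, ℂ)) (t : ℝ) :
    (schwartzDeriv^[j] ψ) t = iteratedDeriv j ψ t := by
  induction j generalizing ψ with
  | zero => rw [iteratedDeriv_zero, Function.iterate_zero, id_eq]
  | succ j ih =>
    rw [Function.iterate_succ_apply, ih, iteratedDeriv_succ']
    rfl

theorem norm_moment_mulReal_le {b : ℝ → ℝ} (hb : b.HasTemperateGrowth) (K j : ℕ) (ψ : 𝓢(ℝ, ℂ))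
    (t : ℝ) : ‖moment K j (mulReal b ψ) t‖ ≤ ∑ i ∈ Finset.range (j + 1),
      (j.choose i) * (|t| ^ i * |iteratedDeriv i b t|) * ‖moment K (j - i) ψ t‖ := by
  have hleibniz : ‖iteratedDeriv j (mulReal b ψ) t‖ ≤ ∑ i ∈ Finset.range (j + 1),
      (j.choose i) * |iteratedDeriv i b t| * ‖iteratedDeriv (j - i) ψ t‖ := by
    have hfun : (mulReal b ψ : ℝ → ℂ) = fun t => b t • ψ t := funext (mulReal_apply hb ψ)
    simpa only [hfun, norm_iteratedFDeriv_eq_norm_iteratedDeriv, Real.norm_eq_abs] using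
      norm_iteratedFDeriv_smul_le (n := j) (N := ∞) hb.1 (ψ.smooth ⊤) t (by exact_mod_cast le_top)
  simp only [norm_moment_apply, iterate_schwartzDeriv_apply]
  refine (mul_le_mul_of_nonneg_left hleibniz (by positivity)).trans_eq ?_
  rw [Finset.mul_sum]
  refine Finset.sum_congr rfl fun i hi => ?_
  rw [← pow_mul_pow_sub |t| (Nat.lt_succ_iff.1 (Finset.mem_range.1 hi))]
  ring

theorem exists_norm_moment_mulReal_japanese_le {j K : ℕ} (hj : j ≤ K) :
    ∃ C : ℝ, 0 ≤ C ∧ ∀ ψ t, ‖moment K j (mulReal (japanese (-(3 * K))) ψ) t‖ ≤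
      C * ∑ i ∈ Finset.range (j + 1), ‖(schwartzDeriv^[j - i] ψ) t‖ := by
  choose B hB₀ hB using fun i => exists_abs_iteratedDeriv_japanese_le i (-(3 * K))
  refine ⟨∑ i ∈ Finset.range (j + 1), (j.choose i) * B i,
    Finset.sum_nonneg fun i _ => mul_nonneg (Nat.cast_nonneg _) (hB₀ i), fun ψ t => ?_⟩
  have hweight : (1 + t ^ 2) ^ K * |t| ^ j * japanese (-(3 * K)) t ≤ 1 := by
    have hprod : japanese (2 * K) t * japanese K t * japanese (-(3 * K)) t = 1 := by
      rw [← japanese_add, ← japanese_add, ← japanese_zero t]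
      congr 1
      ring
    rw [← japanese_two_mul, ← hprod]
    have hpow : |t| ^ j ≤ japanese K t :=
      (abs_pow_le_japanese j t).trans (japanese_mono (by exact_mod_cast hj) t)
    exact mul_le_mul_of_nonneg_right (mul_le_mul_of_nonneg_left hpow (japanese_pos _ t).le)
      (japanese_pos _ t).le
  refine (norm_moment_mulReal_le (hasTemperateGrowth_japanese _) K j ψ t).trans ?_
  rw [Finset.mul_sum]
  refine Finset.sum_le_sum fun i hi => ?_
  have hBi := hB₀ i
  calc (j.choose i) * (|t| ^ i * |iteratedDeriv i (japanese (-(3 * K))) t|) *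
        ‖moment K (j - i) ψ t‖
    _ ≤ (j.choose i) * (|t| ^ i * (B i * japanese (-(3 * K)) t)) * ‖moment K (j - i) ψ t‖ := by
      gcongr
      exact hB i t
    _ = ((j.choose i) * B i * ‖(schwartzDeriv^[j - i] ψ) t‖) *
        ((1 + t ^ 2) ^ K * |t| ^ j * japanese (-(3 * K)) t) := by
      rw [norm_moment_apply, ← pow_mul_pow_sub |t| (Nat.lt_succ_iff.1 (Finset.mem_range.1 hi))]
      ring
    _ ≤ (j.choose i) * B i * ‖(schwartzDeriv^[j - i] ψ) t‖ :=
      mul_le_of_le_one_right (by positivity) hweight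
    _ ≤ (∑ i ∈ Finset.range (j + 1), (j.choose i) * B i) * ‖(schwartzDeriv^[j - i] ψ) t‖ := by
      gcongr
      exact Finset.single_le_sum (f := fun i => (j.choose i : ℝ) * B i)
        (fun i _ => mul_nonneg (Nat.cast_nonneg _) (hB₀ i)) hi

theorem lpNorm_halfMeasure_le (ψ : 𝓢(ℝ, ℂ)) : lpNorm ψ 2 halfMeasure ≤ ‖toL2 ψ‖ := by
  have hmeas {μ : Measure ℝ} : AEStronglyMeasurable ψ μ := ψ.continuous.aestronglyMeasurable
  rw [norm_toL2_eq_lpNorm, ← toReal_eLpNorm hmeas, ← toReal_eLpNorm hmeas]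
  exact ENNReal.toReal_mono (ψ.memLp 2 volume).eLpNorm_ne_top
    (eLpNorm_mono_measure _ Measure.restrict_le_self)

theorem exists_conormal_mulReal_japanese_bessel_le (K : ℕ) : ∃ C : ℝ, 0 ≤ C ∧ ∀ ψ : 𝓢(ℝ, ℂ),
    conormal K (mulReal (japanese (-(3 * K))) (bessel (-K) ψ)) ≤ C * ‖toL2 ψ‖ := by
  have hterm (j : ℕ) (hj : j ∈ Finset.range (K + 1)) : ∃ C : ℝ, 0 ≤ C ∧ ∀ ψ : 𝓢(ℝ, ℂ),
      lpNorm (moment K j (mulReal (japanese (-(3 * K))) (bessel (-K) ψ))) 2 halfMeasure ≤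
        C * ‖toL2 ψ‖ := by
    have hjK : j ≤ K := Nat.lt_succ_iff.1 (Finset.mem_range.1 hj)
    obtain ⟨C, hC, h⟩ := exists_norm_moment_mulReal_japanese_le hjK
    refine ⟨C * ∑ i ∈ Finset.range (j + 1), (2 * Real.pi) ^ (j - i), by positivity, fun ψ => ?_⟩
    refine (lpNorm_le_mul_sum_of_ae_le (Finset.range (j + 1)) one_le_two hC
      (fun i _ => memLp_halfMeasure (schwartzDeriv^[j - i] (bessel (-K) ψ)))
      (.of_forall fun t => h _ t)).trans ?_
    rw [mul_assoc, Finset.sum_mul]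
    gcongr with i
    exact (lpNorm_halfMeasure_le _).trans
      (norm_toL2_iterate_schwartzDeriv_bessel_neg_le ((Nat.sub_le j i).trans hjK) ψ)
  choose! C hC₀ hC using hterm
  refine ⟨∑ j ∈ Finset.range (K + 1), C j, Finset.sum_nonneg hC₀, fun ψ => ?_⟩
  rw [Finset.sum_mul]
  exact Finset.sum_le_sum fun j hj => hC j hj ψ

/-! ### Density of test functions on the half-line -/

theorem tendsto_lpNorm_zero_of_dominated {α E : Type*} [MeasurableSpace α] [NormedAddCommGroup E]
    {μ : Measure α} {p : ENNReal} (hp₀ : p ≠ 0) (hp : p ≠ ⊤) {f : ℕ → α → E} {g : α → ℝ}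
    (hg : MemLp g p μ) (hf : ∀ n, AEStronglyMeasurable (f n) μ)
    (hle : ∀ n, ∀ᵐ x ∂μ, ‖f n x‖ ≤ g x)
    (hlim : ∀ᵐ x ∂μ, Filter.Tendsto (fun n => f n x) Filter.atTop (nhds 0)) :
    Filter.Tendsto (fun n => lpNorm (f n) p μ) Filter.atTop (nhds 0) := by
  have hpos : 0 < p.toReal := ENNReal.toReal_pos hp₀ hp
  have hlintegral : Filter.Tendsto (fun n => ∫⁻ x, ‖f n x‖ₑ ^ p.toReal ∂μ) Filter.atTop
      (nhds (∫⁻ _, 0 ∂μ)) := by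
    refine tendsto_lintegral_of_dominated_convergence' (fun x => ‖g x‖ₑ ^ p.toReal)
      (fun n => (hf n).enorm.pow_const _) (fun n => ?_)
      ((eLpNorm_lt_top_iff_lintegral_rpow_enorm_lt_top hp₀ hp).1 hg.2).ne ?_
    · filter_upwards [hle n] with x hx
      have : ‖f n x‖ₑ ≤ ‖g x‖ₑ := enorm_le_iff_norm_le.2 (hx.trans (Real.le_norm_self _))
      gcongr
    · filter_upwards [hlim] with x hx
      have := (ENNReal.continuous_rpow_const (y := p.toReal)).continuousAt.tendsto.comp hx.enorm
      simpa only [enorm_zero, ENNReal.zero_rpow_of_pos hpos, Function.comp_def] using this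
  have heLpNorm := (ENNReal.continuous_rpow_const (y := 1 / p.toReal)).continuousAt.tendsto.comp
    hlintegral
  rw [lintegral_zero, ENNReal.zero_rpow_of_pos (by positivity)] at heLpNorm
  refine ((ENNReal.tendsto_toReal ENNReal.zero_ne_top).comp heLpNorm).congr fun n => ?_
  rw [← toReal_eLpNorm (hf n), eLpNorm_eq_lintegral_rpow_enorm_toReal hp₀ hp]
  rfl

theorem cutoff_of_le {t : ℝ} (h : t ≤ 1) : cutoff t = 1 :=
  Real.smoothTransition.one_of_one_le (by linarith)

theorem cutoff_of_ge {t : ℝ} (h : 2 ≤ t) : cutoff t = 0 :=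
  Real.smoothTransition.zero_of_nonpos (by linarith)

theorem isNear_cutoff : IsNear cutoff :=
  ⟨contDiff_cutoff, Filter.eventually_atTop.2 ⟨2, fun _ => cutoff_of_ge⟩⟩

/-- Families of smooth functions on `ℝ₊` all of whose derivatives `(t∂_t)^i` are bounded,
uniformly in the index: the bounds do not change under dilations of `ℝ₊`. -/
structure ScaleBounded {ι : Type*} (m : ι → ℝ → ℝ) : Prop where
  contDiff : ∀ n, ContDiff ℝ ∞ (m n)
  exists_bound : ∀ i : ℕ, ∃ C : ℝ, ∀ n t, 0 < t → t ^ i * |iteratedDeriv i (m n) t| ≤ C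

theorem IsNear.iteratedDeriv {b : ℝ → ℝ} (hb : IsNear b) (i : ℕ) : IsNear (iteratedDeriv i b) := by
  induction i with
  | zero => rwa [iteratedDeriv_zero]
  | succ i ih =>
    rw [iteratedDeriv_succ]
    exact ih.deriv

theorem IsNear.scaleBounded {b : ℝ → ℝ} (hb : IsNear b) {ι : Type*} {a : ι → ℝ}
    (ha : ∀ n, 0 < a n) : ScaleBounded fun n t => b (a n * t) where
  contDiff n := hb.contDiff.comp (contDiff_const.mul contDiff_id)
  exists_bound i := by
    obtain ⟨C, -, h⟩ := ((hb.iteratedDeriv i).pow_mul i).exists_bound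
    refine ⟨C, fun n t ht => le_trans (le_of_eq ?_) (h (a n * t) (mul_pos (ha n) ht))⟩
    rw [iteratedDeriv_comp_const_mul (hb.contDiff.of_le (by exact_mod_cast le_top)),
      Real.norm_eq_abs, abs_mul, abs_mul, abs_pow, abs_pow, abs_mul, abs_of_pos ht,
      abs_of_pos (ha n)]
    ring

theorem ScaleBounded.one_sub {ι : Type*} {m : ι → ℝ → ℝ} (hm : ScaleBounded m) :
    ScaleBounded fun n t => 1 - m n t where
  contDiff n := contDiff_const.sub (hm.contDiff n)
  exists_bound i := by
    obtain ⟨C, h⟩ := hm.exists_bound i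
    rcases Nat.eq_zero_or_pos i with rfl | hi
    · simp only [pow_zero, iteratedDeriv_zero, one_mul] at h ⊢
      refine ⟨1 + C, fun n t ht => (abs_sub _ _).trans ?_⟩
      rw [abs_one]
      exact add_le_add_right (h n t ht) 1
    · refine ⟨C, fun n t ht => ?_⟩
      rw [iteratedDeriv_const_sub hi, iteratedDeriv_neg, abs_neg]
      exact h n t ht

theorem ScaleBounded.mul {ι : Type*} {m m' : ι → ℝ → ℝ} (hm : ScaleBounded m)
    (hm' : ScaleBounded m') : ScaleBounded fun n t => m n t * m' n t where
  contDiff n := (hm.contDiff n).mul (hm'.contDiff n)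
  exists_bound i := by
    choose C h using hm.exists_bound
    choose C' h' using hm'.exists_bound
    refine ⟨∑ l ∈ Finset.range (i + 1), (i.choose l) * C l * C' (i - l), fun n t ht => ?_⟩
    have hleibniz := norm_iteratedFDeriv_mul_le (n := i) (N := ∞) (hm.contDiff n) (hm'.contDiff n)
      t (by exact_mod_cast le_top)
    simp only [norm_iteratedFDeriv_eq_norm_iteratedDeriv, Real.norm_eq_abs] at hleibniz
    refine (mul_le_mul_of_nonneg_left hleibniz (by positivity)).trans ?_
    rw [Finset.mul_sum]
    refine Finset.sum_le_sum fun l hl => ?_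
    have hl₀ : 0 ≤ t ^ l * |iteratedDeriv l (m n) t| := by positivity
    calc t ^ i * ((i.choose l) * |iteratedDeriv l (m n) t| * |iteratedDeriv (i - l) (m' n) t|)
      _ = (i.choose l) * (t ^ l * |iteratedDeriv l (m n) t|) *
          (t ^ (i - l) * |iteratedDeriv (i - l) (m' n) t|) := by
        rw [← pow_mul_pow_sub t (Nat.lt_succ_iff.1 (Finset.mem_range.1 hl))]
        ring
      _ ≤ (i.choose l) * C l * C' (i - l) := by
        have hCl := hl₀.trans (h l n t ht)
        gcongr
        exacts [h l n t ht, h' (i - l) n t ht]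

/-- Cut-off functions exhausting `(0, ∞)`. -/
def exhaust (n : ℕ) (t : ℝ) : ℝ := (1 - cutoff ((n + 1 : ℝ) * t)) * cutoff ((n + 1 : ℝ)⁻¹ * t)

theorem scaleBounded_one_sub_exhaust : ScaleBounded fun n t => 1 - exhaust n t :=
  ((isNear_cutoff.scaleBounded (a := fun n : ℕ => (n + 1 : ℝ)) fun n => by positivity).one_sub.mul
    (isNear_cutoff.scaleBounded (a := fun n : ℕ => (n + 1 : ℝ)⁻¹) fun n => by positivity)).one_sub

theorem contDiff_exhaust (n : ℕ) : ContDiff ℝ ∞ (exhaust n) :=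
  (contDiff_const.sub (contDiff_cutoff.comp (contDiff_const.mul contDiff_id))).mul
    (contDiff_cutoff.comp (contDiff_const.mul contDiff_id))

theorem exhaust_eq_zero {n : ℕ} {t : ℝ} (h : t ∉ Set.Icc ((n + 1 : ℝ)⁻¹) (2 * (n + 1))) :
    exhaust n t = 0 := by
  have hn : (0 : ℝ) < n + 1 := by positivity
  rw [Set.mem_Icc, not_and_or, not_le, not_le] at h
  rw [exhaust]
  rcases h with h | h
  · rw [cutoff_of_le, sub_self, zero_mul]
    rw [← le_div_iff₀' hn, one_div]
    exact h.le
  · rw [cutoff_of_ge (t := (n + 1 : ℝ)⁻¹ * t), mul_zero]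
    rw [inv_mul_eq_div, le_div_iff₀ hn]
    exact h.le

theorem hasTemperateGrowth_one_sub_exhaust (n : ℕ) :
    (fun t => 1 - exhaust n t).HasTemperateGrowth :=
  (Function.HasTemperateGrowth.const 1).sub <|
    (HasCompactSupport.intro isCompact_Icc fun _ => exhaust_eq_zero).hasTemperateGrowth
      (contDiff_exhaust n)

theorem eventually_exhaust_eq_one {t : ℝ} (ht : 0 < t) :
    ∀ᶠ n : ℕ in Filter.atTop, ∀ᶠ r in nhds t, exhaust n r = 1 := by
  obtain ⟨N, hN⟩ := exists_nat_ge (max (4 / t) (2 * t))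
  filter_upwards [Filter.eventually_ge_atTop N] with n hn
  obtain ⟨hsmall, hlarge⟩ := max_le_iff.1 (hN.trans (Nat.cast_le.2 hn))
  rw [div_le_iff₀ ht] at hsmall
  filter_upwards [Ioo_mem_nhds (half_lt_self ht) (lt_two_mul_self ht)] with r hr
  rw [exhaust, cutoff_of_ge, cutoff_of_le, sub_zero, one_mul]
  · rw [inv_mul_eq_div, div_le_one (by positivity)]
    linarith [hr.2]
  · nlinarith only [hr.1, hsmall, ht]

theorem eventually_iteratedDeriv_one_sub_exhaust {t : ℝ} (ht : 0 < t) (i : ℕ) :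
    ∀ᶠ n : ℕ in Filter.atTop, iteratedDeriv i (fun t => 1 - exhaust n t) t = 0 := by
  filter_upwards [eventually_exhaust_eq_one ht] with n hn
  have hzero : (fun t => 1 - exhaust n t) =ᶠ[nhds t] fun _ => 0 := by
    filter_upwards [hn] with r hr
    rw [hr, sub_self]
  rw [hzero.iteratedDeriv_eq, iteratedDeriv_fun_const_zero]

theorem tendsto_lpNorm_moment_one_sub_exhaust (K j : ℕ) (ψ : 𝓢(ℝ, ℂ)) :
    Filter.Tendsto (fun n => lpNorm (moment K j (mulReal (fun t => 1 - exhaust n t) ψ)) 2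
      halfMeasure) Filter.atTop (nhds 0) := by
  have hle (n : ℕ) (t : ℝ) := norm_moment_mulReal_le (hasTemperateGrowth_one_sub_exhaust n) K j ψ t
  choose C hC using scaleBounded_one_sub_exhaust.exists_bound
  have hdominating : MemLp (fun t => ∑ i ∈ Finset.range (j + 1),
      ((j.choose i) * C i) * ‖moment K (j - i) ψ t‖) 2 halfMeasure :=
    memLp_finsetSum _ fun i _ => (memLp_halfMeasure (moment K (j - i) ψ)).norm.const_mul _
  refine tendsto_lpNorm_zero_of_dominated two_ne_zero ENNReal.ofNat_ne_top hdominating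
    (fun n => (memLp_halfMeasure _).1) (fun n => ae_halfMeasure fun t ht => ?_)
    (ae_halfMeasure fun t ht => ?_)
  · refine (hle n t).trans (Finset.sum_le_sum fun i _ => ?_)
    rw [abs_of_pos ht]
    have := hC i n t ht
    gcongr
  · have hderiv : ∀ᶠ n : ℕ in Filter.atTop, ∀ i ∈ Finset.range (j + 1),
        iteratedDeriv i (fun t => 1 - exhaust n t) t = 0 :=
      (Filter.eventually_all_finset _).2 fun i _ => eventually_iteratedDeriv_one_sub_exhaust ht i
    refine tendsto_const_nhds.congr' ?_
    filter_upwards [hderiv] with n hn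
    refine (norm_le_zero_iff.1 ((hle n t).trans_eq (Finset.sum_eq_zero fun i hi => ?_))).symm
    rw [hn i hi, abs_zero, mul_zero, mul_zero, zero_mul]

theorem tendsto_conormal_one_sub_exhaust (K : ℕ) (ψ : 𝓢(ℝ, ℂ)) :
    Filter.Tendsto (fun n => conormal K (mulReal (fun t => 1 - exhaust n t) ψ)) Filter.atTop
      (nhds 0) := by
  simpa only [Finset.sum_const_zero, conormal] using
    tendsto_finsetSum (Finset.range (K + 1)) fun j _ => tendsto_lpNorm_moment_one_sub_exhaust K j ψ

theorem toSchwartz_apply {Ω : TopologicalSpace.Opens ℝ} (φ : 𝓓(Ω, ℂ)) (t : ℝ) :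
    toSchwartz φ t = φ t := rfl

/-- The test function `exhaust n * ψ` on `(0, ∞)`. -/
def exhaustTest (n : ℕ) (ψ : 𝓢(ℝ, ℂ)) : Test :=
  mkTest (fun t => (exhaust n t : ℂ) * ψ t)
    ((Complex.ofRealCLM.contDiff.comp (contDiff_exhaust n)).mul (ψ.smooth ⊤)).contDiffOn
    ⟨Set.Icc ((n + 1 : ℝ)⁻¹) (2 * (n + 1)), isCompact_Icc,
      fun _ ht => (by positivity : (0 : ℝ) < (n + 1 : ℝ)⁻¹).trans_le ht.1,
      fun t ht => by rw [exhaust_eq_zero ht, Complex.ofReal_zero, zero_mul]⟩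

theorem mulReal_one_sub_exhaust (n : ℕ) (ψ : 𝓢(ℝ, ℂ)) :
    mulReal (fun t => 1 - exhaust n t) ψ = ψ - toSchwartz (exhaustTest n ψ) := by
  ext t
  rw [mulReal_apply (hasTemperateGrowth_one_sub_exhaust n), Complex.ofReal_sub, Complex.ofReal_one,
    one_sub_mul]
  rfl

theorem eq_zero_of_controlled {G : 𝓢(ℝ, ℂ) →ₗ[ℂ] ℂ} (hG : Controlled fun ψ => ‖G ψ‖)
    (h₀ : ∀ φ : Test, G (toSchwartz φ) = 0) : G = 0 := by
  obtain ⟨K, C, -, hC⟩ := hG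
  ext ψ
  have hle (n : ℕ) : ‖G ψ‖ ≤ C * conormal K (mulReal (fun t => 1 - exhaust n t) ψ) := by
    simpa only [mulReal_one_sub_exhaust, map_sub, h₀, sub_zero] using
      hC (mulReal (fun t => 1 - exhaust n t) ψ)
  have hlim := ge_of_tendsto' ((tendsto_conormal_one_sub_exhaust K ψ).const_mul C) hle
  rwa [mul_zero, norm_le_zero_iff] at hlim

theorem conormal_eq_zero {ψ : 𝓢(ℝ, ℂ)} (h : ∀ t, 0 < t → ψ t = 0) (K : ℕ) : conormal K ψ = 0 := by
  refine Finset.sum_eq_zero fun j _ => ?_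
  have hzero : moment K j ψ =ᵐ[halfMeasure] 0 := ae_halfMeasure fun t ht => by
    have heq : ψ =ᶠ[nhds t] fun _ => 0 := by
      filter_upwards [lt_mem_nhds ht] with r hr using h r hr
    rw [moment_apply, iterate_schwartzDeriv_apply, heq.iteratedDeriv_eq,
      iteratedDeriv_fun_const_zero, mul_zero, Pi.zero_apply]
  rw [← toReal_eLpNorm (memLp_halfMeasure _).1, eLpNorm_congr_ae hzero, eLpNorm_zero,
    ENNReal.toReal_zero]

/-! ### The bilinear pairing on `L²` -/

section Pairing

variable {α : Type*} [MeasurableSpace α] {μ : Measure α}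

/-- The bilinear pairing `∫ f g` on `L²`. Unlike the inner product it is complex linear in both
arguments, as is the action of distributions on test functions. -/
def pair : Lp ℂ 2 μ →L[ℂ] Lp ℂ 2 μ →L[ℂ] ℂ := (ContinuousLinearMap.mul ℂ ℂ).lpPairing μ 2 2

theorem pair_apply (f g : Lp ℂ 2 μ) : pair f g = ∫ x, f x * g x ∂μ :=
  (ContinuousLinearMap.mul ℂ ℂ).lpPairing_eq_integral f g

theorem inner_star_left (f g : Lp ℂ 2 μ) : inner ℂ (star f) g = pair f g := by
  rw [pair_apply, L2.inner_def]
  refine integral_congr_ae ?_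
  filter_upwards [Lp.coeFn_star f] with x hx
  rw [hx, Pi.star_apply, RCLike.inner_apply, starRingEnd_apply, star_star, mul_comm]

theorem norm_star_Lp (f : Lp ℂ 2 μ) : ‖star f‖ = ‖f‖ := by
  rw [Lp.norm_def, Lp.norm_def, eLpNorm_congr_ae (Lp.coeFn_star f), eLpNorm_star]

theorem norm_pair_apply_le (f g : Lp ℂ 2 μ) : ‖pair f g‖ ≤ ‖f‖ * ‖g‖ := by
  rw [← inner_star_left, ← norm_star_Lp f]
  exact norm_inner_le_norm _ _

theorem norm_integral_mul_le_lpNorm_mul_lpNorm {f g : α → ℂ} (hf : MemLp f 2 μ)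
    (hg : MemLp g 2 μ) : ‖∫ x, f x * g x ∂μ‖ ≤ lpNorm f 2 μ * lpNorm g 2 μ := by
  have hpair : ∫ x, f x * g x ∂μ = pair (hf.toLp f) (hg.toLp g) := by
    rw [pair_apply]
    refine integral_congr_ae ?_
    filter_upwards [hf.coeFn_toLp, hg.coeFn_toLp] with x hfx hgx
    rw [hfx, hgx]
  rw [hpair, ← toReal_eLpNorm hf.1, ← toReal_eLpNorm hg.1, ← Lp.norm_toLp f hf, ← Lp.norm_toLp g hg]
  exact norm_pair_apply_le _ _

theorem eq_of_pair_eq {f g : Lp ℂ 2 μ} (h : ∀ k, pair f k = pair g k) : f = g :=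
  star_injective <| ext_inner_right ℂ fun k => by rw [inner_star_left, inner_star_left, h]

theorem pair_star_toDual_symm (ℓ : Lp ℂ 2 μ →L[ℂ] ℂ) (g : Lp ℂ 2 μ) :
    pair (star ((InnerProductSpace.toDual ℂ _).symm ℓ)) g = ℓ g := by
  rw [← inner_star_left, star_star, InnerProductSpace.toDual_symm_apply]

/-- The Riesz representation of the functionals on `L²` with respect to the bilinear pairing. -/
def pairRiesz : (Lp ℂ 2 μ →L[ℂ] ℂ) →ₗᵢ[ℂ] Lp ℂ 2 μ where
  toFun ℓ := star ((InnerProductSpace.toDual ℂ _).symm ℓ)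
  map_add' ℓ ℓ' := eq_of_pair_eq fun k => by
    rw [map_add pair, _root_.add_apply, pair_star_toDual_symm, pair_star_toDual_symm,
      pair_star_toDual_symm, _root_.add_apply]
  map_smul' c ℓ := eq_of_pair_eq fun k => by
    rw [RingHom.id_apply, map_smul pair, _root_.smul_apply, pair_star_toDual_symm,
      pair_star_toDual_symm, _root_.smul_apply]
  norm_map' ℓ := by
    change ‖star _‖ = _
    rw [norm_star_Lp, LinearIsometryEquiv.norm_map]

theorem pair_pairRiesz (ℓ : Lp ℂ 2 μ →L[ℂ] ℂ) (g : Lp ℂ 2 μ) : pair (pairRiesz ℓ) g = ℓ g :=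
  pair_star_toDual_symm ℓ g

end Pairing

theorem pair_toL2 (f : L2) (ψ : 𝓢(ℝ, ℂ)) : pair f (toL2 ψ) = ∫ t, f t * ψ t := by
  rw [pair_apply]
  refine integral_congr_ae ?_
  filter_upwards [ψ.coeFn_toLp 2 volume] with t ht
  rw [SchwartzMap.toLpCLM_apply, ht]

theorem pair_toL2_toL2 (φ ψ : 𝓢(ℝ, ℂ)) : pair (toL2 φ) (toL2 ψ) = ∫ t, φ t * ψ t := by
  rw [pair_toL2]
  refine integral_congr_ae ?_
  filter_upwards [φ.coeFn_toLp 2 volume] with t ht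
  rw [SchwartzMap.toLpCLM_apply, ht]

theorem sobolev_apply (s δ : ℝ) (f : L2) (ψ : 𝓢(ℝ, ℂ)) :
    sobolev s δ f ψ = pair f (toL2 (bessel (-s) (mulReal (japanese (-δ)) ψ))) := by
  rw [pair_toL2]
  simp only [sobolev, ContinuousLinearMap.comp_apply, TemperedDistribution.smulLeftCLM_apply_apply,
    TemperedDistribution.besselPotential, TemperedDistribution.fourierMultiplierCLM_apply_apply,
    Lp.toTemperedDistributionCLM_apply, Lp.toTemperedDistribution_apply, smul_eq_mul]
  have hbessel (g : 𝓢(ℝ, ℂ)) : bessel (-s) g =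
      𝓕 (SchwartzMap.smulLeftCLM ℂ (besselSymbol (-s)) (𝓕⁻ g)) :=
    (fourier_smulLeftCLM_fourierInv (by fun_prop) (fun x => by simp [besselSymbol]) g).symm
  rw [hbessel]
  simp_rw [mul_comm (f _)]
  rfl

theorem mulReal_japanese_neg_zero (ψ : 𝓢(ℝ, ℂ)) : mulReal (japanese (-0)) ψ = ψ := by
  ext t
  rw [mulReal_apply (hasTemperateGrowth_japanese _), neg_zero, japanese_zero, Complex.ofReal_one,
    one_mul]

theorem sobolev_zero_apply (s : ℝ) (f : L2) (ψ : 𝓢(ℝ, ℂ)) :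
    sobolev s 0 f ψ = pair f (toL2 (bessel (-s) ψ)) := by
  rw [sobolev_apply, mulReal_japanese_neg_zero]

theorem sobolev_toL2 (s δ : ℝ) (φ ψ : 𝓢(ℝ, ℂ)) :
    sobolev s δ (toL2 φ) ψ = ∫ t, mulReal (japanese (-δ)) (bessel (-s) φ) t * ψ t := by
  rw [sobolev_apply, pair_toL2_toL2, ← integral_bessel_mul_comm]
  congr 1
  ext t
  rw [mulReal_apply (hasTemperateGrowth_japanese _), mulReal_apply (hasTemperateGrowth_japanese _)]
  ring

theorem sobolev_toL2_bessel (s : ℝ) (φ ψ : 𝓢(ℝ, ℂ)) :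
    sobolev s 0 (toL2 (bessel s φ)) ψ = ∫ t, φ t * ψ t := by
  rw [sobolev_zero_apply, pair_toL2_toL2, integral_bessel_mul_comm, bessel_bessel, add_neg_cancel,
    bessel_zero]

theorem continuous_sobolev_apply (s δ : ℝ) (ψ : 𝓢(ℝ, ℂ)) :
    Continuous fun f : L2 => sobolev s δ f ψ := by
  simp_rw [sobolev_apply]
  fun_prop

theorem denseRange_toL2 : DenseRange (toL2 : 𝓢(ℝ, ℂ) →L[ℂ] L2) :=
  SchwartzMap.denseRange_toLpCLM (by norm_num)

theorem exists_clm_toL2_eq {G : Type*} [NormedAddCommGroup G] [NormedSpace ℂ G] [CompleteSpace G]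
    {B : 𝓢(ℝ, ℂ) →ₗ[ℂ] G} {C : ℝ} (hC : 0 ≤ C) (hB : ∀ ψ, ‖B ψ‖ ≤ C * ‖toL2 ψ‖) :
    ∃ A : L2 →L[ℂ] G, ‖A‖ ≤ C ∧ ∀ ψ, A (toL2 ψ) = B ψ :=
  have hd : DenseRange (toL2 : 𝓢(ℝ, ℂ) →L[ℂ] L2).toLinearMap := denseRange_toL2
  ⟨B.extendOfNorm toL2.toLinearMap, LinearMap.opNorm_extendOfNorm_le hd hC hB,
    LinearMap.extendOfNorm_eq hd ⟨C, hB⟩⟩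

/-! ### Dilations and the half-line Sobolev spaces -/

theorem Controlled.comp_dilSchwartz {p : 𝓢(ℝ, ℂ) → ℝ} (hp : Controlled p) {r : ℝ} (hr : 0 < r) :
    Controlled fun ψ => p (dilSchwartz r hr ψ) := by
  obtain ⟨K, C, hC, h⟩ := hp
  refine ⟨K, C * max 1 (r⁻¹ ^ 2) ^ K, by positivity, fun ψ => (h _).trans ?_⟩
  rw [mul_assoc]
  exact mul_le_mul_of_nonneg_left (conormal_dilSchwartz_le_mul hr K ψ) hC

theorem Controlled.exists_uniform_extension {G : Type*} [NormedAddCommGroup G] [NormedSpace ℂ G]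
    [CompleteSpace G] {B : 𝓢(ℝ, ℂ) →ₗ[ℂ] G} (hB : Controlled fun ψ => ‖B ψ‖) :
    ∃ (K : ℕ) (C : ℝ), 0 ≤ C ∧ ∀ (r : ℝ) (hr : 1 ≤ r), ∃ A : L2 →L[ℂ] G, ‖A‖ ≤ C ∧
      ∀ ψ, A (toL2 ψ) = B (dilSchwartz r (zero_lt_one.trans_le hr)
        (mulReal (japanese (-(3 * K))) (bessel (-K) ψ))) := by
  obtain ⟨K, C₀, hC₀, hB⟩ := hB
  obtain ⟨C₁, hC₁, hweight⟩ := exists_conormal_mulReal_japanese_bessel_le K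
  refine ⟨K, C₀ * C₁, by positivity, fun r hr => ?_⟩
  refine exists_clm_toL2_eq (B := B ∘ₗ (dilSchwartz r (zero_lt_one.trans_le hr)).toLinearMap ∘ₗ
    (mulReal (japanese (-(3 * K)))).toLinearMap ∘ₗ (bessel (-K)).toLinearMap) (by positivity)
    fun ψ => (hB _).trans ?_
  rw [mul_assoc]
  gcongr
  exact (conormal_dilSchwartz_le hr K _).trans (hweight ψ)

theorem integral_mul_dilSchwartz_inv {r : ℝ} (hr : 0 < r) (φ ψ : 𝓢(ℝ, ℂ)) :
    ∫ t, φ t * dilSchwartz r⁻¹ (inv_pos.2 hr) ψ t = ∫ t, dilSchwartz r hr φ t * ψ t := by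
  have hfactor : r * r⁻¹ ^ (1 / 2 : ℝ) = r ^ (1 / 2 : ℝ) := by
    rw [Real.inv_rpow hr.le, ← Real.rpow_neg hr.le]
    nth_rw 1 [← Real.rpow_one r]
    rw [← Real.rpow_add hr]
    norm_num
  have hsubst := Measure.integral_comp_mul_left
    (fun t => φ t * dilSchwartz r⁻¹ (inv_pos.2 hr) ψ t) r
  rw [abs_of_pos (inv_pos.2 hr), eq_inv_smul_iff₀ hr.ne', ← integral_smul] at hsubst
  rw [← hsubst]
  congr 1
  ext t
  rw [dilSchwartz_apply, dilSchwartz_apply, ← hfactor, inv_mul_cancel_left₀ hr.ne',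
    Complex.real_smul]
  push_cast
  ring

theorem toSchwartz_dilTest {r : ℝ} (hr : 0 < r) (φ : Test) :
    toSchwartz (dilTest r hr φ) = dilSchwartz r hr (toSchwartz φ) := rfl

theorem dilTest_apply {r : ℝ} (hr : 0 < r) (φ : Test) (t : ℝ) :
    dilTest r hr φ t = ((r ^ (1 / 2 : ℝ) : ℝ) : ℂ) * φ (r * t) := rfl

theorem dilSchwartz_dilSchwartz {a b c : ℝ} (ha : 0 < a) (hb : 0 < b) (hc : 0 < c) (h : a * b = c)
    (ψ : 𝓢(ℝ, ℂ)) : dilSchwartz a ha (dilSchwartz b hb ψ) = dilSchwartz c hc ψ := by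
  subst h
  ext t
  rw [dilSchwartz_apply, dilSchwartz_apply, dilSchwartz_apply, Real.mul_rpow ha.le hb.le,
    mul_left_comm b a t, ← mul_assoc a b t]
  push_cast
  ring

theorem dilTest_dilTest {a b c : ℝ} (ha : 0 < a) (hb : 0 < b) (hc : 0 < c) (h : a * b = c)
    (φ : Test) : dilTest a ha (dilTest b hb φ) = dilTest c hc φ :=
  DFunLike.ext _ _ fun t => DFunLike.congr_fun (dilSchwartz_dilSchwartz ha hb hc h (toSchwartz φ)) t

theorem dilSchwartz_one (h : (0 : ℝ) < 1) (ψ : 𝓢(ℝ, ℂ)) : dilSchwartz 1 h ψ = ψ := by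
  ext t
  rw [dilSchwartz_apply, Real.one_rpow, Complex.ofReal_one, one_mul, one_mul]

theorem dilTest_one_inv (h : (0 : ℝ) < 1⁻¹) (φ : Test) : dilTest 1⁻¹ h φ = φ := by
  ext t
  rw [dilTest_apply, inv_one, Real.one_rpow, Complex.ofReal_one, one_mul, one_mul]

/-- The extension of elements of `H^{s,δ}(ℝ₊)` to `ℝ` of minimal norm. -/
def hPlusLift (s δ : ℝ) : HPlus s δ →L[ℂ] L2 :=
  have : CompleteSpace (hNull s δ) := (isClosed_hNull s δ).completeSpace_coe
  (hNull s δ)ᗮ.subtypeL ∘L ((hNull s δ).quotientEquivOrthogonal.toContinuousLinearEquiv :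
    (L2 ⧸ hNull s δ) →L[ℂ] (hNull s δ)ᗮ)

theorem norm_hPlusLift_le (s δ : ℝ) (v : HPlus s δ) : ‖hPlusLift s δ v‖ ≤ ‖v‖ :=
  have : CompleteSpace (hNull s δ) := (isClosed_hNull s δ).completeSpace_coe
  ((hNull s δ).quotientEquivOrthogonal.norm_map v).le

theorem hPlusDist_eq_sobolev_hPlusLift (s δ : ℝ) (v : HPlus s δ) (φ : Test) :
    hPlusDist s δ v φ = sobolev s δ (hPlusLift s δ v) (toSchwartz φ) := by
  have : CompleteSpace (hNull s δ) := (isClosed_hNull s δ).completeSpace_coe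
  let e := (hNull s δ).quotientEquivOrthogonal
  have hv : v = (hNull s δ).mkQ (hPlusLift s δ v) :=
    (e.symm_apply_apply v).symm.trans
      ((hNull s δ).quotientEquivOrthogonal_symm_eq_mk (e v : L2) (e v).2)
  conv_lhs => rw [hv]
  rfl

/-! ### From Sobolev spaces to cone Sobolev spaces -/

/-- The compatibility with dilations of a map of target spaces that is needed to pass from strongly
to weakly parameter-dependent symbols: `κ_{r'}⁻¹ J κ_r` is uniformly bounded for `0 < r' ≤ r`, or
for `0 < r' = r` in case of boldface twisting. -/
structure IsTargetTwist {E F : Type*} [NormedAddCommGroup E] [NormedSpace ℂ E] [KappaSpace E]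
    [NormedAddCommGroup F] [NormedSpace ℂ F] [KappaSpace F] (k : Twist) (J : E →L[ℂ] F) :
    Prop where
  dil : ∀ r u v, KappaSpace.dil r u v → KappaSpace.dil r (J u) (J v)
  twist : ∃ C : ℝ, 0 ≤ C ∧ ∀ r' r : ℝ, 0 < r' → r' ≤ r → (k = .bold → r' = r) →
    TwistedNormLE r r' J C

/-- The compatibility with dilations of a map of source spaces that is needed to pass from strongly
to weakly parameter-dependent symbols: `κ_r⁻¹ I κ_{r'}` is uniformly bounded for `0 < r' ≤ r`, or
for `0 < r' = r` in case of boldface twisting. -/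
structure IsSourceTwist {E F : Type*} [NormedAddCommGroup E] [NormedSpace ℂ E] [KappaSpace E]
    [NormedAddCommGroup F] [NormedSpace ℂ F] [KappaSpace F] (k : Twist) (I : E →L[ℂ] F) :
    Prop where
  dil : ∀ r u v, KappaSpace.dil r u v → KappaSpace.dil r (I u) (I v)
  twist : ∃ C : ℝ, 0 ≤ C ∧ ∀ r' r : ℝ, 0 < r' → r' ≤ r → (k = .bold → r' = r) →
    TwistedNormLE r' r I C

/-- The weight `ω(a t) ⟨t⟩^δ` localized to bounded `t`. -/
def nearWeight (a δ t : ℝ) : ℝ := cutoff (a * t) * japanese δ t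

/-- The weight `(1 - ω(a t)) ⟨t⟩^δ` localized away from `t ≤ 0`. -/
def farWeight (a δ t : ℝ) : ℝ := (1 - cutoff (a * t)) * japanese δ t

theorem isNear_nearWeight {a : ℝ} (ha : 0 < a) (δ : ℝ) : IsNear (nearWeight a δ) where
  contDiff := (contDiff_cutoff.comp (contDiff_const.mul contDiff_id)).mul (contDiff_japanese δ)
  eventually_eq_zero := by
    filter_upwards [Filter.eventually_ge_atTop (2 / a)] with t ht
    rw [nearWeight, cutoff_of_ge ((div_le_iff₀' ha).1 ht), zero_mul]

theorem hasCompactSupport_fderiv_cutoff : HasCompactSupport (fderiv ℝ cutoff) := by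
  refine HasCompactSupport.intro (isCompact_Icc (a := 1) (b := 2)) fun t ht => ?_
  rw [Set.mem_Icc, not_and_or, not_le, not_le] at ht
  rcases ht with ht | ht
  · have hone : cutoff =ᶠ[nhds t] fun _ => 1 := by
      filter_upwards [gt_mem_nhds ht] with r hr using cutoff_of_le hr.le
    rw [hone.fderiv_eq, fderiv_const_apply]
  · have hzero : cutoff =ᶠ[nhds t] fun _ => 0 := by
      filter_upwards [lt_mem_nhds ht] with r hr using cutoff_of_ge hr.le
    rw [hzero.fderiv_eq, fderiv_const_apply]

theorem hasTemperateGrowth_cutoff : cutoff.HasTemperateGrowth := by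
  refine .of_fderiv (hasCompactSupport_fderiv_cutoff.hasTemperateGrowth
    (contDiff_cutoff.fderiv_right (by simp))) (contDiff_cutoff.differentiable (by simp))
    (k := 0) (C := 1) fun t => ?_
  rw [pow_zero, mul_one, cutoff, Real.norm_of_nonneg (Real.smoothTransition.nonneg _)]
  exact Real.smoothTransition.le_one _

theorem isFar_farWeight {a : ℝ} (ha : 0 < a) (δ : ℝ) : IsFar (farWeight a δ) where
  hasTemperateGrowth := ((Function.HasTemperateGrowth.const 1).sub
    (hasTemperateGrowth_cutoff.comp ((Function.HasTemperateGrowth.const a).mul .id))).mul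
    (hasTemperateGrowth_japanese δ)
  exists_eq_zero := ⟨1 / a, by positivity, fun t ht => by
    rw [farWeight, cutoff_of_le ((le_div_iff₀' ha).1 ht), sub_self, zero_mul]⟩

/-- The Bessel potentials of the part of a function near `0`, in the variable `-ln t`, and of the
part away from `0`: the two components of cone Sobolev norms. -/
def besselSplit (s δ : ℝ) {a : ℝ} (ha : 0 < a) (b : ℝ) : 𝓢(ℝ, ℂ) →ₗ[ℂ] L2 × L2 :=
  (toL2.toLinearMap ∘ₗ (bessel s).toLinearMap ∘ₗ near _ (isNear_nearWeight ha δ)).prod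
    (toL2.toLinearMap ∘ₗ (bessel s).toLinearMap ∘ₗ (mulReal (farWeight b δ)).toLinearMap)

theorem besselSplit_apply (s δ : ℝ) {a : ℝ} (ha : 0 < a) (b : ℝ) (ψ : 𝓢(ℝ, ℂ)) :
    besselSplit s δ ha b ψ = (toL2 (bessel s (near _ (isNear_nearWeight ha δ) ψ)),
      toL2 (bessel s (mulReal (farWeight b δ) ψ))) := rfl

theorem controlled_besselSplit (s δ : ℝ) {a b : ℝ} (ha : 0 < a) (hb : 0 < b) :
    Controlled fun ψ => ‖besselSplit s δ ha b ψ‖ :=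
  ((controlled_bessel_near s (isNear_nearWeight ha δ)).add
    (controlled_bessel_far s (isFar_farWeight hb δ))).mono fun _ =>
      max_le_add_of_nonneg (norm_nonneg _) (norm_nonneg _)

theorem integral_near_mul {b : ℝ → ℝ} (hb : IsNear b) (ψ : 𝓢(ℝ, ℂ)) (g : ℝ → ℂ) :
    ∫ r, near b hb ψ r * g r =
      ∫ t in Set.Ioi 0, ψ t * (((b t * t ^ (-(1 / 2 : ℝ)) : ℝ) : ℂ) * g (-Real.log t)) := by
  have hsubst := integral_image_eq_integral_abs_deriv_smul (s := Set.univ) MeasurableSet.univ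
    (fun r _ => (hasDerivAt_exp_neg r).hasDerivWithinAt)
    (Real.exp_injective.comp neg_injective).injOn
    (fun t => ψ t * (((b t * t ^ (-(1 / 2 : ℝ)) : ℝ) : ℂ) * g (-Real.log t)))
  rw [image_exp_neg_univ, Measure.restrict_univ] at hsubst
  rw [hsubst]
  congr 1
  ext r
  have hexp : Real.exp (-r / 2) = Real.exp (-r) * Real.exp (-r * -(1 / 2)) := by
    rw [← Real.exp_add]
    congr 1
    ring
  rw [near_apply, abs_neg, abs_of_pos (Real.exp_pos _), Real.log_exp, neg_neg, Complex.real_smul,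
    ← Real.exp_mul, hexp]
  push_cast
  ring

theorem thetaTest_apply_of_pos (φ : TestR) {t : ℝ} (ht : 0 < t) :
    thetaTest φ t = ((t⁻¹ : ℝ) : ℂ) * φ (-Real.log t) :=
  if_pos ht

theorem mulTest_apply {m : ℝ → ℝ} (hm : ContDiffOn ℝ ∞ m (Set.Ioi 0)) (φ : Test) (t : ℝ) :
    mulTest m hm φ t = (m t : ℂ) * φ t := rfl

theorem test_eq_zero_of_notMem_Ioi (φ : Test) {t : ℝ} (ht : t ∉ Set.Ioi 0) : φ t = 0 :=
  test_zero φ fun h => ht (φ.tsupport_subset h)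

theorem sobolev_besselSplit_fst (s δ : ℝ) (ψ : 𝓢(ℝ, ℂ)) (φ : TestR) :
    sobolev s 0 (besselSplit s δ one_pos 1 ψ).1 (toSchwartz φ) =
      ∫ t, ψ t * toSchwartz (mulTest _ (contDiffOn_near 0 δ) (thetaTest φ)) t := by
  rw [besselSplit_apply, sobolev_toL2_bessel, integral_near_mul,
    ← setIntegral_eq_integral_of_forall_compl_eq_zero (s := Set.Ioi 0)
      (f := fun t => ψ t * toSchwartz (mulTest _ _ _) t) fun t ht => by
      rw [toSchwartz_apply, test_eq_zero_of_notMem_Ioi _ ht, mul_zero]]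
  refine setIntegral_congr_fun measurableSet_Ioi fun t ht => ?_
  have hpow : t ^ (-(1 / 2 : ℝ)) = t ^ (1 / 2 - 0 : ℝ) * t⁻¹ := by
    rw [← Real.rpow_neg_one, ← Real.rpow_add ht]
    norm_num
  simp only [toSchwartz_apply, mulTest_apply, thetaTest_apply_of_pos φ ht, hpow, nearWeight,
    one_mul]
  push_cast
  ring

theorem sobolev_besselSplit_snd (s δ : ℝ) (ψ : 𝓢(ℝ, ℂ)) (φ : Test) :
    sobolev s 0 (besselSplit s δ one_pos 1 ψ).2 (toSchwartz φ) =
      ∫ t, ψ t * toSchwartz (mulTest _ (contDiffOn_far δ) φ) t := by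
  rw [besselSplit_apply, sobolev_toL2_bessel]
  congr 1
  ext t
  rw [mulReal_apply (isFar_farWeight one_pos δ).hasTemperateGrowth, toSchwartz_apply,
    toSchwartz_apply, mulTest_apply, farWeight, one_mul]
  ring

theorem exists_clm_coneDist_eq {E : Type*} [NormedAddCommGroup E] [NormedSpace ℂ E] {s γ δ : ℝ}
    (A : E →L[ℂ] L2 × L2) (W : E →ₗ[ℂ] Dist)
    (hnear : ∀ f (φ : TestR), sobolev s 0 (A f).1 (toSchwartz φ) =
      W f (mulTest _ (contDiffOn_near γ δ) (thetaTest φ)))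
    (hfar : ∀ f (φ : Test), sobolev s 0 (A f).2 (toSchwartz φ) =
      W f (mulTest _ (contDiffOn_far δ) φ)) :
    ∃ T : E →L[ℂ] Cone s γ δ, ‖T‖ ≤ 2 * ‖A‖ ∧ ∀ f φ, coneDist s γ δ (T f) φ = W f φ := by
  let components : E →ₗ[ℂ] WithLp 1 (L2 × HPlus s 0) :=
    (WithLp.linearEquiv 1 ℂ (L2 × HPlus s 0)).symm.toLinearMap ∘ₗ
      (LinearMap.id.prodMap (hNull s 0).mkQ) ∘ₗ A.toLinearMap
  let T : E →ₗ[ℂ] Cone s γ δ :=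
    (W.prod components).codRestrict (coneSpace s γ δ) fun f => ⟨hnear f, hfar f⟩
  have hT (f : E) : ‖T f‖ ≤ 2 * ‖A‖ * ‖f‖ := by
    have hnorm : ‖T f‖ = ‖(A f).1‖ + ‖(hNull s 0).mkQ (A f).2‖ :=
      WithLp.prod_norm_eq_of_L1 (WithLp.toLp 1 ((A f).1, (hNull s 0).mkQ (A f).2))
    rw [hnorm, mul_assoc, two_mul]
    exact add_le_add ((norm_fst_le _).trans (A.le_opNorm f))
      ((Submodule.Quotient.norm_mk_le _ _).trans ((norm_snd_le _).trans (A.le_opNorm f)))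
  exact ⟨T.mkContinuous _ hT, T.mkContinuous_norm_le (by positivity) hT, fun _ _ => rfl⟩

theorem exists_coneMap (s δ : ℝ) : ∃ (K : ℕ) (C : ℝ), 0 ≤ C ∧ ∀ (r : ℝ) (hr : 1 ≤ r),
    ∃ T : L2 →L[ℂ] Cone s 0 δ, ‖T‖ ≤ C ∧ ∀ f φ, coneDist s 0 δ (T f) φ = sobolev K (3 * K) f
      (toSchwartz (dilTest r⁻¹ (inv_pos.2 (zero_lt_one.trans_le hr)) φ)) := by
  obtain ⟨K, C, hC, hA⟩ := (controlled_besselSplit s δ one_pos one_pos).exists_uniform_extension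
  refine ⟨K, 2 * C, by positivity, fun r hr => ?_⟩
  obtain ⟨A, hAC, hA⟩ := hA r hr
  have hr₀ := zero_lt_one.trans_le hr
  have hsobolev (ψ : 𝓢(ℝ, ℂ)) (φ : Test) :
      sobolev K (3 * K) (toL2 ψ) (toSchwartz (dilTest r⁻¹ (inv_pos.2 hr₀) φ)) =
        ∫ t, dilSchwartz r hr₀ (mulReal (japanese (-(3 * K))) (bessel (-K) ψ)) t *
          toSchwartz φ t := by
    rw [toSchwartz_dilTest, sobolev_toL2, integral_mul_dilSchwartz_inv]
  let W : L2 →ₗ[ℂ] Dist := (dilTest r⁻¹ (inv_pos.2 hr₀)).lcomp ℂ ℂ ∘ₗ restrict ∘ₗ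
    (sobolev K (3 * K)).toLinearMap
  obtain ⟨T, hT, hTW⟩ := exists_clm_coneDist_eq (s := s) (γ := 0) (δ := δ) A W
    (fun f φ => congrFun (denseRange_toL2.equalizer
      ((continuous_sobolev_apply s 0 _).comp (continuous_fst.comp A.continuous))
      (continuous_sobolev_apply K (3 * K) _) <| funext fun ψ => by
        simp only [Function.comp_apply, hA, sobolev_besselSplit_fst, hsobolev]) f)
    (fun f φ => congrFun (denseRange_toL2.equalizer
      ((continuous_sobolev_apply s 0 _).comp (continuous_snd.comp A.continuous))
      (continuous_sobolev_apply K (3 * K) _) <| funext fun ψ => by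
        simp only [Function.comp_apply, hA, sobolev_besselSplit_snd, hsobolev]) f)
  exact ⟨T, hT.trans (by gcongr), hTW⟩

theorem exists_targetEmbedding (s δ : ℝ) : ∃ (k ε : ℝ) (J : HPlus k ε →L[ℂ] Cone s 0 δ),
    IsTargetTwist .plain J ∧ ∀ w, TargetSpace.toDist (J w) = TargetSpace.toDist w := by
  obtain ⟨K, C, hC, h⟩ := exists_coneMap s δ
  choose T hT hTdist using h
  have hdist (w : HPlus K (3 * K)) (φ : Test) :
      coneDist s 0 δ (T 1 le_rfl (hPlusLift K (3 * K) w)) φ = hPlusDist K (3 * K) w φ := by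
    rw [hTdist, dilTest_one_inv, hPlusDist_eq_sobolev_hPlusLift]
  refine ⟨K, 3 * K, T 1 le_rfl ∘L hPlusLift K (3 * K), ⟨?_, C, hC, ?_⟩,
    fun w => LinearMap.ext fun φ => hdist w φ⟩
  · rintro r u v ⟨hr, huv⟩
    exact ⟨hr, fun φ => (hdist v φ).trans ((huv φ).trans (hdist u _).symm)⟩
  · rintro r' r hr' hle - w z ⟨hr, hwz⟩
    refine ⟨T (r / r') ((one_le_div hr').2 hle) (hPlusLift K (3 * K) w),
      ⟨hr', fun φ => (hdist z φ).trans ?_⟩, ?_⟩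
    · rw [hwz φ, hTdist, ← hPlusDist_eq_sobolev_hPlusLift,
        dilTest_dilTest _ _ (inv_pos.2 hr) (by field_simp)]
    · exact ((T _ _).le_of_opNorm_le (hT _ _) _).trans
        (mul_le_mul_of_nonneg_left (norm_hPlusLift_le _ _ w) hC)

/-! ### From cone Sobolev spaces to Sobolev spaces -/

theorem eq_of_controlled {G G' : 𝓢(ℝ, ℂ) →ₗ[ℂ] ℂ} (hG : Controlled fun ψ => ‖G ψ‖)
    (hG' : Controlled fun ψ => ‖G' ψ‖) (h : ∀ φ : Test, G (toSchwartz φ) = G' (toSchwartz φ)) :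
    G = G' :=
  sub_eq_zero.1 (eq_zero_of_controlled ((hG.add hG').mono fun _ => norm_sub_le _ _)
    fun φ => by rw [LinearMap.sub_apply, h, sub_self])

theorem Controlled.map_dilSchwartz_eq_zero {G : 𝓢(ℝ, ℂ) →ₗ[ℂ] ℂ}
    (hG : Controlled fun ψ => ‖G ψ‖) {r : ℝ} (hr : 0 < r) {ψ : 𝓢(ℝ, ℂ)}
    (hψ : tsupport ψ ⊆ Set.Iio 0) : G (dilSchwartz r hr ψ) = 0 := by
  obtain ⟨K, C, -, hle⟩ := hG.comp_dilSchwartz hr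
  have hpos (t : ℝ) (ht : 0 < t) : ψ t = 0 :=
    image_eq_zero_of_notMem_tsupport fun h => ht.not_gt (hψ h)
  have := hle ψ
  rwa [conormal_eq_zero hpos, mul_zero, norm_le_zero_iff] at this

theorem controlled_integral_mul (φ : Test) : Controlled fun ψ => ‖∫ t, φ t * ψ t‖ := by
  have hnorm : Controlled fun ψ => lpNorm (ψ : ℝ → ℂ) 2 halfMeasure := by
    simpa only [Complex.ofReal_one, one_mul, Function.iterate_zero, id_eq] using
      controlled_lpNorm_mul_iterate_deriv (b := fun _ => 1) 0 0 zero_le_one fun t _ => by simp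
  refine (hnorm.const_mul (c := lpNorm φ 2 halfMeasure) lpNorm_nonneg).mono fun ψ => ?_
  rw [← setIntegral_eq_integral_of_forall_compl_eq_zero (s := Set.Ioi 0) fun t ht => by
    rw [test_eq_zero_of_notMem_Ioi φ ht, zero_mul]]
  exact norm_integral_mul_le_lpNorm_mul_lpNorm (memLp_halfMeasure (toSchwartz φ))
    (memLp_halfMeasure ψ)

theorem contDiffOn_nearInv (δ : ℝ) : ContDiffOn ℝ ∞
    (fun t : ℝ => cutoff (2⁻¹ * t) * t ^ (-(1 / 2 : ℝ)) * japanese (-δ) t) (Set.Ioi 0) :=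
  ((contDiff_cutoff.comp (contDiff_const.mul contDiff_id)).contDiffOn.mul
    (contDiffOn_id.rpow_const_of_ne fun _ ht => ne_of_gt ht)).mul (contDiff_japanese _).contDiffOn

theorem contDiffOn_farInv (δ : ℝ) : ContDiffOn ℝ ∞
    (fun t : ℝ => (1 - cutoff (2 * t)) * japanese (-δ) t) (Set.Ioi 0) :=
  ((contDiff_const.sub (contDiff_cutoff.comp (contDiff_const.mul contDiff_id))).mul
    (contDiff_japanese _)).contDiffOn

theorem cutoff_partition (t : ℝ) :
    cutoff t * cutoff (2⁻¹ * t) + (1 - cutoff t) * (1 - cutoff (2 * t)) = 1 := by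
  rcases le_total t 1 with h₁ | h₁
  · rw [cutoff_of_le h₁, cutoff_of_le (t := 2⁻¹ * t) (by linarith)]
    ring
  · rw [cutoff_of_ge (t := 2 * t) (by linarith)]
    rcases le_total t 2 with h₂ | h₂
    · rw [cutoff_of_le (t := 2⁻¹ * t) (by linarith)]
      ring
    · rw [cutoff_of_ge h₂]
      ring

theorem mulTest_near_add_far (δ : ℝ) (φ : Test) :
    mulTest _ (contDiffOn_near 0 δ) (mulTest _ (contDiffOn_nearInv δ) φ) +
      mulTest _ (contDiffOn_far δ) (mulTest _ (contDiffOn_farInv δ) φ) = φ := by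
  ext t
  rw [_root_.add_apply, mulTest_apply, mulTest_apply, mulTest_apply, mulTest_apply]
  by_cases ht : 0 < t
  · have hpow : t ^ (1 / 2 - 0 : ℝ) * t ^ (-(1 / 2 : ℝ)) = 1 := by
      rw [← Real.rpow_add ht, sub_zero, add_neg_cancel, Real.rpow_zero]
    have hweights : cutoff t * t ^ (1 / 2 - 0 : ℝ) * japanese δ t *
        (cutoff (2⁻¹ * t) * t ^ (-(1 / 2 : ℝ)) * japanese (-δ) t) +
        (1 - cutoff t) * japanese δ t * ((1 - cutoff (2 * t)) * japanese (-δ) t) = 1 := by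
      linear_combination cutoff_partition t +
        cutoff t * cutoff (2⁻¹ * t) * hpow * (japanese δ t * japanese (-δ) t) +
        (cutoff t * cutoff (2⁻¹ * t) + (1 - cutoff t) * (1 - cutoff (2 * t))) *
          japanese_neg_mul δ t
    rw [← mul_assoc, ← mul_assoc, ← add_mul, ← Complex.ofReal_mul, ← Complex.ofReal_mul,
      ← Complex.ofReal_add, hweights, Complex.ofReal_one, one_mul]
  · simp only [test_eq_zero_of_notMem_Ioi φ ht, mul_zero, add_zero]

theorem near_toSchwartz {δ : ℝ} (hb : IsNear (nearWeight 2⁻¹ (-δ))) (φ : Test) :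
    near _ hb (toSchwartz φ) =
      toSchwartz (thetaInvTest (mulTest _ (contDiffOn_nearInv δ) φ)) := by
  ext r
  have htheta (φ : Test) :
      thetaInvTest φ r = ((Real.exp (-r) : ℝ) : ℂ) * φ (Real.exp (-r)) := rfl
  have hexp : Real.exp (-r / 2) = Real.exp (-r) * Real.exp (-r * -(1 / 2)) := by
    rw [← Real.exp_add]
    congr 1
    ring
  rw [near_apply, toSchwartz_apply, toSchwartz_apply, htheta, mulTest_apply, nearWeight,
    ← Real.exp_mul, hexp]
  push_cast
  ring

theorem mulReal_farWeight_toSchwartz (δ : ℝ) (φ : Test) :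
    mulReal (farWeight 2 (-δ)) (toSchwartz φ) = toSchwartz (mulTest _ (contDiffOn_farInv δ) φ) := by
  ext t
  rw [mulReal_apply (isFar_farWeight two_pos _).hasTemperateGrowth]
  rfl

/-- The pair of components of an element of the cone Sobolev space. -/
def coneComponents (s γ δ : ℝ) : Cone s γ δ →ₗᵢ[ℂ] WithLp 1 (L2 × HPlus s 0) where
  toLinearMap := conePair s γ δ
  norm_map' _ := rfl

/-- The component of an element of the cone Sobolev space near `0`. -/
def coneNear (s γ δ : ℝ) : Cone s γ δ →L[ℂ] L2 :=
  WithLp.fstL 1 ℂ L2 (HPlus s 0) ∘L (coneComponents s γ δ).toContinuousLinearMap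

/-- The component of an element of the cone Sobolev space away from `0`, extended to `ℝ`. -/
def coneFar (s γ δ : ℝ) : Cone s γ δ →L[ℂ] L2 :=
  hPlusLift s 0 ∘L WithLp.sndL 1 ℂ L2 (HPlus s 0) ∘L (coneComponents s γ δ).toContinuousLinearMap

theorem norm_coneNear_add_norm_coneFar_le {s γ δ : ℝ} (u : Cone s γ δ) :
    ‖coneNear s γ δ u‖ + ‖coneFar s γ δ u‖ ≤ ‖u‖ := by
  rw [← (coneComponents s γ δ).norm_map u, WithLp.prod_norm_eq_of_L1]
  exact add_le_add_right (norm_hPlusLift_le _ _ _) _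

theorem sobolev_coneNear {s γ δ : ℝ} (u : Cone s γ δ) (φ : TestR) :
    sobolev s 0 (coneNear s γ δ u) (toSchwartz φ) =
      coneDist s γ δ u (mulTest _ (contDiffOn_near γ δ) (thetaTest φ)) := u.2.1 φ

theorem sobolev_coneFar {s γ δ : ℝ} (u : Cone s γ δ) (φ : Test) :
    sobolev s 0 (coneFar s γ δ u) (toSchwartz φ) =
      coneDist s γ δ u (mulTest _ (contDiffOn_far δ) φ) :=
  (hPlusDist_eq_sobolev_hPlusLift _ _ _ φ).symm.trans (u.2.2 φ)

/-- The functional on `L² × L²` given by the two components of an element of the cone Sobolev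
space. -/
def coneDual (s γ δ : ℝ) : Cone s γ δ →L[ℂ] (L2 × L2 →L[ℂ] ℂ) :=
  (ContinuousLinearMap.compL ℂ (L2 × L2) L2 ℂ).flip (.fst ℂ L2 L2) ∘L pair ∘L coneNear s γ δ +
    (ContinuousLinearMap.compL ℂ (L2 × L2) L2 ℂ).flip (.snd ℂ L2 L2) ∘L pair ∘L coneFar s γ δ

theorem norm_coneDual_le {s γ δ : ℝ} (u : Cone s γ δ) : ‖coneDual s γ δ u‖ ≤ ‖u‖ := by
  refine ContinuousLinearMap.opNorm_le_bound _ (norm_nonneg u) fun x => ?_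
  calc ‖coneDual s γ δ u x‖
      ≤ ‖coneNear s γ δ u‖ * ‖x.1‖ + ‖coneFar s γ δ u‖ * ‖x.2‖ :=
        (norm_add_le _ _).trans (add_le_add (norm_pair_apply_le _ _) (norm_pair_apply_le _ _))
    _ ≤ (‖coneNear s γ δ u‖ + ‖coneFar s γ δ u‖) * ‖x‖ := by
        rw [add_mul]
        gcongr
        exacts [norm_fst_le x, norm_snd_le x]
    _ ≤ ‖u‖ * ‖x‖ := by
        gcongr
        exact norm_coneNear_add_norm_coneFar_le u

/-- The extension by zero of an element of the cone Sobolev space to a functional on `𝓢(ℝ)`. The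
cut-offs at `2` and `1/2` equal `1` on the supports of those in the definition of the cone Sobolev
space. -/
def coneExtension (s δ : ℝ) (u : Cone s 0 δ) : 𝓢(ℝ, ℂ) →ₗ[ℂ] ℂ :=
  (coneDual s 0 δ u).toLinearMap ∘ₗ besselSplit (-s) (-δ) (inv_pos.2 two_pos) 2

theorem controlled_coneExtension {s δ : ℝ} (u : Cone s 0 δ) :
    Controlled fun ψ => ‖coneExtension s δ u ψ‖ :=
  ((controlled_besselSplit (-s) (-δ) (inv_pos.2 two_pos) two_pos).const_mul
    (norm_nonneg (coneDual s 0 δ u))).mono fun _ => (coneDual s 0 δ u).le_opNorm _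

theorem coneExtension_toSchwartz {s δ : ℝ} (u : Cone s 0 δ) (φ : Test) :
    coneExtension s δ u (toSchwartz φ) = coneDist s 0 δ u φ := by
  have hsplit : coneExtension s δ u (toSchwartz φ) =
      sobolev s 0 (coneNear s 0 δ u)
        (near _ (isNear_nearWeight (inv_pos.2 two_pos) (-δ)) (toSchwartz φ)) +
      sobolev s 0 (coneFar s 0 δ u) (mulReal (farWeight 2 (-δ)) (toSchwartz φ)) := by
    rw [sobolev_zero_apply, sobolev_zero_apply]
    rfl
  rw [hsplit, near_toSchwartz, mulReal_farWeight_toSchwartz, sobolev_coneNear, sobolev_coneFar,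
    thetaTest_thetaInvTest, ← map_add, mulTest_near_add_far]

theorem coneExtension_dil {s δ r : ℝ} (hr : 0 < r) {u v : Cone s 0 δ}
    (huv : ∀ φ : Test, coneDist s 0 δ v φ = coneDist s 0 δ u (dilTest r⁻¹ (inv_pos.2 hr) φ))
    (ψ : 𝓢(ℝ, ℂ)) :
    coneExtension s δ v ψ = coneExtension s δ u (dilSchwartz r⁻¹ (inv_pos.2 hr) ψ) := by
  have hext : coneExtension s δ v =
      coneExtension s δ u ∘ₗ (dilSchwartz r⁻¹ (inv_pos.2 hr)).toLinearMap := by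
    refine eq_of_controlled (controlled_coneExtension v)
      ((controlled_coneExtension u).comp_dilSchwartz _) fun φ => ?_
    rw [coneExtension_toSchwartz, huv, ← coneExtension_toSchwartz, toSchwartz_dilTest]
    rfl
  rw [hext]
  rfl

theorem coneExtension_of_isTest {s δ : ℝ} {u : Cone s 0 δ} {φ : Test}
    (hu : SourceSpace.isTest φ u) (ψ : 𝓢(ℝ, ℂ)) :
    coneExtension s δ u ψ = ∫ t, φ t * ψ t := by
  have hpair (ψ : 𝓢(ℝ, ℂ)) : pair (toL2 (toSchwartz φ)) (toL2 ψ) = ∫ t, φ t * ψ t :=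
    pair_toL2_toL2 _ _
  have hext : coneExtension s δ u =
      (pair (toL2 (toSchwartz φ))).toLinearMap ∘ₗ toL2.toLinearMap := by
    refine eq_of_controlled (controlled_coneExtension u)
      ((controlled_integral_mul φ).mono fun ψ => (congrArg norm (hpair ψ)).le) fun χ => ?_
    rw [coneExtension_toSchwartz, hu χ]
    exact (hpair (toSchwartz χ)).symm
  rw [hext]
  exact hpair ψ

theorem mulReal_bessel_bessel_mulReal (k ε : ℝ) (ψ : 𝓢(ℝ, ℂ)) :
    mulReal (japanese (-ε)) (bessel (-k) (bessel (-(-k)) (mulReal (japanese (-(-ε))) ψ))) = ψ := by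
  rw [bessel_bessel, add_neg_cancel, bessel_zero]
  ext t
  rw [mulReal_apply (hasTemperateGrowth_japanese _), mulReal_apply (hasTemperateGrowth_japanese _),
    ← mul_assoc, ← Complex.ofReal_mul, japanese_neg_mul, Complex.ofReal_one, one_mul]

theorem exists_coneExtensionMap (s δ : ℝ) : ∃ (K : ℕ) (C : ℝ), 0 ≤ C ∧ ∀ (r : ℝ) (hr : 1 ≤ r),
    ∃ T : Cone s 0 δ →L[ℂ] HZero (-K) (-(3 * K)), (∀ u, ‖T u‖ ≤ C * ‖u‖) ∧
      ∀ u ψ, hZeroDist (-K) (-(3 * K)) (T u) ψ =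
        coneExtension s δ u (dilSchwartz r (zero_lt_one.trans_le hr) ψ) := by
  obtain ⟨K, C, hC, hA⟩ := (controlled_besselSplit (-s) (-δ)
    (inv_pos.2 two_pos) two_pos).exists_uniform_extension
  refine ⟨K, C, hC, fun r hr => ?_⟩
  obtain ⟨A, hAC, hA⟩ := hA r hr
  let T : Cone s 0 δ →L[ℂ] L2 := pairRiesz.toContinuousLinearMap ∘L
    (ContinuousLinearMap.compL ℂ L2 (L2 × L2) ℂ).flip A ∘L coneDual s 0 δ
  have hpair (u : Cone s 0 δ) (f : L2) : pair (T u) f = coneDual s 0 δ u (A f) :=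
    pair_pairRiesz _ f
  have hsobolev (u : Cone s 0 δ) (ψ : 𝓢(ℝ, ℂ)) : sobolev (-K) (-(3 * K)) (T u) ψ =
      coneExtension s δ u (dilSchwartz r (zero_lt_one.trans_le hr) ψ) := by
    rw [sobolev_apply, hpair, hA, mulReal_bessel_bessel_mulReal]
    rfl
  have hnorm (u : Cone s 0 δ) : ‖T u‖ ≤ C * ‖u‖ :=
    calc ‖T u‖ = ‖coneDual s 0 δ u ∘L A‖ := pairRiesz.norm_map _
      _ ≤ ‖coneDual s 0 δ u‖ * ‖A‖ := ContinuousLinearMap.opNorm_comp_le _ _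
      _ ≤ C * ‖u‖ := by
        rw [mul_comm]
        exact mul_le_mul hAC (norm_coneDual_le u) (norm_nonneg _) hC
  have hzero (u : Cone s 0 δ) : T u ∈ hZero (-K) (-(3 * K)) := fun ψ hψ =>
    (hsobolev u ψ).trans ((controlled_coneExtension u).map_dilSchwartz_eq_zero _ hψ)
  exact ⟨T.codRestrict (hZero (-K) (-(3 * K))) hzero, hnorm, hsobolev⟩

theorem exists_sourceEmbedding (s δ : ℝ) : ∃ (k ε : ℝ) (I : Cone s 0 δ →L[ℂ] HZero k ε),
    IsSourceTwist .plain I ∧ ∀ φ u, SourceSpace.isTest φ u → SourceSpace.isTest φ (I u) := by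
  obtain ⟨K, C, hC, h⟩ := exists_coneExtensionMap s δ
  choose T hT hTdist using h
  have hdist (u : Cone s 0 δ) (ψ : 𝓢(ℝ, ℂ)) :
      hZeroDist (-K) (-(3 * K)) (T 1 le_rfl u) ψ = coneExtension s δ u ψ := by
    rw [hTdist, dilSchwartz_one]
  refine ⟨-K, -(3 * K), T 1 le_rfl, ⟨?_, C, hC, ?_⟩, fun φ u hu ψ => ?_⟩
  · rintro r u v ⟨hr, huv⟩
    refine ⟨hr, fun ψ => ?_⟩
    rw [hdist, hdist]
    exact coneExtension_dil hr huv ψ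
  · rintro r' r hr' hle - u v ⟨hr'₀, huv⟩
    have hr : 0 < r := hr'.trans_le hle
    refine ⟨T (r / r') ((one_le_div hr').2 hle) u, ⟨hr, fun ψ => ?_⟩, hT _ _ _⟩
    rw [hdist, hTdist, coneExtension_dil hr'₀ huv,
      dilSchwartz_dilSchwartz _ _ (inv_pos.2 hr'₀) (by field_simp)]
  · rw [hdist]
    exact coneExtension_of_isTest hu ψ

/-! ### Iterated partial derivatives -/

theorem uniqueDiffOn_fullDomain (n : ℕ) : UniqueDiffOn ℝ (fullDomain n) := by
  have hprod : fullDomain n = Set.univ ×ˢ (Set.univ ×ˢ Set.Ici (0 : ℝ)) := by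
    ext p
    simp [fullDomain]
  rw [hprod]
  exact uniqueDiffOn_univ.prod (uniqueDiffOn_univ.prod (uniqueDiffOn_Ici 0))

theorem uniqueDiffOn_strongDomain (n : ℕ) : UniqueDiffOn ℝ (strongDomain n) :=
  (uniqueDiffOn_fullDomain n).inter (t := {p : Phase n | p.2 ≠ 0})
    (isOpen_ne.preimage continuous_snd)

theorem uniqueDiffOn_weakDomain (n : ℕ) : UniqueDiffOn ℝ (weakDomain n) :=
  (uniqueDiffOn_fullDomain n).inter (t := {p : Phase n | p.2.1 ≠ 0})
    (isOpen_ne.preimage (continuous_fst.comp continuous_snd))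

section Partials

variable {n : ℕ} {F G : Type*} [NormedAddCommGroup F] [NormedSpace ℝ F] [NormedAddCommGroup G]
  [NormedSpace ℝ G] {D : Set (Phase n)} {a b : Phase n → F}

theorem contDiffOn_partials (hD : UniqueDiffOn ℝ D) (ha : ContDiffOn ℝ ∞ a D) :
    ∀ l, ContDiffOn ℝ ∞ (partials D l a) D
  | [] => ha
  | _ :: l => ((contDiffOn_partials hD ha l).fderivWithin hD (m := ∞) (by simp)).clm_apply
      contDiffOn_const

theorem differentiableOn_partials (hD : UniqueDiffOn ℝ D) (ha : ContDiffOn ℝ ∞ a D)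
    (l : List (Direction n)) : DifferentiableOn ℝ (partials D l a) D :=
  (contDiffOn_partials hD ha l).differentiableOn (by simp)

theorem partials_congr (h : Set.EqOn a b D) : ∀ l, Set.EqOn (partials D l a) (partials D l b) D
  | [] => h
  | e :: l => fun _ hp => congrArg (fun T : Phase n →L[ℝ] F => T e.vec)
      (fderivWithin_congr (partials_congr h l) (partials_congr h l hp))

theorem partials_append (l l' : List (Direction n)) :
    partials D (l ++ l') a = partials D l (partials D l' a) := by
  induction l with
  | nil => rfl
  | cons e l ih => simp only [List.cons_append, partials, ih]

theorem partials_clm (hD : UniqueDiffOn ℝ D) (ha : ContDiffOn ℝ ∞ a D) (Φ : F →L[ℝ] G) :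
    ∀ l, Set.EqOn (partials D l fun p => Φ (a p)) (fun p => Φ (partials D l a p)) D
  | [] => fun _ _ => rfl
  | e :: l => fun p hp => by
    have ih := partials_clm hD ha Φ l
    have hchain : fderivWithin ℝ (fun p => Φ (partials D l a p)) D p =
        Φ ∘L fderivWithin ℝ (partials D l a) D p :=
      (Φ.hasFDerivAt.comp_hasFDerivWithinAt p
        (differentiableOn_partials hD ha l p hp).hasFDerivWithinAt).fderivWithin (hD p hp)
    simp only [partials]
    rw [fderivWithin_congr ih (ih hp), hchain]
    rfl

theorem partials_add (hD : UniqueDiffOn ℝ D) (ha : ContDiffOn ℝ ∞ a D) (hb : ContDiffOn ℝ ∞ b D) :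
    ∀ l, Set.EqOn (partials D l (a + b)) (partials D l a + partials D l b) D
  | [] => fun _ _ => rfl
  | e :: l => fun p hp => by
    have ih := partials_add hD ha hb l
    simp only [partials, Pi.add_apply]
    rw [fderivWithin_congr ih (ih hp), fderivWithin_add (hD p hp)
      (differentiableOn_partials hD ha l p hp) (differentiableOn_partials hD hb l p hp)]
    rfl

theorem partials_zero (l : List (Direction n)) : partials D l (0 : Phase n → F) = 0 := by
  induction l with
  | nil => rfl
  | cons e l ih =>
    funext p
    simp only [partials, ih, fderivWithin_zero, Pi.zero_apply, _root_.zero_apply]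

theorem partials_subset {D' : Set (Phase n)} (hD : UniqueDiffOn ℝ D) (hD' : UniqueDiffOn ℝ D')
    (hsub : D' ⊆ D) (ha : ContDiffOn ℝ ∞ a D) :
    ∀ l, Set.EqOn (partials D' l a) (partials D l a) D'
  | [] => fun _ _ => rfl
  | e :: l => fun p hp => by
    have ih := partials_subset hD hD' hsub ha l
    simp only [partials]
    rw [fderivWithin_congr ih (ih hp), fderivWithin_subset hsub (hD' p hp)
      (differentiableOn_partials hD ha l p (hsub hp))]

section MulXi

variable [NormedSpace ℂ F] [IsScalarTower ℝ ℂ F] {γ : EuclideanSpace ℝ (Fin n) → ℝ}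

theorem contDiff_ofReal_comp_xi (hγ : ContDiff ℝ ∞ γ) :
    ContDiff ℝ ∞ fun p : Phase n => ((γ p.2.1 : ℝ) : ℂ) :=
  Complex.ofRealCLM.contDiff.comp (hγ.comp (contDiff_fst.comp contDiff_snd))

theorem partials_singleton_smul (hD : UniqueDiffOn ℝ D) (hb : ContDiffOn ℝ ∞ b D)
    (hγ : ContDiff ℝ ∞ γ) (e : Direction n) :
    Set.EqOn (partials D [e] fun p => ((γ p.2.1 : ℝ) : ℂ) • b p)
      ((fun p => ((γ p.2.1 : ℝ) : ℂ) • partials D [e] b p) +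
        fun p => ((fderiv ℝ γ p.2.1 e.vec.2.1 : ℝ) : ℂ) • b p) D := by
  intro p hp
  have hxi : HasFDerivAt (fun p : Phase n => p.2.1)
      ((ContinuousLinearMap.fst ℝ _ _).comp (ContinuousLinearMap.snd ℝ _ _)) p :=
    hasFDerivAt_fst.comp p hasFDerivAt_snd
  have hfactor := Complex.ofRealCLM.hasFDerivAt.comp p
    ((hγ.differentiable (by simp) p.2.1).hasFDerivAt.comp p hxi)
  have hsmul := (hfactor.hasFDerivWithinAt.smul
    (hb.differentiableOn (by simp) p hp).hasFDerivWithinAt).fderivWithin (hD p hp)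
  exact congrArg (fun T : Phase n →L[ℝ] F => T e.vec) hsmul

theorem partials_concat_smul (hD : UniqueDiffOn ℝ D) (hb : ContDiffOn ℝ ∞ b D)
    (hγ : ContDiff ℝ ∞ γ) (l : List (Direction n)) (e : Direction n) :
    Set.EqOn (partials D (l ++ [e]) fun p => ((γ p.2.1 : ℝ) : ℂ) • b p)
      (partials D l (fun p => ((γ p.2.1 : ℝ) : ℂ) • partials D [e] b p) +
        partials D l fun p => ((fderiv ℝ γ p.2.1 e.vec.2.1 : ℝ) : ℂ) • b p) D := by
  have hγ' : ContDiff ℝ ∞ fun y => fderiv ℝ γ y e.vec.2.1 :=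
    (hγ.fderiv_right (m := ∞) (by simp)).clm_apply contDiff_const
  rw [partials_append]
  exact (partials_congr (partials_singleton_smul hD hb hγ e) l).trans (partials_add hD
    ((contDiff_ofReal_comp_xi hγ).contDiffOn.smul (contDiffOn_partials hD hb [e]))
    ((contDiff_ofReal_comp_xi hγ').contDiffOn.smul hb) l)

end MulXi

end Partials

/-! ### Operators between spaces with a linear group action -/

/-- Spaces whose dilations `κ_r`, encoded as relations, are compatible with the linear structure. -/
class LinearKappaSpace (E : Type*) [NormedAddCommGroup E] [NormedSpace ℂ E] [KappaSpace E] :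
    Prop where
  dil_zero : ∀ {r : ℝ}, 0 < r → KappaSpace.dil r (0 : E) 0
  dil_add : ∀ {r : ℝ} {u v u' v' : E}, KappaSpace.dil r u v → KappaSpace.dil r u' v' →
    KappaSpace.dil r (u + u') (v + v')
  dil_smul : ∀ {r : ℝ} {u v : E} (c : ℂ), KappaSpace.dil r u v → KappaSpace.dil r (c • u) (c • v)

open LinearKappaSpace

theorem LinearKappaSpace.of_linearMap {E : Type*} [NormedAddCommGroup E] [NormedSpace ℂ E]
    [KappaSpace E] (T : E →ₗ[ℂ] Dist) (hT : ∀ r (u v : E), KappaSpace.dil r u v ↔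
      ∃ hr : 0 < r, ∀ φ : Test, T v φ = T u (dilTest r⁻¹ (inv_pos.2 hr) φ)) :
    LinearKappaSpace E where
  dil_zero hr := (hT _ _ _).2 ⟨hr, fun φ => by rw [map_zero]; rfl⟩
  dil_add := by
    simp only [hT]
    rintro r u v u' v' ⟨hr, huv⟩ ⟨_, huv'⟩
    refine ⟨hr, fun φ => ?_⟩
    rw [map_add, map_add]
    exact congrArg₂ (· + ·) (huv φ) (huv' φ)
  dil_smul := by
    simp only [hT]
    rintro r u v c ⟨hr, huv⟩
    refine ⟨hr, fun φ => ?_⟩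
    rw [map_smul, map_smul]
    exact congrArg (c • ·) (huv φ)

instance (s δ : ℝ) : LinearKappaSpace (HPlus s δ) :=
  .of_linearMap (hPlusDist s δ) fun _ _ _ => Iff.rfl

instance (s γ δ : ℝ) : LinearKappaSpace (Cone s γ δ) :=
  .of_linearMap (coneDist s γ δ) fun _ _ _ => Iff.rfl

instance (E : Type*) [NormedAddCommGroup E] [NormedSpace ℂ E] [KappaSpace E] [LinearKappaSpace E]
    (L M : ℕ) : LinearKappaSpace (Block E L M) where
  dil_zero hr := ⟨hr, fun _ => dil_zero hr, rfl⟩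
  dil_add h h' := ⟨h.1, fun i => dil_add (h.2.1 i) (h'.2.1 i), congrArg₂ (· + ·) h.2.2 h'.2.2⟩
  dil_smul c h := ⟨h.1, fun i => dil_smul c (h.2.1 i), congrArg (c • ·) h.2.2⟩

section TwistedNormLE

variable {E₀ E₁ E₂ : Type*} [NormedAddCommGroup E₀] [NormedSpace ℂ E₀] [KappaSpace E₀]
  [NormedAddCommGroup E₁] [NormedSpace ℂ E₁] [KappaSpace E₁]
  [NormedAddCommGroup E₂] [NormedSpace ℂ E₂] [KappaSpace E₂]
  {r₀ r₁ r₂ C C' : ℝ} {T T' : E₀ →L[ℂ] E₁}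

theorem TwistedNormLE.mono (hT : TwistedNormLE r₀ r₁ T C) (hC : C ≤ C') :
    TwistedNormLE r₀ r₁ T C' := fun u v huv => by
  obtain ⟨w, hw, hwu⟩ := hT u v huv
  exact ⟨w, hw, hwu.trans (mul_le_mul_of_nonneg_right hC (norm_nonneg u))⟩

theorem TwistedNormLE.comp {S : E₁ →L[ℂ] E₂} (hS : TwistedNormLE r₁ r₂ S C')
    (hT : TwistedNormLE r₀ r₁ T C) (hC' : 0 ≤ C') : TwistedNormLE r₀ r₂ (S ∘L T) (C' * C) :=
  fun u v huv => by
    obtain ⟨w, hw, hwu⟩ := hT u v huv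
    obtain ⟨z, hz, hzw⟩ := hS w (T v) hw
    refine ⟨z, hz, hzw.trans ?_⟩
    rw [mul_assoc]
    exact mul_le_mul_of_nonneg_left hwu hC'

variable [LinearKappaSpace E₁]

theorem TwistedNormLE.add (hT : TwistedNormLE r₀ r₁ T C) (hT' : TwistedNormLE r₀ r₁ T' C') :
    TwistedNormLE r₀ r₁ (T + T') (C + C') := fun u v huv => by
  obtain ⟨w, hw, hwu⟩ := hT u v huv
  obtain ⟨w', hw', hwu'⟩ := hT' u v huv
  refine ⟨w + w', dil_add hw hw', (norm_add_le _ _).trans ?_⟩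
  rw [add_mul]
  exact add_le_add hwu hwu'

theorem TwistedNormLE.smul (hT : TwistedNormLE r₀ r₁ T C) (c : ℂ) :
    TwistedNormLE r₀ r₁ (c • T) (‖c‖ * C) := fun u v huv => by
  obtain ⟨w, hw, hwu⟩ := hT u v huv
  refine ⟨c • w, dil_smul c hw, ?_⟩
  rw [norm_smul, mul_assoc]
  exact mul_le_mul_of_nonneg_left hwu (norm_nonneg c)

theorem twistedNormLE_zero (hr : 0 < r₁) : TwistedNormLE r₀ r₁ (0 : E₀ →L[ℂ] E₁) 0 :=
  fun _ _ _ => ⟨0, dil_zero hr, by rw [norm_zero, zero_mul]⟩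

end TwistedNormLE

/-! ### Symbol estimates -/

section SymbolEstimates

variable {n : ℕ} {E₀ E₁ F₀ F₁ : Type*}
  [NormedAddCommGroup E₀] [NormedSpace ℂ E₀] [KappaSpace E₀]
  [NormedAddCommGroup E₁] [NormedSpace ℂ E₁] [KappaSpace E₁]
  [NormedAddCommGroup F₀] [NormedSpace ℂ F₀] [KappaSpace F₀]
  [NormedAddCommGroup F₁] [NormedSpace ℂ F₁] [KappaSpace F₁]
  {D D' : Set (Phase n)} {r₀ r₁ r₀' r₁' : Phase n → ℝ} {w w' : ℕ → ℕ → Phase n → ℝ}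
  {a b : Phase n → E₀ →L[ℂ] E₁}

theorem SymbolEstimates.exists_nonneg (ha : SymbolEstimates D r₀ r₁ w a)
    (hw : ∀ k j, ∀ p ∈ D, 0 ≤ w k j p) (l : List (Direction n)) :
    ∃ C : ℝ, 0 ≤ C ∧ ∀ p ∈ D, TwistedNormLE (r₀ p) (r₁ p) (partials D l a p)
      (C * w (l.countP Direction.isXi) (l.countP Direction.isMu) p) := by
  obtain ⟨C, hC⟩ := ha.2 l
  exact ⟨|C|, abs_nonneg C, fun p hp => (hC p hp).mono
    (mul_le_mul_of_nonneg_right (le_abs_self C) (hw _ _ p hp))⟩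

theorem SymbolEstimates.mono (ha : SymbolEstimates D r₀ r₁ w a)
    (hw : ∀ k j, ∀ p ∈ D, 0 ≤ w k j p) (hww' : ∀ k j, ∀ p ∈ D, w k j p ≤ w' k j p) :
    SymbolEstimates D r₀ r₁ w' a := by
  refine ⟨ha.1, fun l => ?_⟩
  obtain ⟨C, hC, hCa⟩ := ha.exists_nonneg hw l
  exact ⟨C, fun p hp => (hCa p hp).mono (mul_le_mul_of_nonneg_left (hww' _ _ p hp) hC)⟩

theorem SymbolEstimates.partials (hD : UniqueDiffOn ℝ D) (ha : SymbolEstimates D r₀ r₁ w a)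
    (l : List (Direction n)) : SymbolEstimates D r₀ r₁
      (fun k j => w (k + l.countP Direction.isXi) (j + l.countP Direction.isMu))
      (partials D l a) := by
  refine ⟨contDiffOn_partials hD ha.1 l, fun l' => ?_⟩
  simpa only [partials_append, List.countP_append] using ha.2 (l' ++ l)

theorem SymbolEstimates.comp (hD : UniqueDiffOn ℝ D) (hD' : UniqueDiffOn ℝ D') (hsub : D' ⊆ D)
    (hw : ∀ k j, ∀ p ∈ D, 0 ≤ w k j p) (ha : SymbolEstimates D r₀ r₁ w a)
    {I : F₀ →L[ℂ] E₀} {J : E₁ →L[ℂ] F₁} {C₀ C₁ : ℝ} (hC₁ : 0 ≤ C₁)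
    (hI : ∀ p ∈ D', TwistedNormLE (r₀' p) (r₀ p) I C₀)
    (hJ : ∀ p ∈ D', TwistedNormLE (r₁ p) (r₁' p) J C₁) :
    SymbolEstimates D' r₀' r₁' w (fun p => J ∘L a p ∘L I) := by
  let Φ : (E₀ →L[ℂ] E₁) →L[ℝ] (F₀ →L[ℂ] F₁) :=
    ((ContinuousLinearMap.compL ℂ F₀ E₁ F₁ J) ∘L
      ((ContinuousLinearMap.compL ℂ F₀ E₀ E₁).flip I)).restrictScalars ℝ
  refine ⟨Φ.contDiff.comp_contDiffOn (ha.1.mono hsub), fun l => ?_⟩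
  obtain ⟨C, hC, hCa⟩ := ha.exists_nonneg hw l
  refine ⟨C₁ * C * C₀, fun p hp => ?_⟩
  have hpartials : GreenSymbols.partials D' l (fun p => J ∘L a p ∘L I) p =
      J ∘L GreenSymbols.partials D l a p ∘L I := by
    rw [← partials_subset hD hD' hsub ha.1 l hp]
    exact partials_clm hD' (ha.1.mono hsub) Φ l hp
  rw [hpartials]
  refine ((hJ p hp).comp ((hCa p (hsub hp)).comp (hI p hp) ?_) hC₁).mono (le_of_eq (by ring))
  exact mul_nonneg hC (hw _ _ p (hsub hp))

variable [LinearKappaSpace E₁]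

theorem SymbolEstimates.add (hD : UniqueDiffOn ℝ D)
    (ha : SymbolEstimates D r₀ r₁ w a) (hb : SymbolEstimates D r₀ r₁ w b) :
    SymbolEstimates D r₀ r₁ w (a + b) := by
  refine ⟨ha.1.add hb.1, fun l => ?_⟩
  obtain ⟨C, hC⟩ := ha.2 l
  obtain ⟨C', hC'⟩ := hb.2 l
  refine ⟨C + C', fun p hp => ?_⟩
  rw [partials_add hD ha.1 hb.1 l hp, add_mul]
  exact (hC p hp).add (hC' p hp)

theorem SymbolEstimates.const_smul (hD : UniqueDiffOn ℝ D) (c : ℂ)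
    (ha : SymbolEstimates D r₀ r₁ w a) : SymbolEstimates D r₀ r₁ w (c • a) := by
  let Φ : (E₀ →L[ℂ] E₁) →L[ℝ] (E₀ →L[ℂ] E₁) :=
    (c • ContinuousLinearMap.id ℂ (E₀ →L[ℂ] E₁)).restrictScalars ℝ
  refine ⟨Φ.contDiff.comp_contDiffOn ha.1, fun l => ?_⟩
  obtain ⟨C, hC⟩ := ha.2 l
  refine ⟨‖c‖ * C, fun p hp => ?_⟩
  have hpartials : GreenSymbols.partials D l (c • a) p = c • GreenSymbols.partials D l a p :=
    partials_clm hD ha.1 Φ l hp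
  rw [hpartials, mul_assoc]
  exact (hC p hp).smul c

theorem SymbolEstimates.sub (hD : UniqueDiffOn ℝ D)
    (ha : SymbolEstimates D r₀ r₁ w a) (hb : SymbolEstimates D r₀ r₁ w b) :
    SymbolEstimates D r₀ r₁ w (a - b) := by
  rw [sub_eq_add_neg, ← neg_one_smul ℂ b]
  exact ha.add hD (hb.const_smul hD (-1))

theorem symbolEstimates_zero (hr : ∀ p ∈ D, 0 < r₁ p) :
    SymbolEstimates D r₀ r₁ w (0 : Phase n → E₀ →L[ℂ] E₁) := by
  refine ⟨contDiffOn_const, fun l => ⟨0, fun p hp => ?_⟩⟩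
  rw [partials_zero, zero_mul]
  exact twistedNormLE_zero (hr p hp)

theorem SymbolEstimates.sum (hD : UniqueDiffOn ℝ D) (hr : ∀ p ∈ D, 0 < r₁ p) {ι : Type*}
    (s : Finset ι) {f : ι → Phase n → E₀ →L[ℂ] E₁}
    (hf : ∀ i ∈ s, SymbolEstimates D r₀ r₁ w (f i)) :
    SymbolEstimates D r₀ r₁ w (∑ i ∈ s, f i) :=
  Finset.sum_induction f _ (fun _ _ h h' => h.add hD h') (symbolEstimates_zero hr) hf

end SymbolEstimates

/-! ### The weights -/

section Weights

variable {n : ℕ} (p : Phase n)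

theorem one_le_brXi : 1 ≤ brXi p := by
  rw [brXi, Real.one_le_sqrt]
  exact le_add_of_nonneg_right (sq_nonneg _)

theorem brXi_le_brXiMu : brXi p ≤ brXiMu p :=
  Real.sqrt_le_sqrt (le_add_of_nonneg_right (sq_nonneg _))

theorem brXi_pos : 0 < brXi p := zero_lt_one.trans_le (one_le_brXi p)

theorem brXiMu_pos : 0 < brXiMu p := (brXi_pos p).trans_le (brXi_le_brXiMu p)

theorem one_le_brXiMu : 1 ≤ brXiMu p := (one_le_brXi p).trans (brXi_le_brXiMu p)

theorem absXi_le_absXiMu : absXi p ≤ absXiMu p :=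
  Real.le_sqrt_of_sq_le (le_add_of_nonneg_right (sq_nonneg _))

theorem absXi_pos {p : Phase n} (hp : p ∈ weakDomain n) : 0 < absXi p := norm_pos_iff.2 hp.2

theorem absXiMu_pos {p : Phase n} (hp : p ∈ strongDomain n) : 0 < absXiMu p := by
  refine Real.sqrt_pos.2 ?_
  by_cases hξ : p.2.1 = 0
  · have hμ : p.2.2 ≠ 0 := fun hμ => hp.2 (Prod.ext hξ hμ)
    positivity
  · have := norm_pos_iff.2 hξ
    positivity

theorem Twist.bracket_pos (k : Twist) : 0 < k.bracket p := by
  cases k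
  · exact brXiMu_pos p
  · exact brXi_pos p

theorem Twist.bracket_le (k : Twist) : k.bracket p ≤ brXiMu p := by
  cases k
  · exact le_rfl
  · exact brXi_le_brXiMu p

theorem Twist.bracket_eq {k : Twist} (hk : k = .bold) : k.bracket p = brXiMu p := by
  rw [hk, bracket]

theorem Twist.modulus_pos (k : Twist) {p : Phase n} (hp : p ∈ weakDomain n) : 0 < k.modulus p := by
  cases k
  · exact absXiMu_pos (weakDomain_subset n hp)
  · exact absXi_pos hp

theorem Twist.modulus_le (k : Twist) : k.modulus p ≤ absXiMu p := by
  cases k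
  · exact le_rfl
  · exact absXi_le_absXiMu p

theorem Twist.modulus_eq {k : Twist} (hk : k = .bold) : k.modulus p = absXiMu p := by
  rw [hk, modulus]

end Weights

theorem rpow_add_le_rpow_mul_rpow {x y σ τ : ℝ} (hx : 0 < x) (hxy : x ≤ y) (hσ : σ ≤ 0) :
    y ^ (σ + τ) ≤ x ^ σ * y ^ τ := by
  rw [Real.rpow_add (hx.trans_le hxy)]
  exact mul_le_mul_of_nonneg_right (Real.rpow_le_rpow_of_nonpos hx hxy hσ)
    (Real.rpow_nonneg (hx.le.trans hxy) _)

/-! ### Multiplication by compactly supported functions of `ξ` -/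

section CompactSupport

variable {n : ℕ} {E₀ E₁ : Type*} [NormedAddCommGroup E₀] [NormedSpace ℂ E₀] [KappaSpace E₀]
  [NormedAddCommGroup E₁] [NormedSpace ℂ E₁] [KappaSpace E₁]
  {D : Set (Phase n)} {r₀ r₁ : Phase n → ℝ} {γ : EuclideanSpace ℝ (Fin n) → ℝ}
  {b : Phase n → E₀ →L[ℂ] E₁} {v : ℕ → Phase n → ℝ}

theorem exists_abs_le_mul_brXi_rpow (hγ : Continuous γ) (hsupp : HasCompactSupport γ) (τ : ℝ) :
    ∃ C : ℝ, ∀ p : Phase n, |γ p.2.1| ≤ C * brXi p ^ τ := by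
  have hcont : Continuous fun y : EuclideanSpace ℝ (Fin n) => γ y * √(1 + ‖y‖ ^ 2) ^ (-τ) := by
    refine hγ.mul (Continuous.rpow_const (by fun_prop) fun y => Or.inl ?_)
    positivity
  obtain ⟨C, hC⟩ := hcont.bounded_above_of_compact_support hsupp.mul_right
  refine ⟨C, fun p => ?_⟩
  have hbound : |γ p.2.1| * brXi p ^ (-τ) ≤ C := by
    have := hC p.2.1
    rwa [norm_mul, Real.norm_eq_abs, Real.norm_of_nonneg (by positivity)] at this
  rwa [Real.rpow_neg (brXi_pos p).le, ← div_eq_mul_inv,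
    div_le_iff₀ (Real.rpow_pos_of_pos (brXi_pos p) τ)] at hbound

/-- A `ξ`-derivative falling on the cut-off `γ` does not change the `μ`-order; the other derivatives
of `γ` vanish, so that `b` may be replaced by its derivative there. -/
theorem SymbolEstimates.exists_fderiv_smul_eq (hD : UniqueDiffOn ℝ D)
    (hb : SymbolEstimates D r₀ r₁ (fun _ j => v j) b) (γ : EuclideanSpace ℝ (Fin n) → ℝ)
    (e : Direction n) : ∃ c : Phase n → E₀ →L[ℂ] E₁,
      SymbolEstimates D r₀ r₁ (fun _ j => v (j + [e].countP Direction.isMu)) c ∧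
      ∀ p, ((fderiv ℝ γ p.2.1 e.vec.2.1 : ℝ) : ℂ) • b p =
        ((fderiv ℝ γ p.2.1 e.vec.2.1 : ℝ) : ℂ) • c p := by
  have hzero (he : e.vec.2.1 = 0) (p : Phase n) : ((fderiv ℝ γ p.2.1 e.vec.2.1 : ℝ) : ℂ) • b p =
      ((fderiv ℝ γ p.2.1 e.vec.2.1 : ℝ) : ℂ) • GreenSymbols.partials D [e] b p := by
    rw [he, map_zero, Complex.ofReal_zero, zero_smul, zero_smul]
  cases e with
  | xi i => exact ⟨b, hb, fun _ => rfl⟩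
  | x i => exact ⟨_, hb.partials hD [.x i], hzero rfl⟩
  | mu => exact ⟨_, hb.partials hD [.mu], hzero rfl⟩

variable [LinearKappaSpace E₁]

theorem exists_twistedNormLE_compact_smul (hγ : Continuous γ) (hsupp : HasCompactSupport γ)
    (hv : ∀ p ∈ D, 0 ≤ v 0 p) (hb : SymbolEstimates D r₀ r₁ (fun _ j => v j) b) (τ : ℝ) :
    ∃ C : ℝ, ∀ p ∈ D, TwistedNormLE (r₀ p) (r₁ p) (((γ p.2.1 : ℝ) : ℂ) • b p)
      (C * (brXi p ^ τ * v 0 p)) := by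
  obtain ⟨C, hC⟩ := hb.2 []
  obtain ⟨C', hC'⟩ := exists_abs_le_mul_brXi_rpow hγ hsupp τ
  refine ⟨C' * |C|, fun p hp => ((hC p hp).smul _).mono ?_⟩
  have hvp := hv p hp
  calc ‖((γ p.2.1 : ℝ) : ℂ)‖ * (C * v 0 p)
    _ = |γ p.2.1| * (C * v 0 p) := by rw [Complex.norm_real, Real.norm_eq_abs]
    _ ≤ |γ p.2.1| * (|C| * v 0 p) := by
      gcongr
      exact le_abs_self C
    _ ≤ (C' * brXi p ^ τ) * (|C| * v 0 p) :=
      mul_le_mul_of_nonneg_right (hC' p) (by positivity)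
    _ = C' * |C| * (brXi p ^ τ * v 0 p) := by ring

theorem exists_twistedNormLE_partials_compact_smul (hD : UniqueDiffOn ℝ D) (τ : ℝ)
    (l : List (Direction n)) : ∀ {γ : EuclideanSpace ℝ (Fin n) → ℝ} {b : Phase n → E₀ →L[ℂ] E₁}
      {v : ℕ → Phase n → ℝ}, ContDiff ℝ ∞ γ → HasCompactSupport γ → (∀ j, ∀ p ∈ D, 0 ≤ v j p) →
      SymbolEstimates D r₀ r₁ (fun _ j => v j) b →
      ∃ C : ℝ, ∀ p ∈ D, TwistedNormLE (r₀ p) (r₁ p)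
        (partials D l (fun p => ((γ p.2.1 : ℝ) : ℂ) • b p) p)
        (C * (brXi p ^ τ * v (l.countP Direction.isMu) p)) := by
  induction l using List.reverseRecOn with
  | nil =>
    intro γ b v hγ hsupp hv hb
    exact exists_twistedNormLE_compact_smul hγ.continuous hsupp (hv 0) hb τ
  | append_singleton l e ih =>
    intro γ b v hγ hsupp hv hb
    have hγ' : ContDiff ℝ ∞ fun y => fderiv ℝ γ y e.vec.2.1 :=
      (hγ.fderiv_right (m := ∞) (by simp)).clm_apply contDiff_const
    have hsupp' : HasCompactSupport fun y => fderiv ℝ γ y e.vec.2.1 :=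
      (hsupp.fderiv (𝕜 := ℝ)).comp_left
        (g := fun T : EuclideanSpace ℝ (Fin n) →L[ℝ] ℝ => T e.vec.2.1) rfl
    obtain ⟨c, hc, hbc⟩ := hb.exists_fderiv_smul_eq hD γ e
    obtain ⟨C, hC⟩ := ih hγ hsupp (fun j => hv _) (hb.partials hD [e])
    obtain ⟨C', hC'⟩ := ih hγ' hsupp' (fun j => hv _) hc
    refine ⟨C + C', fun p hp => ?_⟩
    rw [partials_concat_smul hD hb.1 hγ l e hp, funext hbc, add_mul, List.countP_append]
    exact (hC p hp).add (hC' p hp)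

theorem SymbolEstimates.compact_smul (hD : UniqueDiffOn ℝ D) (hγ : ContDiff ℝ ∞ γ)
    (hsupp : HasCompactSupport γ) (hv : ∀ j, ∀ p ∈ D, 0 ≤ v j p)
    (hb : SymbolEstimates D r₀ r₁ (fun _ j => v j) b) (τ : ℝ) :
    SymbolEstimates D r₀ r₁ (fun k j p => brXi p ^ (τ - k) * v j p)
      (fun p => ((γ p.2.1 : ℝ) : ℂ) • b p) :=
  ⟨(contDiff_ofReal_comp_xi hγ).contDiffOn.smul hb.1, fun l =>
    exists_twistedNormLE_partials_compact_smul hD (τ - l.countP Direction.isXi) l hγ hsupp hv hb⟩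

end CompactSupport

/-! ### Direct sums with finite-dimensional spaces -/

section Blocks

variable {E F : Type*} [NormedAddCommGroup E] [NormedSpace ℂ E]
  [NormedAddCommGroup F] [NormedSpace ℂ F]

/-- The operator `u ⊕ z ↦ I u ⊕ z`, where `I` acts on each component of `u`. -/
def blockMap (I : E →L[ℂ] F) (L M : ℕ) : Block E L M →L[ℂ] Block F L M :=
  (ContinuousLinearMap.piMap fun _ => I).prodMap (ContinuousLinearMap.id ℂ _)

variable [KappaSpace E] [KappaSpace F] {I : E →L[ℂ] F} {k : Twist}

theorem dil_blockMap {L M : ℕ} {r : ℝ}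
    (hI : ∀ u v, KappaSpace.dil r u v → KappaSpace.dil r (I u) (I v)) {u v : Block E L M}
    (huv : KappaSpace.dil r u v) : KappaSpace.dil r (blockMap I L M u) (blockMap I L M v) :=
  ⟨huv.1, fun i => hI _ _ (huv.2.1 i), huv.2.2⟩

theorem TwistedNormLE.blockMap {r₀ r₁ C : ℝ} (hr₁ : 0 < r₁) (hI : TwistedNormLE r₀ r₁ I C)
    (L M : ℕ) : TwistedNormLE r₀ r₁ (GreenSymbols.blockMap I L M) (max C 1) := by
  rintro u v ⟨-, huv, hfin⟩
  choose w hw hwu using fun i => hI _ _ (huv i)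
  refine ⟨(w, u.2), ⟨hr₁, hw, hfin⟩, max_le ?_ ?_⟩
  · refine (pi_norm_le_iff_of_nonneg (by positivity)).2 fun i => (hwu i).trans ?_
    gcongr
    exacts [le_max_left _ _, (norm_le_pi_norm u.1 i).trans (norm_fst_le u)]
  · exact (norm_snd_le u).trans (le_mul_of_one_le_left (norm_nonneg u) (le_max_right _ _))

theorem IsTargetTwist.blockMap (hI : IsTargetTwist k I) (L M : ℕ) :
    IsTargetTwist k (GreenSymbols.blockMap I L M) := by
  obtain ⟨C, -, hC⟩ := hI.twist
  exact ⟨fun r _ _ => dil_blockMap (hI.dil r), max C 1, by positivity, fun r' r hr' hle hk =>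
    (hC r' r hr' hle hk).blockMap hr' L M⟩

theorem IsSourceTwist.blockMap (hI : IsSourceTwist k I) (L M : ℕ) :
    IsSourceTwist k (GreenSymbols.blockMap I L M) := by
  obtain ⟨C, -, hC⟩ := hI.twist
  exact ⟨fun r _ _ => dil_blockMap (hI.dil r), max C 1, by positivity, fun r' r hr' hle hk =>
    (hC r' r hr' hle hk).blockMap (hr'.trans_le hle) L M⟩

theorem twistedNormLE_id (r : ℝ) : TwistedNormLE r r (ContinuousLinearMap.id ℂ E) 1 :=
  fun u _ huv => ⟨u, huv, (one_mul ‖u‖).ge⟩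

theorem isTargetTwist_id : IsTargetTwist .bold (ContinuousLinearMap.id ℂ E) :=
  ⟨fun _ _ _ h => h, 1, zero_le_one, fun _ r _ _ hk => hk rfl ▸ twistedNormLE_id r⟩

theorem isSourceTwist_id : IsSourceTwist .bold (ContinuousLinearMap.id ℂ E) :=
  ⟨fun _ _ _ h => h, 1, zero_le_one, fun _ r _ _ hk => hk rfl ▸ twistedNormLE_id r⟩

end Blocks

/-! ### Excision functions -/

section Excision

variable {E F : Type*} [NormedAddCommGroup E] [NormedSpace ℝ E]
  [NormedAddCommGroup F] [NormedSpace ℝ F]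

theorem exists_isExcision [HasContDiffBump E] {ε : ℝ} (hε : 0 < ε) :
    ∃ χ : E → ℝ, IsExcision χ ∧ ∀ y, ε ≤ ‖y‖ → χ y = 1 := by
  let f : ContDiffBump (0 : E) := ⟨ε / 2, ε, half_pos hε, half_lt_self hε⟩
  have hone (y : E) (hy : ε ≤ ‖y‖) : 1 - f y = 1 := by
    rw [f.zero_of_le_dist (by rwa [dist_zero_right]), sub_zero]
  refine ⟨fun y => 1 - f y, ⟨contDiff_const.sub f.contDiff, ?_, ε, hone⟩, hone⟩
  filter_upwards [f.eventuallyEq_one] with y hy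
  rw [hy, Pi.one_apply, sub_self]

theorem IsExcision.hasCompactSupport [ProperSpace E] {χ : E → ℝ} (hχ : IsExcision χ) :
    HasCompactSupport fun y => 1 - χ y := by
  obtain ⟨-, -, R, hR⟩ := hχ
  refine HasCompactSupport.intro (isCompact_closedBall 0 R) fun y hy => ?_
  rw [mem_closedBall_zero_iff, not_le] at hy
  rw [hR y hy.le, sub_self]

theorem IsExcision.exists_mul_eq [HasContDiffBump (E × F)] {χ : E → ℝ} (hχ : IsExcision χ) :
    ∃ χ' : E × F → ℝ, IsExcision χ' ∧ ∀ y, χ y.1 * χ' y = χ y.1 := by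
  obtain ⟨ε, hε, hzero⟩ := Metric.eventually_nhds_iff.1 hχ.2.1
  obtain ⟨χ', hχ', hone⟩ := exists_isExcision (E := E × F) hε
  refine ⟨χ', hχ', fun y => ?_⟩
  rcases lt_or_ge ‖y.1‖ ε with hy | hy
  · rw [hzero (by rwa [dist_zero_right]), zero_mul]
  · rw [hone y (hy.trans (norm_fst_le y)), mul_one]

end Excision

/-! ### From strongly to weakly parameter-dependent symbols -/

theorem comp_sub_sum_smul_comp {E₀ E₁ F₀ F₁ : Type*} [NormedAddCommGroup E₀] [NormedSpace ℂ E₀]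
    [NormedAddCommGroup E₁] [NormedSpace ℂ E₁] [NormedAddCommGroup F₀] [NormedSpace ℂ F₀]
    [NormedAddCommGroup F₁] [NormedSpace ℂ F₁] (I : F₀ →L[ℂ] E₀) (J : E₁ →L[ℂ] F₁)
    (T : E₀ →L[ℂ] E₁) (h : ℕ → E₀ →L[ℂ] E₁) {x y : ℝ} (hxy : y * x = y) (N : ℕ) :
    J ∘L T ∘L I - ∑ j ∈ Finset.range N, (y : ℂ) • (J ∘L h j ∘L I) =
      J ∘L (T - ∑ j ∈ Finset.range N, (x : ℂ) • h j) ∘L I +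
        ∑ j ∈ Finset.range N, ((1 - y : ℝ) : ℂ) • (J ∘L ((x : ℂ) • h j) ∘L I) := by
  ext1 u
  simp only [sub_apply, add_apply, sum_apply, smul_apply, ContinuousLinearMap.comp_apply, map_sub,
    map_sum, map_smul]
  rw [sub_add, ← Finset.sum_sub_distrib]
  congr 1
  refine Finset.sum_congr rfl fun j _ => ?_
  rw [smul_smul, ← sub_smul, ← Complex.ofReal_mul, ← Complex.ofReal_sub, sub_mul, one_mul, hxy,
    sub_sub_cancel]

section Passage

variable {n : ℕ} {E₀ E₁ F₀ F₁ : Type*}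
  [NormedAddCommGroup E₀] [NormedSpace ℂ E₀] [KappaSpace E₀]
  [NormedAddCommGroup E₁] [NormedSpace ℂ E₁] [KappaSpace E₁]
  [NormedAddCommGroup F₀] [NormedSpace ℂ F₀] [KappaSpace F₀]
  [NormedAddCommGroup F₁] [NormedSpace ℂ F₁] [KappaSpace F₁]
  {k₀ k₁ : Twist} {I : F₀ →L[ℂ] E₀} {J : E₁ →L[ℂ] F₁} {d d' ν : ℝ} {a : Phase n → E₀ →L[ℂ] E₁}

theorem SymbolEstimates.comp_twist {D D' : Set (Phase n)} (hD : UniqueDiffOn ℝ D)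
    (hD' : UniqueDiffOn ℝ D') (hsub : D' ⊆ D) (hI : IsSourceTwist k₀ I) (hJ : IsTargetTwist k₁ J)
    {r : Phase n → ℝ} {r' : Twist → Phase n → ℝ} {w : ℕ → ℕ → Phase n → ℝ}
    (hr' : ∀ k, ∀ p ∈ D', 0 < r' k p ∧ r' k p ≤ r p ∧ (k = .bold → r' k p = r p))
    (hw : ∀ k j, ∀ p ∈ D, 0 ≤ w k j p) (ha : SymbolEstimates D r r w a) :
    SymbolEstimates D' (r' k₀) (r' k₁) w (fun p => J ∘L a p ∘L I) := by
  obtain ⟨C₀, -, hC₀⟩ := hI.twist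
  obtain ⟨C₁, hC₁_nonneg, hC₁⟩ := hJ.twist
  exact ha.comp hD hD' hsub hw hC₁_nonneg
    (fun p hp => hC₀ _ _ (hr' k₀ p hp).1 (hr' k₀ p hp).2.1 (hr' k₀ p hp).2.2)
    (fun p hp => hC₁ _ _ (hr' k₁ p hp).1 (hr' k₁ p hp).2.1 (hr' k₁ p hp).2.2)

theorem KappaHomogeneous.comp {D D' : Set (Phase n)} (hsub : D' ⊆ D)
    (hI : ∀ r u v, KappaSpace.dil r u v → KappaSpace.dil r (I u) (I v))
    (hJ : ∀ r u v, KappaSpace.dil r u v → KappaSpace.dil r (J u) (J v))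
    (ha : KappaHomogeneous D d a) : KappaHomogeneous D' d (fun p => J ∘L a p ∘L I) := by
  intro p hp r hr u v huv
  have h := hJ _ _ _ (ha p (hsub hp) r hr _ _ (hI _ _ _ huv))
  rwa [map_smul] at h

theorem rpow_sub_sub_le_rpow_mul_rpow {x y : ℝ} (hx : 0 < x) (hxy : x ≤ y) (hν : ν ≤ 0)
    (d : ℝ) (k j : ℕ) : y ^ (d - k - j) ≤ x ^ (ν - k) * y ^ (d - ν - j) := by
  have hexp : d - k - j = (ν - k) + (d - ν - j) := by ring
  rw [hexp]
  exact rpow_add_le_rpow_mul_rpow hx hxy (sub_nonpos.2 (hν.trans k.cast_nonneg))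

theorem StrongSymbol.comp_twist (hI : IsSourceTwist k₀ I) (hJ : IsTargetTwist k₁ J)
    (ha : StrongSymbol d a) :
    SymbolEstimates (fullDomain n) k₀.bracket k₁.bracket (fun k j p => brXiMu p ^ (d - k - j))
      (fun p => J ∘L a p ∘L I) :=
  SymbolEstimates.comp_twist (uniqueDiffOn_fullDomain n) (uniqueDiffOn_fullDomain n) subset_rfl
    hI hJ (fun k p _ => ⟨k.bracket_pos p, k.bracket_le p, Twist.bracket_eq p⟩)
    (fun _ _ p _ => Real.rpow_nonneg (brXiMu_pos p).le _) ha

theorem StrongSymbol.comp_weakSymbol (hI : IsSourceTwist k₀ I) (hJ : IsTargetTwist k₁ J)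
    (hν : ν ≤ 0) (ha : StrongSymbol d a) : WeakSymbol k₀ k₁ d ν (fun p => J ∘L a p ∘L I) :=
  (ha.comp_twist hI hJ).mono (fun _ _ p _ => Real.rpow_nonneg (brXiMu_pos p).le _)
    fun k j p _ => rpow_sub_sub_le_rpow_mul_rpow (brXi_pos p) (brXi_le_brXiMu p) hν d k j

theorem StrongHomogeneous.comp_weakHomogeneous (hI : IsSourceTwist k₀ I) (hJ : IsTargetTwist k₁ J)
    (hν : ν ≤ 0) (ha : StrongHomogeneous d a) :
    WeakHomogeneous k₀ k₁ d ν (fun p => J ∘L a p ∘L I) := by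
  have hsub := weakDomain_subset n
  have hw : ∀ k j : ℕ, ∀ p ∈ strongDomain n, 0 ≤ absXiMu p ^ (d - k - j) :=
    fun k j p hp => Real.rpow_nonneg (absXiMu_pos hp).le _
  have hest := SymbolEstimates.comp_twist (uniqueDiffOn_strongDomain n) (uniqueDiffOn_weakDomain n)
    hsub hI hJ (fun k p hp => ⟨k.modulus_pos hp, k.modulus_le p, Twist.modulus_eq p⟩) hw ha.2
  exact ⟨ha.1.comp hsub hI.dil hJ.dil, hest.mono (fun k j p hp => hw k j p (hsub hp))
    fun k j p hp => rpow_sub_sub_le_rpow_mul_rpow (absXi_pos hp) (absXi_le_absXiMu p) hν d k j⟩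

theorem StrongSymbol.mono (ha : StrongSymbol d a) (h : d ≤ d') : StrongSymbol d' a :=
  SymbolEstimates.mono ha (fun _ _ p _ => Real.rpow_nonneg (brXiMu_pos p).le _)
    fun _ _ p _ => Real.rpow_le_rpow_of_exponent_le (one_le_brXiMu p) (by linarith)

theorem StrongSymbol.smul_of_forall_sub_sum [LinearKappaSpace E₁]
    {h : ℕ → Phase n → E₀ →L[ℂ] E₁} {χ : EuclideanSpace ℝ (Fin n) × ℝ → ℝ}
    (hah : ∀ N : ℕ, StrongSymbol (d - N)
      (fun p => a p - ∑ j ∈ Finset.range N, ((χ p.2 : ℝ) : ℂ) • h j p)) (j : ℕ) :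
    StrongSymbol (d - j) (fun p => ((χ p.2 : ℝ) : ℂ) • h j p) := by
  have hle : d - (j + 1 : ℕ) ≤ d - j := by
    push_cast
    linarith
  have hterm : (fun p => ((χ p.2 : ℝ) : ℂ) • h j p) =
      (fun p => a p - ∑ i ∈ Finset.range j, ((χ p.2 : ℝ) : ℂ) • h i p) -
        fun p => a p - ∑ i ∈ Finset.range (j + 1), ((χ p.2 : ℝ) : ℂ) • h i p := by
    funext p
    rw [Pi.sub_apply, Finset.sum_range_succ]
    abel
  rw [hterm]
  exact SymbolEstimates.sub (uniqueDiffOn_fullDomain n) (hah j) ((hah (j + 1)).mono hle)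

theorem StrongSymbol.compact_smul_comp_weakSymbol [LinearKappaSpace F₁]
    (hI : IsSourceTwist k₀ I) (hJ : IsTargetTwist k₁ J) {γ : EuclideanSpace ℝ (Fin n) → ℝ}
    (hγ : ContDiff ℝ ∞ γ) (hsupp : HasCompactSupport γ) (hd : d ≤ d' - ν) (ha : StrongSymbol d a) :
    WeakSymbol k₀ k₁ d' ν (fun p => ((γ p.2.1 : ℝ) : ℂ) • (J ∘L a p ∘L I)) := by
  have hv (j : ℕ) (p : Phase n) : 0 ≤ brXiMu p ^ (d' - ν - j) :=
    Real.rpow_nonneg (brXiMu_pos p).le _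
  have hest : SymbolEstimates (fullDomain n) k₀.bracket k₁.bracket
      (fun _ j p => brXiMu p ^ (d' - ν - j)) (fun p => J ∘L a p ∘L I) :=
    (ha.comp_twist hI hJ).mono (fun _ _ p _ => Real.rpow_nonneg (brXiMu_pos p).le _)
      fun k j p _ => Real.rpow_le_rpow_of_exponent_le (one_le_brXiMu p)
        (by linarith [k.cast_nonneg (α := ℝ)])
  exact hest.compact_smul (uniqueDiffOn_fullDomain n) hγ hsupp (fun j p _ => hv j p) ν

/-- The cut-offs `χ (ξ, μ)` and `χ' ξ` of the two kinds of expansions differ by functions of compact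
support in `ξ`, which have arbitrarily low order with respect to `ξ`. -/
theorem StrongClassical.comp_weakClassical [LinearKappaSpace E₁] [LinearKappaSpace F₁]
    (hI : IsSourceTwist k₀ I) (hJ : IsTargetTwist k₁ J) (hν : ν ≤ 0) (ha : StrongClassical d a) :
    WeakClassical k₀ k₁ d ν (fun p => J ∘L a p ∘L I) := by
  obtain ⟨ha, h, hh, hah⟩ := ha
  have hνN (N : ℕ) : ν - N ≤ 0 := sub_nonpos.2 (hν.trans N.cast_nonneg)
  refine ⟨ha.comp_weakSymbol hI hJ hν, fun j p => J ∘L h j p ∘L I,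
    fun j => (hh j).comp_weakHomogeneous hI hJ (hνN j), fun χ' hχ' N => ?_⟩
  obtain ⟨χ, hχ, hχ'χ⟩ := hχ'.exists_mul_eq (F := ℝ)
  have hterm (j : ℕ) : WeakSymbol k₀ k₁ (d - N) (ν - N) (fun p =>
      ((1 - χ' p.2.1 : ℝ) : ℂ) • (J ∘L (((χ p.2 : ℝ) : ℂ) • h j p) ∘L I)) :=
    (StrongSymbol.smul_of_forall_sub_sum (hah χ hχ) j).compact_smul_comp_weakSymbol hI hJ
      (contDiff_const.sub hχ'.1) hχ'.hasCompactSupport (by linarith [j.cast_nonneg (α := ℝ)])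
  have hD := uniqueDiffOn_fullDomain n
  have hsum : WeakSymbol k₀ k₁ (d - N) (ν - N) _ :=
    SymbolEstimates.add hD ((hah χ hχ N).comp_weakSymbol hI hJ (hνN N))
      (SymbolEstimates.sum hD (fun p _ => k₁.bracket_pos p) (Finset.range N) fun j _ => hterm j)
  convert hsum using 1
  funext p
  rw [Pi.add_apply, Finset.sum_apply]
  exact comp_sub_sum_smul_comp I J (a p) (h · p) (hχ'χ p.2) N

end Passage

/-! ### Sums of symbols -/

section Sums

variable {n : ℕ} {E₀ E₁ : Type*} [NormedAddCommGroup E₀] [NormedSpace ℂ E₀] [KappaSpace E₀]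
  [NormedAddCommGroup E₁] [NormedSpace ℂ E₁] [KappaSpace E₁] [LinearKappaSpace E₁]
  {k₀ k₁ : Twist} {d ν : ℝ} {a b : Phase n → E₀ →L[ℂ] E₁}

theorem KappaHomogeneous.add {D : Set (Phase n)} (ha : KappaHomogeneous D d a)
    (hb : KappaHomogeneous D d b) : KappaHomogeneous D d (a + b) := fun p hp r hr u v huv => by
  simp only [Pi.add_apply, add_apply, smul_add]
  exact dil_add (ha p hp r hr u v huv) (hb p hp r hr u v huv)

theorem WeakHomogeneous.add (ha : WeakHomogeneous k₀ k₁ d ν a) (hb : WeakHomogeneous k₀ k₁ d ν b) :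
    WeakHomogeneous k₀ k₁ d ν (a + b) :=
  ⟨ha.1.add hb.1, ha.2.add (uniqueDiffOn_weakDomain n) hb.2⟩

theorem WeakSymbol.add (ha : WeakSymbol k₀ k₁ d ν a) (hb : WeakSymbol k₀ k₁ d ν b) :
    WeakSymbol k₀ k₁ d ν (a + b) :=
  SymbolEstimates.add (uniqueDiffOn_fullDomain n) ha hb

theorem WeakClassical.add (ha : WeakClassical k₀ k₁ d ν a) (hb : WeakClassical k₀ k₁ d ν b) :
    WeakClassical k₀ k₁ d ν (a + b) := by
  obtain ⟨ha, h, hh, hah⟩ := ha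
  obtain ⟨hb, h', hh', hbh'⟩ := hb
  refine ⟨ha.add hb, fun j => h j + h' j, fun j => (hh j).add (hh' j),
    fun χ hχ N => ?_⟩
  convert (hah χ hχ N).add (hbh' χ hχ N) using 1
  funext p
  simp only [Pi.add_apply, smul_add, Finset.sum_add_distrib]
  abel

theorem kappaHomogeneous_zero (D : Set (Phase n)) (d : ℝ) :
    KappaHomogeneous D d (0 : Phase n → E₀ →L[ℂ] E₁) := fun _ _ r hr u v _ => by
  simpa only [Pi.zero_apply, zero_apply, smul_zero] using dil_zero hr

theorem strongClassical_zero (d : ℝ) : StrongClassical d (0 : Phase n → E₀ →L[ℂ] E₁) := by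
  have hzero (d : ℝ) : StrongSymbol d (0 : Phase n → E₀ →L[ℂ] E₁) :=
    symbolEstimates_zero fun p _ => brXiMu_pos p
  refine ⟨hzero d, 0, fun j => ⟨kappaHomogeneous_zero _ _,
    symbolEstimates_zero fun p hp => absXiMu_pos hp⟩, fun χ _ N => ?_⟩
  convert hzero (d - N) using 1
  funext p
  simp only [Pi.zero_apply, smul_zero, Finset.sum_const_zero, sub_zero]

end Sums

/-! ### Green symbols -/

/-- Target spaces whose embedding into the distributions is additive. -/
class LinearTargetSpace (E : Type*) [NormedAddCommGroup E] [TargetSpace E] : Prop where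
  toDist_add : ∀ u v : E, TargetSpace.toDist (u + v) = TargetSpace.toDist u + TargetSpace.toDist v

open LinearTargetSpace

instance (s δ : ℝ) : LinearTargetSpace (HPlus s δ) where
  toDist_add := map_add (hPlusDist s δ)

instance (s γ δ : ℝ) : LinearTargetSpace (Cone s γ δ) where
  toDist_add _ _ := rfl

theorem toDist_zero {E : Type*} [NormedAddCommGroup E] [TargetSpace E] [LinearTargetSpace E] :
    TargetSpace.toDist (0 : E) = 0 := by
  simpa only [add_zero, left_eq_add] using toDist_add (0 : E) 0

section Realizations

variable {n L M L' M' : ℕ} {E₀ E₁ F₀ F₁ : Type*}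
  [NormedAddCommGroup E₀] [NormedSpace ℂ E₀] [SourceSpace E₀]
  [NormedAddCommGroup E₁] [NormedSpace ℂ E₁] [TargetSpace E₁]
  [NormedAddCommGroup F₀] [NormedSpace ℂ F₀] [SourceSpace F₀]
  [NormedAddCommGroup F₁] [NormedSpace ℂ F₁] [TargetSpace F₁]
  {D D' : Set (Phase n)} {a b : Phase n → Block E₀ L M →L[ℂ] Block E₁ L' M'}

theorem Realizes.comp_blockMap {I : F₀ →L[ℂ] E₀} {J : E₁ →L[ℂ] F₁}
    (hI : ∀ φ u, SourceSpace.isTest φ u → SourceSpace.isTest φ (I u))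
    (hJ : ∀ w, TargetSpace.toDist (J w) = TargetSpace.toDist w) (hsub : D' ⊆ D)
    {g : D → GreenOp L M L' M'} (ha : Realizes a g) :
    Realizes (fun p => blockMap J L' M' ∘L a p ∘L blockMap I L M)
      (fun p : D' => g (Set.inclusion hsub p)) := by
  intro p φ u hu
  obtain ⟨hdist, hfin⟩ := ha (Set.inclusion hsub p) φ (fun i => I (u i)) fun i => hI _ _ (hu i)
  exact ⟨fun i => (hJ _).trans (hdist i), hfin⟩

theorem Realizes.add [LinearTargetSpace E₁] {g g' : D → GreenOp L M L' M'} (ha : Realizes a g)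
    (hb : Realizes b g') : Realizes (a + b) (g + g') := by
  intro p φ u hu
  obtain ⟨hdist, hfin⟩ := ha p φ u hu
  obtain ⟨hdist', hfin'⟩ := hb p φ u hu
  exact ⟨fun i => (toDist_add _ _).trans (congrArg₂ (· + ·) (hdist i) (hdist' i)),
    congrArg₂ (· + ·) hfin hfin'⟩

theorem realizes_zero [LinearTargetSpace E₁] :
    Realizes (0 : Phase n → Block E₀ L M →L[ℂ] Block E₁ L' M') (0 : D → GreenOp L M L' M') :=
  fun _ _ _ _ => ⟨fun _ => toDist_zero, rfl⟩

end Realizations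

section Membership

variable {n L M L' M' : ℕ} {E₀ E₁ F₀ F₁ : Type*}
  [NormedAddCommGroup E₀] [NormedSpace ℂ E₀] [KappaSpace E₀] [SourceSpace E₀]
  [NormedAddCommGroup E₁] [NormedSpace ℂ E₁] [KappaSpace E₁] [TargetSpace E₁]
  [NormedAddCommGroup F₀] [NormedSpace ℂ F₀] [KappaSpace F₀] [SourceSpace F₀]
  [NormedAddCommGroup F₁] [NormedSpace ℂ F₁] [KappaSpace F₁] [TargetSpace F₁]
  {k₀ k₁ : Twist} {I : F₀ →L[ℂ] E₀} {J : E₁ →L[ℂ] F₁} {d ν : ℝ}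

theorem MemStrong.memWeak [LinearKappaSpace E₁] [LinearKappaSpace F₁] (hν : ν ≤ 0)
    (hI : IsSourceTwist k₀ I ∧ ∀ φ u, SourceSpace.isTest φ u → SourceSpace.isTest φ (I u))
    (hJ : IsTargetTwist k₁ J ∧ ∀ w, TargetSpace.toDist (J w) = TargetSpace.toDist w)
    {g : fullDomain n → GreenOp L M L' M'} (hg : MemStrong E₀ E₁ d g) :
    MemWeak F₀ F₁ k₀ k₁ d ν g := by
  obtain ⟨a, ha, hag⟩ := hg
  exact ⟨_, ha.comp_weakClassical (hI.1.blockMap L M) (hJ.1.blockMap L' M') hν,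
    hag.comp_blockMap hI.2 hJ.2 subset_rfl⟩

theorem MemStrongHom.memWeakHom (hν : ν ≤ 0)
    (hI : IsSourceTwist k₀ I ∧ ∀ φ u, SourceSpace.isTest φ u → SourceSpace.isTest φ (I u))
    (hJ : IsTargetTwist k₁ J ∧ ∀ w, TargetSpace.toDist (J w) = TargetSpace.toDist w)
    {g : strongDomain n → GreenOp L M L' M'} (hg : MemStrongHom E₀ E₁ d g) :
    MemWeakHom F₀ F₁ k₀ k₁ d ν (fun p => g (Set.inclusion (weakDomain_subset n) p)) := by
  obtain ⟨a, ha, hag⟩ := hg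
  exact ⟨_, ha.comp_weakHomogeneous (hI.1.blockMap L M) (hJ.1.blockMap L' M') hν,
    hag.comp_blockMap hI.2 hJ.2 (weakDomain_subset n)⟩

theorem MemWeak.add [LinearKappaSpace E₁] [LinearTargetSpace E₁]
    {g g' : fullDomain n → GreenOp L M L' M'} (hg : MemWeak E₀ E₁ k₀ k₁ d ν g)
    (hg' : MemWeak E₀ E₁ k₀ k₁ d ν g') : MemWeak E₀ E₁ k₀ k₁ d ν (g + g') := by
  obtain ⟨a, ha, hag⟩ := hg
  obtain ⟨b, hb, hbg'⟩ := hg'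
  exact ⟨a + b, ha.add hb, hag.add hbg'⟩

theorem memStrong_zero [LinearKappaSpace E₁] [LinearTargetSpace E₁] :
    MemStrong E₀ E₁ d (0 : fullDomain n → GreenOp L M L' M') :=
  ⟨0, strongClassical_zero d, realizes_zero⟩

end Membership

section Green

variable {n L M L' M' : ℕ} {d ν : ℝ}

theorem strongGreen_subset_weakGreen (hν : ν ≤ 0) :
    StrongGreen n L M L' M' d ⊆ WeakGreen n L M L' M' d ν := by
  intro g hg s s' δ δ'
  obtain ⟨k, ε, I, hI⟩ := exists_sourceEmbedding s δ
  obtain ⟨k', ε', J, hJ⟩ := exists_targetEmbedding s' δ'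
  exact ⟨(hg s s' 0 0).memWeak hν ⟨isSourceTwist_id, fun _ _ h => h⟩
      ⟨isTargetTwist_id, fun _ => rfl⟩,
    (hg s k' 0 ε').memWeak hν ⟨isSourceTwist_id, fun _ _ h => h⟩ hJ,
    (hg k s' ε 0).memWeak hν hI ⟨isTargetTwist_id, fun _ => rfl⟩,
    (hg k k' ε ε').memWeak hν hI hJ⟩

theorem restrict_mem_weakGreenHom (hν : ν ≤ 0) {g : strongDomain n → GreenOp L M L' M'}
    (hg : g ∈ StrongGreenHom n L M L' M' d) :
    (fun p => g (Set.inclusion (weakDomain_subset n) p)) ∈ WeakGreenHom n L M L' M' d ν := by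
  intro s s' δ δ'
  obtain ⟨k, ε, I, hI⟩ := exists_sourceEmbedding s δ
  obtain ⟨k', ε', J, hJ⟩ := exists_targetEmbedding s' δ'
  exact ⟨(hg s s' 0 0).memWeakHom hν ⟨isSourceTwist_id, fun _ _ h => h⟩
      ⟨isTargetTwist_id, fun _ => rfl⟩,
    (hg s k' 0 ε').memWeakHom hν ⟨isSourceTwist_id, fun _ _ h => h⟩ hJ,
    (hg k s' ε 0).memWeakHom hν hI ⟨isTargetTwist_id, fun _ => rfl⟩,
    (hg k k' ε ε').memWeakHom hν hI hJ⟩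

theorem add_mem_weakGreen {g g' : fullDomain n → GreenOp L M L' M'}
    (hg : g ∈ WeakGreen n L M L' M' d ν) (hg' : g' ∈ WeakGreen n L M L' M' d ν) :
    g + g' ∈ WeakGreen n L M L' M' d ν := by
  intro s s' δ δ'
  obtain ⟨hbb, hbp, hpb, hpp⟩ := hg s s' δ δ'
  obtain ⟨hbb', hbp', hpb', hpp'⟩ := hg' s s' δ δ'
  exact ⟨hbb.add hbb', hbp.add hbp', hpb.add hpb', hpp.add hpp'⟩

theorem zero_mem_strongGreen : 0 ∈ StrongGreen n L M L' M' d := fun _ _ _ _ => memStrong_zero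

theorem green_eq_weakGreen (hν : ν ≤ 0) : Green n L M L' M' d ν = WeakGreen n L M L' M' d ν := by
  refine Set.Subset.antisymm ?_ fun g hg => ⟨0, zero_mem_strongGreen, g, hg, (zero_add g).symm⟩
  rintro _ ⟨g, hg, g', hg', rfl⟩
  exact add_mem_weakGreen (strongGreen_subset_weakGreen hν hg) hg'

end Green

end GreenSymbols

end

theorem mainTheorem7 (n L M L' M' : ℕ) (d : ℝ) :
    GreenSymbols.StrongGreen n L M L' M' d ⊆ GreenSymbols.WeakGreen n L M L' M' d 0 ∧
    (∀ g ∈ GreenSymbols.StrongGreenHom n L M L' M' d,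
      (fun p => g (Set.inclusion (GreenSymbols.weakDomain_subset n) p)) ∈
        GreenSymbols.WeakGreenHom n L M L' M' d 0) ∧
    (∀ ν : ℝ, ν ≤ 0 →
      GreenSymbols.Green n L M L' M' d ν = GreenSymbols.WeakGreen n L M L' M' d ν) :=
  ⟨GreenSymbols.strongGreen_subset_weakGreen le_rfl,
    fun _ hg => GreenSymbols.restrict_mem_weakGreenHom le_rfl hg,
    fun _ hν => GreenSymbols.green_eq_weakGreen hν⟩
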